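/- **Setting.** Let $\mathcal X$ be a finite set of inputs and let $(x^{(j)},y^{(j)})_{j=1}^n$, $n\ge 1$, be a training set, with $x^{(j)}\in\mathcal X$, $y^{(j)}\in\mathbb R$, $X=(x^{(j)})_j$, $Y=(y^{(j)})_j$. For each $m$ consider a quantum circuit on $m$ qubits with $L=L(m)$ layers, $U(\Theta,x)=V_L(x)W_L(\Theta)\cdots V_1(x)W_1(\Theta)$, where $W_\ell(\Theta)=\bigotimes_{k=1}^m e^{-i\mathcal G_{\ell,k}\theta_{\ell,k}}$ with Hermitian single-qubit generators $\mathcal G_{\ell,k}$ of spectrum $\{-1,1\}$, and $V_\ell(x)$ is a tensor product of one- and two-qubit unitary gates on disjoint qubits, which may depend on $x$ (which qubits interact does not depend on $x$). Let $O_k$ be a Hermitian traceless single-qubit observable on qubit $k$ with spectrum in $[-1,1]$, and put $$f_k(\Theta,x)=\langle 0^m|U^\dagger O_kU|0^m\rangle,\qquad f(\Theta,x)=\frac1{N(m)}\sum_{k=1}^m f_k(\Theta,x).$$ Let $\mathcal I_{\ell,k}$ consist of $k$ and the qubit interacting with $k$ in layer $\ell$ (if any); $\mathcal J^L_k=\mathcal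 I_{L,k}$, $\mathcal J^\ell_k=\bigcup_{k'\in\mathcal J^{\ell+1}_k}\mathcal I_{\ell,k'}$ for $\ell<L$; $\mathcal N_k=\{(\ell,k'):k'\in\mathcal J^\ell_k\}$ and $\mathcal M_i=\{k:i\in\mathcal N_k\}$. Write $|\mathcal N|=\max_k|\mathcal N_k|$, $|\mathcal M|=\max_i|\mathcal M_i|$, $|\Theta|=Lm$. Let $\mathcal L(\Theta)=\frac1{2n}\sum_j(f(\Theta,x^{(j)})-y^{(j)})^2$ and $\hat K_\Theta(x,x')=\frac1{N_K(m)}\nabla_\Theta f(\Theta,x)\cdot\nabla_\Theta f(\Theta,x')$. The parameters $\Theta_0$ are initialized independently and uniformly in $[0,\pi]$; below, $\mathbb E_0$ is the expectation over this law. **Assumptions.** 1. $\mathbb E_0[f_k(\Theta,x)]=0$ for all $m,k,x$, and $\mathbb E_0[f(\Theta,x)f(\Theta,x')]\to\mathcal K_0(x,x')$ as $m\to\infty$, uniformly in $x,x'$, with $\mathcal K_0(x,x)>0$ for all $x$. 2. (NTK) $\mathbb E_0[\hat K_\Theta(x,x')]\to\bar K(x,x')$ as $m\to\infty$, uniformly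 in $x,x'$, where $\bar K$ is not identically zero and the smallest eigenvalue $\lambda^K_{\min}$ of the matrix $\bar K:=\bar K(X,X^T)$ is strictly positive. 3. $N(m)\to\infty$ and $\dfrac{L^2m^2|\mathcal M|^6|\mathcal N|^4}{N^5(m)}\log N(m)\to0$ as $m\to\infty$. 4. Fix $\eta_0>0$, $\delta>0$ and $T\in\mathbb N$, and let $\eta=\frac{n}{N_K(m)}\eta_0$. The training is $\Theta_{t+1}=\Theta_t-\eta\,g^{(t)}(\Theta_t)$, where the random vectors $g^{(t)}(\Theta_t)$ are square integrable and, with $\mathcal F_t=\sigma\big(\Theta_0,\,g^{(k)}(\Theta_k),\,k<t\big)$, for all $t\le T$, all $m$ and all parameter indices $i$, almost surely $$\mathbb E\big[g^{(t)}_i(\Theta_t)\,\big|\,\mathcal F_t\big]=\partial_{\theta_i}\mathcal L(\Theta_t),$$ $$\mathrm{Var}\big[g^{(t)}_i(\Theta_t)\,\big|\,\mathcal F_t\big]\le c_0\,\eta_0^2\,\frac{(\lambda_{\min}^K)^4}{n^2}\,\frac{N_K^2(m)}{|\mathcal M|^2|\Theta|^3}\,\frac{\delta/4}{(t+1)^2}\,\mathcal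 L(\Theta_t),\qquad c_0=\frac1{864\pi^2}.$$ **Theorem.** For every training time $t\le T$, as $m\to\infty$ the random function $\{f(\Theta_t,x)\}_{x\in\mathcal X}$ converges in distribution to a Gaussian process with mean and covariance $$\mu_t(x)=\bar K(x,X^T)\bar K^{-1}A_tY,$$ $$\begin{aligned}\mathcal K_t(x,x')={}&\mathcal K_0(x,x')-\bar K(x,X^T)\bar K^{-1}A_t\,\mathcal K_0(X,x')-\bar K(x',X^T)\bar K^{-1}A_t\,\mathcal K_0(X,x)\\&+\bar K(x,X^T)\bar K^{-1}A_t\,\mathcal K_0(X,X^T)\,A_t\bar K^{-1}\bar K(X,x'),\end{aligned}$$ where $A_t=\mathbb 1-(\mathbb 1-\eta_0\bar K)^t$. -/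

import Mathlib

open MeasureTheory ProbabilityTheory Filter Topology

noncomputable section

namespace QNN

/-- The operator `A 0 ⊗ A 1 ⊗ ⋯ ⊗ A (m - 1)` on `(ℂ²)^{⊗ m}`, written in the computational basis,
whose vectors are indexed by bit strings `Fin m → Fin 2`. -/
def tensorOp {m : ℕ} (A : Fin m → Matrix (Fin 2) (Fin 2) ℂ) :
    Matrix (Fin m → Fin 2) (Fin m → Fin 2) ℂ :=
  Matrix.of fun s s' => ∏ k, A k (s k) (s' k)

/-- The operator `1 ⊗ ⋯ ⊗ 1 ⊗ A ⊗ 1 ⊗ ⋯ ⊗ 1` acting as `A` on the qubit `k`. -/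
def onQubit {m : ℕ} (k : Fin m) (A : Matrix (Fin 2) (Fin 2) ℂ) :
    Matrix (Fin m → Fin 2) (Fin m → Fin 2) ℂ :=
  tensorOp (Function.update (fun _ => 1) k A)

/-- The smallest eigenvalue of a real (symmetric) matrix. -/
def minEigenvalue {n : ℕ} (A : Matrix (Fin n) (Fin n) ℝ) : ℝ := sInf (spectrum ℝ A)

/-- The partial derivative `∂F/∂θ_i` at `Θ`. -/
def partialDeriv {ι : Type*} [Fintype ι] [DecidableEq ι] (F : (ι → ℝ) → ℝ) (i : ι) (Θ : ι → ℝ) : ℝ :=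
  fderiv ℝ F Θ (Pi.single i 1)

/-- A parameterized quantum circuit on `m` qubits with inputs in `𝒳`: an arbitrary number of layers,
each of which consists of one parameterized single-qubit gate `exp (-i 𝒢 θ)` on every qubit, followed
by fixed one- and two-qubit gates on disjoint qubits, which may depend on the input; and a traceless
single-qubit observable for every qubit. -/
structure Circuit (𝒳 : Type*) (m : ℕ) where
  /-- the number of layers -/
  depth : ℕ
  /-- `partner ℓ k` is the qubit with which `k` shares a two-qubit gate in the layer `ℓ`, and it is
  `k` itself if `k` carries no two-qubit gate in that layer -/
  partner : Fin depth → Fin m → Fin m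
  partner_involutive : ∀ ℓ, Function.Involutive (partner ℓ)
  /-- the one-qubit gates of `V_ℓ(x)`; used on the qubits `k` with `partner ℓ k = k` -/
  gate₁ : Fin depth → Fin m → 𝒳 → Matrix.unitaryGroup (Fin 2) ℂ
  /-- the two-qubit gates of `V_ℓ(x)`; `gate₂ ℓ k` acts on the pair of qubits `(k, partner ℓ k)` and
  is used for `k < partner ℓ k` -/
  gate₂ : Fin depth → Fin m → 𝒳 → Matrix.unitaryGroup (Fin 2 × Fin 2) ℂ
  /-- the generators of the parameterized gates -/
  generator : Fin depth → Fin m → Matrix (Fin 2) (Fin 2) ℂ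
  generator_isHermitian : ∀ ℓ k, (generator ℓ k).IsHermitian
  generator_spectrum : ∀ ℓ k, spectrum ℝ (generator ℓ k) = {-1, 1}
  /-- the single-qubit observables -/
  obs : Fin m → Matrix (Fin 2) (Fin 2) ℂ
  obs_isHermitian : ∀ k, (obs k).IsHermitian
  obs_trace : ∀ k, (obs k).trace = 0
  obs_spectrum : ∀ k, spectrum ℝ (obs k) ⊆ Set.Icc (-1) 1

namespace Circuit

variable {𝒳 : Type*} {m : ℕ} (C : Circuit 𝒳 m)

/-- Parameter vectors: `θ_(ℓ, k)` is the parameter of the gate on the qubit `k` in the layer `ℓ`. -/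
abbrev Params : Type := Fin C.depth × Fin m → ℝ

/-- The parameterized gate `exp (-i 𝒢 θ)`. -/
def paramGate (Θ : C.Params) (ℓ : Fin C.depth) (k : Fin m) : Matrix (Fin 2) (Fin 2) ℂ :=
  NormedSpace.exp ((-(Complex.I * (Θ (ℓ, k) : ℂ))) • C.generator ℓ k)

/-- The unitary `V_ℓ(x)`: the tensor product of all its one- and two-qubit gates. -/
def encoding (x : 𝒳) (ℓ : Fin C.depth) : Matrix (Fin m → Fin 2) (Fin m → Fin 2) ℂ :=
  Matrix.of fun s s' =>
    (∏ k with C.partner ℓ k = k, (C.gate₁ ℓ k x : Matrix (Fin 2) (Fin 2) ℂ) (s k) (s' k)) *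
    (∏ k with k < C.partner ℓ k,
      (C.gate₂ ℓ k x : Matrix (Fin 2 × Fin 2) (Fin 2 × Fin 2) ℂ)
        (s k, s (C.partner ℓ k)) (s' k, s' (C.partner ℓ k)))

/-- The layer `U_ℓ(Θ, x) = V_ℓ(x) (W_(ℓ,1) ⊗ ⋯ ⊗ W_(ℓ,m))(Θ)`. -/
def layer (Θ : C.Params) (x : 𝒳) (ℓ : Fin C.depth) :
    Matrix (Fin m → Fin 2) (Fin m → Fin 2) ℂ :=
  C.encoding x ℓ * tensorOp (C.paramGate Θ ℓ)

/-- The circuit `U(Θ, x) = U_L(Θ, x) ⋯ U_1(Θ, x)`. -/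
def unitary (Θ : C.Params) (x : 𝒳) : Matrix (Fin m → Fin 2) (Fin m → Fin 2) ℂ :=
  (((List.finRange C.depth).map (C.layer Θ x)).reverse).prod

/-- `f_k(Θ, x) = ⟨0^m| U(Θ, x)† 𝒪_k U(Θ, x) |0^m⟩`, where `𝒪_k` is the observable of the qubit `k`. -/
def localModel (k : Fin m) (Θ : C.Params) (x : 𝒳) : ℝ :=
  (((C.unitary Θ x).conjTranspose * onQubit k (C.obs k) * C.unitary Θ x)
    (fun _ => 0) (fun _ => 0)).re

/-- The model function `f(Θ, x) = (1 / N) ∑_k f_k(Θ, x)`. -/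
def model (N : ℝ) (Θ : C.Params) (x : 𝒳) : ℝ := (1 / N) * ∑ k, C.localModel k Θ x

/-! ### Light cones -/

/-- `ℐ_(ℓ,k)`: the qubit `k` together with the qubit it interacts with in the layer `ℓ`. -/
def interaction (ℓ : Fin C.depth) (k : Fin m) : Finset (Fin m) := {k, C.partner ℓ k}

/-- `𝒥^ℓ_k`, with layers numbered from `0`: the last layer gives `ℐ_(ℓ,k)`, and
`𝒥^ℓ_k = ⋃_(k' ∈ 𝒥^(ℓ+1)_k) ℐ_(ℓ,k')` for the others. -/
def backwardCone (k : Fin m) (ℓ : ℕ) : Finset (Fin m) :=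
  if h : ℓ < C.depth then (backwardCone k (ℓ + 1)).biUnion (C.interaction ⟨ℓ, h⟩) else {k}
termination_by C.depth - ℓ

/-- The (extended) past light cone `𝒩_k` of the qubit `k`, a set of parameter indices. -/
def pastCone (k : Fin m) : Finset (Fin C.depth × Fin m) :=
  Finset.univ.filter fun i => i.2 ∈ C.backwardCone k i.1

/-- The (extended) future light cone `ℳ_i` of the parameter `θ_i`, a set of qubits. -/
def futureCone (i : Fin C.depth × Fin m) : Finset (Fin m) :=
  Finset.univ.filter fun k => i ∈ C.pastCone k

/-- `|ℳ|`, the maximal cardinality of a future light cone. -/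
def maxFuture : ℕ := Finset.univ.sup fun i => (C.futureCone i).card

/-- `|𝒩|`, the maximal cardinality of a past light cone. -/
def maxPast : ℕ := Finset.univ.sup fun k => (C.pastCone k).card

/-! ### Initialization and neural tangent kernel -/

/-- The law of the parameters at initialization: independent and uniform in `[0, π]`. -/
def initLaw : Measure C.Params :=
  Measure.pi fun _ => ProbabilityTheory.cond volume (Set.Icc 0 Real.pi)

/-- The empirical neural tangent kernel
`K̂_Θ(x, x') = (1 / N_K) ∑_i ∂_i f(Θ, x) ∂_i f(Θ, x')`. -/
def empiricalNTK (N NK : ℝ) (Θ : C.Params) (x x' : 𝒳) : ℝ :=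
  (1 / NK) * ∑ i, partialDeriv (fun Θ' => C.model N Θ' x) i Θ *
    partialDeriv (fun Θ' => C.model N Θ' x') i Θ

/-- The analytic neural tangent kernel `K(x, x') = 𝔼[K̂_Θ(x, x')]` at random initialization. -/
def analyticNTK (N NK : ℝ) (x x' : 𝒳) : ℝ := ∫ Θ, C.empiricalNTK N NK Θ x x' ∂C.initLaw

/-! ### Noisy training -/

/-- The mean squared error `ℒ(Θ) = (1 / 2n) ∑_j (f(Θ, x_j) - y_j)²` on the training set. -/
def loss (N : ℝ) {n : ℕ} (X : Fin n → 𝒳) (Y : Fin n → ℝ) (Θ : C.Params) : ℝ :=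
  (1 / (2 * (n : ℝ))) * ∑ j, (C.model N Θ (X j) - Y j) ^ 2

variable {Ω : Type*}

/-- The noisy iterates: `Θ_0` is given and `Θ_(t+1) = Θ_t - η g^(t)(Θ_t)`. -/
def iterate (η : ℝ) (Θ₀ : Ω → C.Params) (g : ℕ → C.Params → Ω → C.Params) :
    ℕ → Ω → C.Params
  | 0 => Θ₀
  | t + 1 => fun ω => iterate η Θ₀ g t ω - η • g t (iterate η Θ₀ g t ω) ω

/-- The σ-algebra of the past at time `t`: it is generated by the initialization `Θ_0` and by the
estimates `g^(k)(Θ_k)` for `k < t`. -/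
@[reducible] def history (η : ℝ) (Θ₀ : Ω → C.Params) (g : ℕ → C.Params → Ω → C.Params) (t : ℕ) :
    MeasurableSpace Ω :=
  MeasurableSpace.comap Θ₀ inferInstance ⊔
    ⨆ k, ⨆ (_ : k < t),
      MeasurableSpace.comap (fun ω => g k (C.iterate η Θ₀ g k ω) ω) inferInstance

/-- Training by noisy gradient descent for the training time `T`, with random uniform initialization
and with an estimator `g^(t)(Θ)` of `∇ℒ(Θ)` which is unbiased conditionally on the past. -/
structure IsNoisyTraining (N : ℝ) {n : ℕ} (X : Fin n → 𝒳) (Y : Fin n → ℝ) (η : ℝ) (T : ℕ)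
    [MeasurableSpace Ω] (P : Measure Ω) (Θ₀ : Ω → C.Params) (g : ℕ → C.Params → Ω → C.Params) :
    Prop where
  measurable_init : Measurable Θ₀
  law_init : HasLaw Θ₀ C.initLaw P
  measurable_grad : ∀ t ≤ T, Measurable fun ω => g t (C.iterate η Θ₀ g t ω) ω
  memLp_grad : ∀ t ≤ T, ∀ i, MemLp (fun ω => g t (C.iterate η Θ₀ g t ω) ω i) 2 P
  unbiased : ∀ t ≤ T, ∀ i,
    P[fun ω => g t (C.iterate η Θ₀ g t ω) ω i | C.history η Θ₀ g t]
      =ᵐ[P] fun ω => partialDeriv (C.loss N X Y) i (C.iterate η Θ₀ g t ω)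

end Circuit

/-! ### The assumptions on a sequence of circuits and the limiting process -/

section Sequence

variable {𝒳 : Type*} (C : (m : ℕ) → Circuit 𝒳 m) (N NK : ℕ → ℝ)

/-- Centered local outputs at initialization, and convergence of the covariance of the model, uniformly
on the input space, to a function `𝒦` with strictly positive diagonal. -/
structure InitAssumption (Kcov : 𝒳 → 𝒳 → ℝ) : Prop where
  mean_zero : ∀ m k x, ∫ Θ, (C m).localModel k Θ x ∂(C m).initLaw = 0
  cov_tendsto : TendstoUniformly
    (fun m (p : 𝒳 × 𝒳) =>
      ∫ Θ, (C m).model (N m) Θ p.1 * (C m).model (N m) Θ p.2 ∂(C m).initLaw)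
    (fun p => Kcov p.1 p.2) atTop
  diag_pos : ∀ x, 0 < Kcov x x

/-- The matrix `K̄(X, Xᵀ)` on the training inputs. -/
def gram (Kbar : 𝒳 → 𝒳 → ℝ) {n : ℕ} (X : Fin n → 𝒳) : Matrix (Fin n) (Fin n) ℝ :=
  Matrix.of fun i j => Kbar (X i) (X j)

/-- Convergence of the analytic neural tangent kernel, uniformly on the input space, to a function `K̄`
which is not identically zero and for which the smallest eigenvalue of `K̄(X, Xᵀ)` is strictly
positive. -/
structure NTKAssumption (Kbar : 𝒳 → 𝒳 → ℝ) {n : ℕ} (X : Fin n → 𝒳) : Prop where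
  tendsto : TendstoUniformly
    (fun m (p : 𝒳 × 𝒳) => (C m).analyticNTK (N m) (NK m) p.1 p.2)
    (fun p => Kbar p.1 p.2) atTop
  ne_zero : Kbar ≠ 0
  minEigenvalue_pos : 0 < minEigenvalue (gram Kbar X)

/-- The matrix `1 - (1 - η₀ K̄)^t`. -/
def evolution (Kbar : 𝒳 → 𝒳 → ℝ) {n : ℕ} (X : Fin n → 𝒳) (η₀ : ℝ) (t : ℕ) :
    Matrix (Fin n) (Fin n) ℝ :=
  1 - (1 - η₀ • gram Kbar X) ^ t

/-- `μ_t(x) = K̄(x, Xᵀ) K̄⁻¹ (1 - (1 - η₀ K̄)^t) Y`. -/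
def meanLimit (Kbar : 𝒳 → 𝒳 → ℝ) {n : ℕ} (X : Fin n → 𝒳) (Y : Fin n → ℝ) (η₀ : ℝ) (t : ℕ)
    (x : 𝒳) : ℝ :=
  (fun j => Kbar x (X j)) ⬝ᵥ
    (((gram Kbar X)⁻¹ * evolution Kbar X η₀ t).mulVec Y)

/-- The covariance
`𝒦_t(x, x') = 𝒦(x, x') - K̄(x, Xᵀ) K̄⁻¹ A 𝒦(X, x') - K̄(x', Xᵀ) K̄⁻¹ A 𝒦(X, x)
  + K̄(x, Xᵀ) K̄⁻¹ A 𝒦(X, Xᵀ) A K̄⁻¹ K̄(X, x')`, where `A = 1 - (1 - η₀ K̄)^t`. -/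
def covLimit (Kcov Kbar : 𝒳 → 𝒳 → ℝ) {n : ℕ} (X : Fin n → 𝒳) (η₀ : ℝ) (t : ℕ)
    (x x' : 𝒳) : ℝ :=
  Kcov x x'
    - (fun j => Kbar x (X j)) ⬝ᵥ
        (((gram Kbar X)⁻¹ * evolution Kbar X η₀ t).mulVec fun j => Kcov (X j) x')
    - (fun j => Kbar x' (X j)) ⬝ᵥ
        (((gram Kbar X)⁻¹ * evolution Kbar X η₀ t).mulVec fun j => Kcov (X j) x)
    + (fun j => Kbar x (X j)) ⬝ᵥ
        (((gram Kbar X)⁻¹ * evolution Kbar X η₀ t * gram Kcov X * evolution Kbar X η₀ t *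
          (gram Kbar X)⁻¹).mulVec fun j => Kbar (X j) x')

end Sequence

end QNN

end

/-! At a fixed training time the model is, up to an error that vanishes in probability, a
deterministic affine function of its values at initialization. Those values are asymptotically a
centered Gaussian vector, and affine images of Gaussian vectors are Gaussian. Since the input space
is finite, the process is a random vector, and limits in distribution are read off from
characteristic functions.

Two features of the circuits carry the estimates. The generators have eigenvalues `±1`, so every
`f_k` is a trigonometric polynomial of degree two in each parameter and obeys the parameter-shift
rule (`Circuit.shiftRule_localModel`): partial derivatives are differences of shifted values, hence
derivatives of every order are bounded by the supremum of the function. The gates act on at most two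
qubits, so `f_k` depends only on its past light cone (`Circuit.heisenberg_congr`). Together they
bound the Hessian of the model by `4 |𝒩| |ℳ| / N` (`LocalFamily.abs_hessian_le`), which tends to
zero.

The law at initialization comes from Stein's method on the dependency graph of overlapping cones
(`LocalFamily.norm_charFun_sub_le`). Its main error is the fluctuation of a local quadratic
expression, controlled by a Poincaré inequality for independent uniform parameters (`poincare`). The
same inequality shows that the empirical kernel concentrates around its mean, and, since it bounds
the nondegenerate variance of the model by `π² N_K K(x, x)`, that `N_K` is bounded away from zero
(`eventually_le_normalization`).

In one training step, the Taylor remainder is the vanishing Hessian bound times the square of a step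
bounded in probability. The linear term is `-η₀ ∑ K̂ (f - y)` plus a noise term. The kernel stays
near `K̄` because the gradient is Lipschitz with a vanishing constant and the parameters move by a
bounded amount; the noise contributes `O(1 / N)` in probability by the conditional variance bound.
Induction on the finitely many steps gives linearized training (`LazyDescent.linearization`), a
linear recursion with the explicit solution `iterate_linStep`. The continuous mapping theorem and
Slutsky's lemma conclude. -/

open MeasureTheory ProbabilityTheory Filter Topology

noncomputable section

namespace QNN

/-! ### The Poincaré inequality for independent uniform parameters -/

/-- The uniform law on `[0, π]`. -/
def unifLaw : Measure ℝ := ProbabilityTheory.cond volume (Set.Icc 0 Real.pi)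

instance : IsProbabilityMeasure unifLaw := by
  apply ProbabilityTheory.cond_isProbabilityMeasure_of_finite
  · simp [Real.pi_pos]
  · simp

lemma integral_unifLaw (F : ℝ → ℝ) :
    ∫ t, F t ∂unifLaw = Real.pi⁻¹ * ∫ t in (0 : ℝ)..Real.pi, F t := by
  rw [unifLaw, ProbabilityTheory.cond, integral_smul_measure,
    intervalIntegral.integral_of_le Real.pi_pos.le, integral_Icc_eq_integral_Ioc]
  simp [Real.pi_pos.le]

/-- Cauchy–Schwarz against the constant function, from the nonnegativity of the integral of `(D - c)
^ 2` with `c` the mean of `D`. -/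
lemma sq_intervalIntegral_le {D : ℝ → ℝ} (hD : Continuous D) {x : ℝ} (hx : 0 ≤ x) :
    (∫ t in (0 : ℝ)..x, D t) ^ 2 ≤ x * ∫ t in (0 : ℝ)..x, D t ^ 2 := by
  rcases hx.eq_or_lt with rfl | hx
  · simp
  set c := (∫ t in (0 : ℝ)..x, D t) / x with hc
  have h0 : 0 ≤ ∫ t in (0 : ℝ)..x, (D t - c) ^ 2 :=
    intervalIntegral.integral_nonneg hx.le fun t _ => sq_nonneg _
  have h1 : ∫ t in (0 : ℝ)..x, (D t - c) ^ 2
      = (∫ t in (0 : ℝ)..x, D t ^ 2) - 2 * c * (∫ t in (0 : ℝ)..x, D t) + x * c ^ 2 := by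
    have : ∀ t, (D t - c) ^ 2 = D t ^ 2 - 2 * c * D t + c ^ 2 := fun t => by ring
    simp_rw [this]
    rw [intervalIntegral.integral_add, intervalIntegral.integral_sub,
      intervalIntegral.integral_const_mul, intervalIntegral.integral_const]
    · simp
    all_goals exact Continuous.intervalIntegrable (by fun_prop) _ _
  have h2 : x * c = ∫ t in (0 : ℝ)..x, D t := by rw [hc]; field_simp
  rw [h1, ← h2] at h0
  rw [← h2]
  nlinarith

/-- The variance is at most the mean square deviation from `F 0`. The fundamental theorem of
calculus and Cauchy–Schwarz bound `(F x - F 0) ^ 2` by `π` times the integral of `D ^ 2`, which is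
`π` times its mean. The constant is not sharp; only its independence of `F` matters. -/
lemma sq_integral_sub_le_of_hasDerivAt {F D : ℝ → ℝ} (hF : ∀ t, HasDerivAt F (D t) t)
    (hD : Continuous D) :
    ∫ t, F t ^ 2 ∂unifLaw - (∫ t, F t ∂unifLaw) ^ 2 ≤ Real.pi ^ 2 * ∫ t, D t ^ 2 ∂unifLaw := by
  have hFc : Continuous F := continuous_iff_continuousAt.2 fun t => (hF t).continuousAt
  have hpi := Real.pi_pos
  set A := ∫ t in (0 : ℝ)..Real.pi, D t ^ 2
  have key : ∀ x ∈ Set.Icc 0 Real.pi, (F x - F 0) ^ 2 ≤ Real.pi * A := by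
    intro x hx
    rw [← intervalIntegral.integral_eq_sub_of_hasDerivAt (fun t _ => hF t)
      (hD.intervalIntegrable _ _)]
    refine (sq_intervalIntegral_le hD hx.1).trans ?_
    have : ∫ t in (0 : ℝ)..x, D t ^ 2 ≤ A := by
      apply intervalIntegral.integral_mono_interval le_rfl hx.1 hx.2
      · exact ae_of_all _ fun t => sq_nonneg _
      · exact Continuous.intervalIntegrable (by fun_prop) _ _
    have h0 : 0 ≤ ∫ t in (0 : ℝ)..x, D t ^ 2 :=
      intervalIntegral.integral_nonneg hx.1 fun t _ => sq_nonneg _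
    exact mul_le_mul hx.2 this h0 hpi.le
  have h1 : ∫ t in (0 : ℝ)..Real.pi, (F t - F 0) ^ 2 ≤ Real.pi * (Real.pi * A) := by
    calc _ ≤ ∫ t in (0 : ℝ)..Real.pi, Real.pi * A :=
          intervalIntegral.integral_mono_on hpi.le
            (Continuous.intervalIntegrable (by fun_prop) _ _)
            (Continuous.intervalIntegrable (by fun_prop) _ _) key
      _ = _ := by simp
  have h2 : ∫ t in (0 : ℝ)..Real.pi, (F t - F 0) ^ 2
      = (∫ t in (0 : ℝ)..Real.pi, F t ^ 2) - 2 * F 0 * (∫ t in (0 : ℝ)..Real.pi, F t)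
        + Real.pi * F 0 ^ 2 := by
    have : ∀ t, (F t - F 0) ^ 2 = F t ^ 2 - 2 * F 0 * F t + F 0 ^ 2 := fun t => by ring
    simp_rw [this]
    rw [intervalIntegral.integral_add, intervalIntegral.integral_sub,
      intervalIntegral.integral_const_mul, intervalIntegral.integral_const]
    · simp
    all_goals exact Continuous.intervalIntegrable (by fun_prop) _ _
  simp_rw [integral_unifLaw]
  set I := ∫ t in (0 : ℝ)..Real.pi, F t
  set J := ∫ t in (0 : ℝ)..Real.pi, F t ^ 2
  change Real.pi⁻¹ * J - (Real.pi⁻¹ * I) ^ 2 ≤ Real.pi ^ 2 * (Real.pi⁻¹ * A)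
  rw [h2] at h1
  have h3 : Real.pi⁻¹ * (J - 2 * F 0 * I + Real.pi * F 0 ^ 2)
      ≤ Real.pi⁻¹ * (Real.pi * (Real.pi * A)) := by gcongr
  have e1 : Real.pi⁻¹ * (J - 2 * F 0 * I + Real.pi * F 0 ^ 2)
    = Real.pi⁻¹ * J - 2 * F 0 * (Real.pi⁻¹ * I) + F 0 ^ 2 := by field_simp
  have e2 : Real.pi⁻¹ * (Real.pi * (Real.pi * A)) = Real.pi ^ 2 * (Real.pi⁻¹ * A) := by
    field_simp
  nlinarith [sq_nonneg (F 0 - Real.pi⁻¹ * I)]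

section Product

variable {α β : Type*} [MeasurableSpace α] [MeasurableSpace β]
  {μ : Measure α} {ν : Measure β} [IsProbabilityMeasure μ] [IsProbabilityMeasure ν]

lemma integrable_of_abs_le {F : α → ℝ} (hF : AEStronglyMeasurable F μ) {B : ℝ}
    (hB : ∀ a, |F a| ≤ B) :
    Integrable F μ :=
  Integrable.of_bound hF B (ae_of_all _ hB)

lemma abs_integral_le_of_abs_le {F : α → ℝ} {B : ℝ} (hB : ∀ a, |F a| ≤ B) :
    |∫ a, F a ∂μ| ≤ B := by
  simpa using norm_integral_le_of_norm_le_const (μ := μ) (f := F) (C := B) (ae_of_all _ hB)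

lemma integral_sq_expand_nonneg {f g h : α → ℝ} {c : ℝ} (hf : Integrable f μ)
    (hg : Integrable g μ) (hh : Integrable h μ) (hf2 : Integrable (fun a => f a ^ 2) μ)
    (hg2 : Integrable (fun a => g a ^ 2) μ) (hh2 : Integrable (fun a => h a ^ 2) μ)
    (hfg : Integrable (fun a => f a * g a) μ) (hfh : Integrable (fun a => f a * h a) μ)
    (hgh : Integrable (fun a => g a * h a) μ) :
    0 ≤ ∫ a, f a ^ 2 ∂μ + ∫ a, g a ^ 2 ∂μ + ∫ a, h a ^ 2 ∂μ + c ^ 2 - 2 * ∫ a, f a * g a ∂μ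
      - 2 * ∫ a, f a * h a ∂μ + 2 * ∫ a, g a * h a ∂μ + 2 * c * ∫ a, f a ∂μ
      - 2 * c * ∫ a, g a ∂μ - 2 * c * ∫ a, h a ∂μ := by
  have h0 : 0 ≤ ∫ a, (f a - g a - h a + c) ^ 2 ∂μ := integral_nonneg fun a => sq_nonneg _
  have hexp : ∀ a, (f a - g a - h a + c) ^ 2 =
      f a ^ 2 + g a ^ 2 + h a ^ 2 + c ^ 2 - 2 * (f a * g a) - 2 * (f a * h a)
        + 2 * (g a * h a) + 2 * c * f a - 2 * c * g a - 2 * c * h a := fun a => by ring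
  simp_rw [hexp] at h0
  have j1 := hf2.fun_add hg2
  have j2 := j1.fun_add hh2
  have j3 := j2.fun_add (integrable_const (μ := μ) (c ^ 2))
  have k1 := hfg.const_mul 2
  have k2 := hfh.const_mul 2
  have k3 := hgh.const_mul 2
  have k4 := hf.const_mul (2 * c)
  have k5 := hg.const_mul (2 * c)
  have k6 := hh.const_mul (2 * c)
  have j4 : Integrable (fun a => f a ^ 2 + g a ^ 2 + h a ^ 2 + c ^ 2 - 2 * (f a * g a)) μ := j3.sub k1
  have j5 : Integrable (fun a => f a ^ 2 + g a ^ 2 + h a ^ 2 + c ^ 2 - 2 * (f a * g a) - 2 * (f a * h a)) μ :=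
    j4.sub k2
  have j6 := j5.fun_add k3
  have j7 := j6.fun_add k4
  have j8 : Integrable (fun a => f a ^ 2 + g a ^ 2 + h a ^ 2 + c ^ 2 - 2 * (f a * g a) - 2 * (f a * h a) + 2 * (g a * h a) + 2 * c * f a
      - 2 * c * g a) μ := j7.sub k5
  rw [integral_sub j8 k6, integral_sub j7 k5, integral_add j6 k4, integral_add j5 k3,
    integral_sub j4 k2, integral_sub j3 k1, integral_add j2 (integrable_const _),
    integral_add j1 hh2, integral_add hf2 hg2, integral_const_mul, integral_const_mul,
    integral_const_mul, integral_const_mul, integral_const_mul, integral_const_mul] at h0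
  simpa using h0

/-- Efron–Stein for two factors. With the conditional means `G`, `H` and the mean `c`, the integral
of `(F - G - H + c) ^ 2` is nonnegative and equals `E F² - E G² - E H² + c²`, because `E FG = E G²`,
`E FH = E H²` and, by independence, `E GH = c²`. -/
lemma variance_prod_le {F : α × β → ℝ} (hF : StronglyMeasurable F) {B : ℝ}
    (hB : ∀ p, |F p| ≤ B) :
    ∫ p, F p ^ 2 ∂(μ.prod ν) - (∫ p, F p ∂(μ.prod ν)) ^ 2 ≤
      ∫ x, (∫ y, F (x, y) ^ 2 ∂ν - (∫ y, F (x, y) ∂ν) ^ 2) ∂μ +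
      ∫ y, (∫ x, F (x, y) ^ 2 ∂μ - (∫ x, F (x, y) ∂μ) ^ 2) ∂ν := by
  have hB2 : ∀ p, |F p ^ 2| ≤ B ^ 2 := fun p => by
    rw [abs_pow]; exact pow_le_pow_left₀ (abs_nonneg _) (hB p) 2
  set G : α → ℝ := fun x => ∫ y, F (x, y) ∂ν with hG
  set H : β → ℝ := fun y => ∫ x, F (x, y) ∂μ with hH
  set c := ∫ p, F p ∂(μ.prod ν) with hc
  have hFi : Integrable F (μ.prod ν) := integrable_of_abs_le hF.aestronglyMeasurable hB
  have hF2i : Integrable (fun p => F p ^ 2) (μ.prod ν) :=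
    integrable_of_abs_le (hF.pow 2).aestronglyMeasurable hB2
  have hGm : StronglyMeasurable G := hF.integral_prod_right'
  have hHm : StronglyMeasurable H := hF.integral_prod_left'
  have hGB : ∀ x, |G x| ≤ B := fun x => abs_integral_le_of_abs_le fun y => hB _
  have hHB : ∀ x, |H x| ≤ B := fun x => abs_integral_le_of_abs_le fun y => hB _
  have hGi : Integrable G μ := integrable_of_abs_le hGm.aestronglyMeasurable hGB
  have hHi : Integrable H ν := integrable_of_abs_le hHm.aestronglyMeasurable hHB
  have hG2i : Integrable (fun x => G x ^ 2) μ := by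
    apply integrable_of_abs_le (hGm.pow 2).aestronglyMeasurable (B := B ^ 2)
    intro p
    simp only [Pi.pow_apply]
    rw [abs_pow]; exact pow_le_pow_left₀ (abs_nonneg _) (hGB p) 2
  have hH2i : Integrable (fun x => H x ^ 2) ν := by
    apply integrable_of_abs_le (hHm.pow 2).aestronglyMeasurable (B := B ^ 2)
    intro p
    simp only [Pi.pow_apply]
    rw [abs_pow]; exact pow_le_pow_left₀ (abs_nonneg _) (hHB p) 2
  have hcG : ∫ x, G x ∂μ = c := (integral_prod F hFi).symm
  have hcH : ∫ y, H y ∂ν = c := (integral_prod_symm F hFi).symm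
  have e1 : ∫ x, (∫ y, F (x, y) ^ 2 ∂ν - G x ^ 2) ∂μ
      = ∫ p, F p ^ 2 ∂(μ.prod ν) - ∫ x, G x ^ 2 ∂μ := by
    rw [integral_sub hF2i.integral_prod_left hG2i, integral_prod _ hF2i]
  have e2 : ∫ y, (∫ x, F (x, y) ^ 2 ∂μ - H y ^ 2) ∂ν
      = ∫ p, F p ^ 2 ∂(μ.prod ν) - ∫ y, H y ^ 2 ∂ν := by
    rw [integral_sub hF2i.integral_prod_right hH2i, integral_prod_symm _ hF2i]
  rw [e1, e2]
  have hG1 : Integrable (fun p : α × β => G p.1) (μ.prod ν) := hGi.comp_fst ν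
  have hH1 : Integrable (fun p : α × β => H p.2) (μ.prod ν) := hHi.comp_snd μ
  have hG2 : Integrable (fun p : α × β => G p.1 ^ 2) (μ.prod ν) := hG2i.comp_fst ν
  have hH2 : Integrable (fun p : α × β => H p.2 ^ 2) (μ.prod ν) := hH2i.comp_snd μ
  have hFG : Integrable (fun p : α × β => F p * G p.1) (μ.prod ν) := by
    refine hFi.mul_bdd (c := B) hG1.aestronglyMeasurable (ae_of_all _ fun p => hGB _)
  have hFH : Integrable (fun p : α × β => F p * H p.2) (μ.prod ν) := by
    refine hFi.mul_bdd (c := B) hH1.aestronglyMeasurable (ae_of_all _ fun p => hHB _)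
  have hGH : Integrable (fun p : α × β => G p.1 * H p.2) (μ.prod ν) := hGi.mul_prod hHi
  have i1 : ∫ p, F p * G p.1 ∂(μ.prod ν) = ∫ x, G x ^ 2 ∂μ := by
    rw [integral_prod _ hFG]
    congr with x
    simp only
    rw [integral_mul_const, pow_two]
  have i2 : ∫ p, F p * H p.2 ∂(μ.prod ν) = ∫ y, H y ^ 2 ∂ν := by
    rw [integral_prod_symm _ hFH]
    congr with x
    simp only
    rw [integral_mul_const, pow_two]
  have i3 : ∫ p, G p.1 * H p.2 ∂(μ.prod ν) = c ^ 2 := by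
    rw [integral_prod_mul, hcG, hcH, pow_two]
  have i4 : ∫ p, G p.1 ^ 2 ∂(μ.prod ν) = ∫ x, G x ^ 2 ∂μ := by
    rw [integral_fun_fst (fun x => G x ^ 2)]; simp
  have i5 : ∫ p, H p.2 ^ 2 ∂(μ.prod ν) = ∫ y, H y ^ 2 ∂ν := by
    rw [integral_fun_snd (fun x => H x ^ 2)]; simp
  have i6 : ∫ p, G p.1 ∂(μ.prod ν) = c := by
    rw [integral_fun_fst G]; simp [hcG]
  have i7 : ∫ p, H p.2 ∂(μ.prod ν) = c := by
    rw [integral_fun_snd H]; simp [hcH]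
  have h0 := integral_sq_expand_nonneg (c := c) hFi hG1 hH1 hF2i hG2 hH2 hFG hFH hGH
  rw [i1, i2, i3, i4, i5, i6, i7, ← hc] at h0
  nlinarith

end Product

/-- Tensorization: the first coordinate is split off, `variance_prod_le` separates the two
variances, and the one-dimensional inequality and the induction hypothesis bound them. The bound `B`
serves only integrability. -/
lemma poincare_fin {B : ℝ} : ∀ {n : ℕ} (F : (Fin n → ℝ) → ℝ) (D : Fin n → (Fin n → ℝ) → ℝ)
    (_ : Continuous F) (_ : ∀ Θ, |F Θ| ≤ B) (_ : ∀ i, Continuous (D i))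
    (_ : ∀ i Θ, |D i Θ| ≤ B)
    (_ : ∀ i Θ t, HasDerivAt (fun s => F (Function.update Θ i s))
      (D i (Function.update Θ i t)) t),
    ∫ Θ, F Θ ^ 2 ∂(Measure.pi fun _ => unifLaw) - (∫ Θ, F Θ ∂(Measure.pi fun _ => unifLaw)) ^ 2
      ≤ Real.pi ^ 2 * ∑ i, ∫ Θ, D i Θ ^ 2 ∂(Measure.pi fun _ => unifLaw)
  | 0, F, D, hF, hFB, hD, hDB, hder => by
    have : ∀ Θ, F Θ = F 0 := fun Θ => congrArg F (Subsingleton.elim _ _)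
    simp [this]
  | n + 1, F, D, hF, hFB, hD, hDB, hder => by
    set μ : Measure (Fin n → ℝ) := Measure.pi fun _ => unifLaw
    have mp := (measurePreserving_piFinSuccAbove (fun _ : Fin (n + 1) => unifLaw) 0).symm
    have hint : ∀ G : (Fin (n + 1) → ℝ) → ℝ,
        ∫ Θ, G Θ ∂(Measure.pi fun _ => unifLaw) =
          ∫ p : ℝ × (Fin n → ℝ), G (Fin.cons p.1 p.2) ∂(unifLaw.prod μ) := fun G => by
      rw [← mp.integral_comp']
      refine integral_congr_ae (ae_of_all _ fun p => ?_)
      simp [MeasurableEquiv.piFinSuccAbove_symm_apply, Fin.insertNthEquiv]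
    have hcons : Continuous fun p : ℝ × (Fin n → ℝ) => (Fin.cons p.1 p.2 : Fin (n + 1) → ℝ) :=
      continuous_pi fun i => by
        refine Fin.cases ?_ (fun j => ?_) i
        · simpa using continuous_fst
        · simpa using (by fun_prop : Continuous fun p : ℝ × (Fin n → ℝ) => p.2 j)
    simp_rw [hint]
    have hint2 : ∀ i, Integrable (fun p : ℝ × (Fin n → ℝ) => D i (Fin.cons p.1 p.2) ^ 2)
        (unifLaw.prod μ) := fun i => by
      refine integrable_of_abs_le (B := B ^ 2) ?_ ?_
      · exact (((hD i).comp hcons).pow 2).aestronglyMeasurable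
      · intro p
        rw [abs_pow]; exact pow_le_pow_left₀ (abs_nonneg _) (hDB _ _) 2
    have hFc : Continuous fun p : ℝ × (Fin n → ℝ) => F (Fin.cons p.1 p.2) := hF.comp hcons
    refine (variance_prod_le (μ := unifLaw) (ν := μ) (B := B)
      (F := fun p => F (Fin.cons p.1 p.2)) hFc.stronglyMeasurable (fun p => hFB _)).trans ?_
    have hF2B : ∀ p : ℝ × (Fin n → ℝ), |F (Fin.cons p.1 p.2) ^ 2| ≤ B ^ 2 := fun p => by
      rw [abs_pow]; exact pow_le_pow_left₀ (abs_nonneg _) (hFB _) 2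
    have a1 : ∫ x, (∫ y, F (Fin.cons x y) ^ 2 ∂μ - (∫ y, F (Fin.cons x y) ∂μ) ^ 2) ∂unifLaw
        ≤ Real.pi ^ 2 * ∑ i : Fin n,
          ∫ p : ℝ × (Fin n → ℝ), D i.succ (Fin.cons p.1 p.2) ^ 2 ∂(unifLaw.prod μ) := by
      have : ∀ x, ∫ y, F (Fin.cons x y) ^ 2 ∂μ - (∫ y, F (Fin.cons x y) ∂μ) ^ 2
          ≤ Real.pi ^ 2 * ∑ i : Fin n, ∫ y, D i.succ (Fin.cons x y) ^ 2 ∂μ := fun x => by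
        refine poincare_fin (fun y => F (Fin.cons x y)) (fun i y => D i.succ (Fin.cons x y))
          (hFc.comp (by fun_prop : Continuous fun y => (x, y))) (fun y => hFB _) (fun i => ?_)
          (fun i y => hDB _ _) (fun i y t => ?_)
        · exact ((hD i.succ).comp hcons).comp (by fun_prop : Continuous fun y => (x, y))
        · have := hder i.succ (Fin.cons x y) t
          simpa [← Fin.cons_update] using this
      refine (integral_mono_of_nonneg (g := fun x =>
        Real.pi ^ 2 * ∑ i : Fin n, ∫ y, D i.succ (Fin.cons x y) ^ 2 ∂μ)
        (ae_of_all _ fun x => ?_) ?_ (ae_of_all _ this)).trans ?_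
      · have := variance_nonneg (fun y => F (Fin.cons x y)) μ
        rw [variance_eq_sub] at this
        · simpa using this
        · refine MemLp.of_bound ?_ B (ae_of_all _ fun y => hFB _)
          exact (hFc.comp (by fun_prop : Continuous fun y => (x, y))).aestronglyMeasurable
      · exact (integrable_finsetSum _ fun i _ => (hint2 i.succ).integral_prod_left).const_mul _
      · rw [integral_const_mul, integral_finsetSum _ fun i _ => (hint2 i.succ).integral_prod_left]
        simp_rw [integral_prod _ (hint2 _)]
        exact le_rfl
    have a2 : ∫ y, (∫ x, F (Fin.cons x y) ^ 2 ∂unifLaw - (∫ x, F (Fin.cons x y) ∂unifLaw) ^ 2) ∂μ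
        ≤ Real.pi ^ 2 *
          ∫ p : ℝ × (Fin n → ℝ), D 0 (Fin.cons p.1 p.2) ^ 2 ∂(unifLaw.prod μ) := by
      have : ∀ y, ∫ x, F (Fin.cons x y) ^ 2 ∂unifLaw - (∫ x, F (Fin.cons x y) ∂unifLaw) ^ 2
          ≤ Real.pi ^ 2 * ∫ x, D 0 (Fin.cons x y) ^ 2 ∂unifLaw := fun y => by
        refine sq_integral_sub_le_of_hasDerivAt (fun t => ?_) ?_
        · have := hder 0 (Fin.cons 0 y) t
          simpa [Fin.update_cons_zero] using this
        · exact ((hD 0).comp hcons).comp (by fun_prop : Continuous fun x => (x, y))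
      refine (integral_mono_of_nonneg (g := fun y =>
        Real.pi ^ 2 * ∫ x, D 0 (Fin.cons x y) ^ 2 ∂unifLaw)
        (ae_of_all _ fun y => ?_) ?_ (ae_of_all _ this)).trans ?_
      · have := variance_nonneg (fun x => F (Fin.cons x y)) unifLaw
        rw [variance_eq_sub] at this
        · simpa using this
        · refine MemLp.of_bound ?_ B (ae_of_all _ fun y => hFB _)
          exact (hFc.comp (by fun_prop : Continuous fun x => (x, y))).aestronglyMeasurable
      · exact ((hint2 0).integral_prod_right).const_mul _
      · rw [integral_const_mul, integral_prod_symm _ (hint2 _)]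
    rw [Fin.sum_univ_succ, mul_add]
    linarith

/-- **Poincaré inequality** for independent parameters, uniform in `[0, π]`. -/
theorem poincare {ι : Type*} [Fintype ι] [DecidableEq ι] {B : ℝ} (F : (ι → ℝ) → ℝ)
    (D : ι → (ι → ℝ) → ℝ)
    (hF : Continuous F) (hFB : ∀ Θ, |F Θ| ≤ B) (hD : ∀ i, Continuous (D i))
    (hDB : ∀ i Θ, |D i Θ| ≤ B)
    (hder : ∀ i Θ t, HasDerivAt (fun s => F (Function.update Θ i s))
      (D i (Function.update Θ i t)) t) :
    ∫ Θ, F Θ ^ 2 ∂(Measure.pi fun _ => unifLaw) - (∫ Θ, F Θ ∂(Measure.pi fun _ => unifLaw)) ^ 2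
      ≤ Real.pi ^ 2 * ∑ i, ∫ Θ, D i Θ ^ 2 ∂(Measure.pi fun _ => unifLaw) := by
  let e := (Fintype.equivFin ι).symm
  have mp := measurePreserving_piCongrLeft (fun _ : ι => unifLaw) e
  have he : ∀ Θ : Fin (Fintype.card ι) → ℝ,
      MeasurableEquiv.piCongrLeft (fun _ : ι => ℝ) e Θ = Θ ∘ e.symm := fun Θ => by
    ext i
    obtain ⟨j, rfl⟩ := e.surjective i
    simp [MeasurableEquiv.coe_piCongrLeft, Equiv.piCongrLeft_apply_apply]
  have hint : ∀ G : (ι → ℝ) → ℝ, ∫ Θ, G Θ ∂(Measure.pi fun _ => unifLaw) =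
      ∫ Θ : Fin (Fintype.card ι) → ℝ, G (Θ ∘ e.symm) ∂(Measure.pi fun _ => unifLaw) := fun G => by
    rw [← mp.integral_comp']
    simp_rw [he]
  simp_rw [hint]
  have hc : Continuous fun Θ : Fin (Fintype.card ι) → ℝ => Θ ∘ e.symm := by fun_prop
  have := poincare_fin (B := B) (fun Θ => F (Θ ∘ e.symm)) (fun i Θ => D (e i) (Θ ∘ e.symm))
    (hF.comp hc) (fun Θ => hFB _) (fun i => (hD _).comp hc) (fun i Θ => hDB _ _)
    (fun i Θ t => by
      have hu : ∀ s, Function.update Θ i s ∘ e.symm = Function.update (Θ ∘ e.symm) (e i) s :=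
        fun s => by
          ext j
          by_cases h : j = e i
          · subst h; simp
          · have : e.symm j ≠ i := fun h' => h (by simp [← h'])
            simp [h, this]
      simp_rw [hu]
      exact hder _ _ _)
  rwa [e.sum_comp (fun i => ∫ Θ : Fin (Fintype.card ι) → ℝ, D i (Θ ∘ e.symm) ^ 2
    ∂(Measure.pi fun _ => unifLaw))] at this

end QNN

end

open MeasureTheory ProbabilityTheory Filter Topology

noncomputable section

namespace QNN

/-! ### Functions satisfying the parameter-shift rule -/

section ShiftRule

variable {ι : Type*} [Fintype ι]

/-- The Euclidean norm of a vector of parameters. -/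
def l2 (v : ι → ℝ) : ℝ := ‖WithLp.toLp 2 v‖

lemma l2_sq (v : ι → ℝ) : l2 v ^ 2 = ∑ i, v i ^ 2 := by
  simp [l2, EuclideanSpace.norm_sq_eq]

lemma l2_nonneg (v : ι → ℝ) : 0 ≤ l2 v := norm_nonneg _

lemma l2_add_le (v w : ι → ℝ) : l2 (v + w) ≤ l2 v + l2 w := by
  simpa [l2] using norm_add_le (WithLp.toLp 2 v) (WithLp.toLp 2 w)

lemma l2_smul (c : ℝ) (v : ι → ℝ) : l2 (c • v) = |c| * l2 v := by
  simp [l2, norm_smul]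

lemma l2_sum_le {n : ℕ} (v : Fin n → ι → ℝ) : l2 (∑ j, v j) ≤ ∑ j, l2 (v j) := by
  simpa [l2, WithLp.toLp_sum] using norm_sum_le Finset.univ fun j => WithLp.toLp 2 (v j)

lemma abs_sum_mul_le_l2 (v w : ι → ℝ) : |∑ i, v i * w i| ≤ l2 v * l2 w := by
  apply abs_le_of_sq_le_sq _ (mul_nonneg (l2_nonneg _) (l2_nonneg _))
  rw [mul_pow, l2_sq, l2_sq]
  exact Finset.sum_mul_sq_le_sq_mul_sq _ _ _

variable [DecidableEq ι]

/-- The parameter-shift rule: the partial derivatives of `F` are differences of shifts of `F`. -/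
structure ShiftRule (F : (ι → ℝ) → ℝ) : Prop where
  differentiable : Differentiable ℝ F
  partialDeriv_eq : ∀ i Θ, partialDeriv F i Θ =
    F (Θ + Pi.single i (Real.pi / 4)) - F (Θ - Pi.single i (Real.pi / 4))

lemma hasDerivAt_comp_update {F : (ι → ℝ) → ℝ} (hF : Differentiable ℝ F) (i : ι) (Θ : ι → ℝ) (t : ℝ) :
    HasDerivAt (fun s => F (Function.update Θ i s))
      (partialDeriv F i (Function.update Θ i t)) t :=
  ((hF _).hasFDerivAt).comp_hasDerivAt t (_root_.hasDerivAt_update Θ i t)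

lemma fderiv_apply_eq_sum {F : (ι → ℝ) → ℝ} (Θ Δ : ι → ℝ) :
    fderiv ℝ F Θ Δ = ∑ i, Δ i * partialDeriv F i Θ := by
  conv_lhs => rw [← Finset.univ_sum_single Δ]
  rw [map_sum]
  refine Finset.sum_congr rfl fun i _ => ?_
  have : (Pi.single i (Δ i) : ι → ℝ) = Δ i • Pi.single i 1 := by
    rw [← Pi.single_smul]; simp
  rw [this, map_smul, smul_eq_mul, partialDeriv]

lemma hasDerivAt_line {F : (ι → ℝ) → ℝ} (hF : Differentiable ℝ F) (Θ Δ : ι → ℝ) (s : ℝ) :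
    HasDerivAt (fun s : ℝ => F (Θ + s • Δ)) (∑ i, Δ i * partialDeriv F i (Θ + s • Δ)) s := by
  rw [← fderiv_apply_eq_sum]
  have h : HasDerivAt (fun s : ℝ => Θ + s • Δ) Δ s := by
    simpa using ((hasDerivAt_id s).smul_const Δ).const_add Θ
  exact ((hF _).hasFDerivAt).comp_hasDerivAt s h

lemma partialDeriv_const_mul {F : (ι → ℝ) → ℝ} (hF : Differentiable ℝ F) (c : ℝ) (i : ι)
    (Θ : ι → ℝ) : partialDeriv (fun Θ => c * F Θ) i Θ = c * partialDeriv F i Θ := by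
  rw [partialDeriv, fderiv_const_mul (hF Θ)]
  rfl

lemma partialDeriv_sum {κ : Type*} {s : Finset κ} {h : κ → (ι → ℝ) → ℝ}
    (hh : ∀ k ∈ s, Differentiable ℝ (h k)) (i : ι) (Θ : ι → ℝ) :
    partialDeriv (fun Θ => ∑ k ∈ s, h k Θ) i Θ = ∑ k ∈ s, partialDeriv (h k) i Θ := by
  rw [partialDeriv, fderiv_fun_sum fun k hk => hh k hk Θ]
  simp [partialDeriv]

namespace ShiftRule

variable {F : (ι → ℝ) → ℝ}

lemma const_mul (hF : ShiftRule F) (c : ℝ) : ShiftRule fun Θ => c * F Θ where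
  differentiable := hF.differentiable.const_mul c
  partialDeriv_eq i Θ := by
    rw [partialDeriv_const_mul hF.differentiable, hF.partialDeriv_eq]
    ring

lemma sum {κ : Type*} {s : Finset κ} {h : κ → (ι → ℝ) → ℝ} (hh : ∀ k ∈ s, ShiftRule (h k)) :
    ShiftRule fun Θ => ∑ k ∈ s, h k Θ where
  differentiable := Differentiable.fun_sum fun k hk => (hh k hk).differentiable
  partialDeriv_eq i Θ := by
    rw [partialDeriv_sum fun k hk => (hh k hk).differentiable, ← Finset.sum_sub_distrib]
    exact Finset.sum_congr rfl fun k hk => (hh k hk).partialDeriv_eq i Θ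

lemma partialDeriv_fun_eq (hF : ShiftRule F) (i : ι) : partialDeriv F i = fun Θ =>
    F (Θ + Pi.single i (Real.pi / 4)) - F (Θ - Pi.single i (Real.pi / 4)) :=
  funext fun Θ => hF.partialDeriv_eq i Θ

/-- Shifts in different directions commute with each other and with differentiation, so derivatives
inherit the rule. This allows supremum bounds to pass to second derivatives. -/
lemma partialDeriv (hF : ShiftRule F) (i : ι) : ShiftRule (partialDeriv F i) where
  differentiable := by
    rw [hF.partialDeriv_fun_eq]
    have := hF.differentiable
    fun_prop
  partialDeriv_eq j Θ := by
    rw [hF.partialDeriv_fun_eq]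
    have hd := hF.differentiable
    rw [QNN.partialDeriv, fderiv_fun_sub (by fun_prop) (by fun_prop)]
    have h1 := fderiv_comp_add_right (𝕜 := ℝ) (f := F) (x := Θ) (Pi.single i (Real.pi / 4))
    have h2 := fderiv_comp_sub (𝕜 := ℝ) (f := F) (x := Θ) (Pi.single i (Real.pi / 4))
    rw [h1, h2]
    change QNN.partialDeriv F j _ - QNN.partialDeriv F j _ = _
    rw [hF.partialDeriv_eq, hF.partialDeriv_eq]
    simp only [add_sub_right_comm, add_right_comm, sub_right_comm]
    ring

/-- A Bernstein-type inequality: the derivative is a difference of two values of the function. -/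
lemma abs_partialDeriv_le (hF : ShiftRule F) {B : ℝ} (hB : ∀ Θ, |F Θ| ≤ B) (i : ι) (Θ : ι → ℝ) :
    |QNN.partialDeriv F i Θ| ≤ 2 * B := by
  rw [hF.partialDeriv_eq]
  refine (abs_sub _ _).trans ?_
  linarith [hB (Θ + Pi.single i (Real.pi / 4)), hB (Θ - Pi.single i (Real.pi / 4))]

lemma continuous (hF : ShiftRule F) : Continuous F := hF.differentiable.continuous

lemma continuous_partialDeriv (hF : ShiftRule F) (i : ι) : Continuous (QNN.partialDeriv F i) :=
  (hF.partialDeriv i).continuous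

end ShiftRule

/-- `F` depends only on the parameters in `S`. -/
def DependsOnlyOn (F : (ι → ℝ) → ℝ) (S : Finset ι) : Prop :=
  ∀ Θ Θ', (∀ i ∈ S, Θ i = Θ' i) → F Θ = F Θ'

namespace DependsOnlyOn

variable {F : (ι → ℝ) → ℝ} {S : Finset ι}

lemma partialDeriv_eq_zero (hF : DependsOnlyOn F S) (hs : ShiftRule F) {i : ι} (hi : i ∉ S)
    (Θ : ι → ℝ) : partialDeriv F i Θ = 0 := by
  rw [hs.partialDeriv_eq, sub_eq_zero]
  refine hF _ _ fun j hj => ?_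
  have : j ≠ i := fun h => hi (h ▸ hj)
  simp [this]

lemma partialDeriv (hF : DependsOnlyOn F S) (hs : ShiftRule F) (i : ι) :
    DependsOnlyOn (partialDeriv F i) S := by
  intro Θ Θ' h
  rw [hs.partialDeriv_eq, hs.partialDeriv_eq]
  congr 1 <;> exact hF _ _ fun j hj => by simp [h j hj]

end DependsOnlyOn

end ShiftRule

/-! ### Families of local functions -/

/-- A family of functions `h k`, bounded by `B`, satisfying the parameter-shift rule, such that
`h k` depends only on the parameters in `cone k`; a cone has at most `p` elements, and a parameter
lies in at most `q` cones. -/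
structure LocalFamily {ι κ : Type*} [Fintype ι] [DecidableEq ι] [Fintype κ]
    (h : κ → (ι → ℝ) → ℝ) (cone : κ → Finset ι) (B : ℝ) (p q : ℕ) : Prop where
  shiftRule : ∀ k, ShiftRule (h k)
  abs_le : ∀ k Θ, |h k Θ| ≤ B
  dependsOnlyOn : ∀ k, DependsOnlyOn (h k) (cone k)
  card_cone_le : ∀ k, (cone k).card ≤ p
  card_filter_le : ∀ i, (Finset.univ.filter fun k => i ∈ cone k).card ≤ q

section Family

variable {ι κ : Type*} [Fintype ι] [DecidableEq ι] [Fintype κ]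

/-- The normalized sum of a family of functions. -/
def normSum (c : ℝ) (h : κ → (ι → ℝ) → ℝ) (Θ : ι → ℝ) : ℝ := c * ∑ k, h k Θ

/-- The gradient. -/
def grad (F : (ι → ℝ) → ℝ) (Θ : ι → ℝ) : ι → ℝ := fun i => partialDeriv F i Θ

namespace LocalFamily

variable {h h' : κ → (ι → ℝ) → ℝ} {cone : κ → Finset ι} {B : ℝ} {p q : ℕ} {c : ℝ}

lemma shiftRule_normSum (hh : LocalFamily h cone B p q) (c : ℝ) : ShiftRule (normSum c h) :=
  (ShiftRule.sum fun k _ => hh.shiftRule k).const_mul c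

lemma partialDeriv_normSum (hh : LocalFamily h cone B p q) (i : ι) (Θ : ι → ℝ) :
    partialDeriv (normSum c h) i Θ = c * ∑ k, partialDeriv (h k) i Θ := by
  unfold normSum
  rw [partialDeriv_const_mul, partialDeriv_sum]
  · exact fun k _ => (hh.shiftRule k).differentiable
  · exact Differentiable.fun_sum fun k _ => (hh.shiftRule k).differentiable

lemma partialDeriv_partialDeriv_normSum (hh : LocalFamily h cone B p q) (i j : ι) (Θ : ι → ℝ) :
    partialDeriv (partialDeriv (normSum c h) i) j Θ
      = c * ∑ k, partialDeriv (partialDeriv (h k) i) j Θ := by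
  have : partialDeriv (normSum c h) i = fun Θ => c * ∑ k, partialDeriv (h k) i Θ :=
    funext fun Θ => hh.partialDeriv_normSum i Θ
  rw [this, partialDeriv_const_mul, partialDeriv_sum]
  · exact fun k _ => ((hh.shiftRule k).partialDeriv i).differentiable
  · exact Differentiable.fun_sum fun k _ => ((hh.shiftRule k).partialDeriv i).differentiable

lemma abs_normSum_le (hh : LocalFamily h cone B p q) (c : ℝ) (Θ : ι → ℝ) :
    |normSum c h Θ| ≤ |c| * (Fintype.card κ * B) := by
  rw [normSum, abs_mul]
  gcongr
  refine (Finset.abs_sum_le_sum_abs _ _).trans ?_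
  refine (Finset.sum_le_sum fun k _ => hh.abs_le k Θ).trans ?_
  simp

/-- Double counting: each parameter lies in at most `q` cones. -/
lemma sum_cone_le (hh : LocalFamily h cone B p q) {v : ι → ℝ} (hv : ∀ i, 0 ≤ v i) :
    ∑ k, ∑ i ∈ cone k, v i ≤ q * ∑ i, v i := by
  have : ∀ k, ∑ i ∈ cone k, v i = ∑ i, if i ∈ cone k then v i else 0 := fun k => by
    rw [Finset.sum_ite_mem, Finset.univ_inter]
  simp_rw [this]
  rw [Finset.sum_comm, Finset.mul_sum]
  refine Finset.sum_le_sum fun i _ => ?_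
  rw [← Finset.sum_filter, Finset.sum_const, nsmul_eq_mul]
  exact mul_le_mul_of_nonneg_right (by exact_mod_cast hh.card_filter_le i) (hv i)

/-- Only the at most `q` members whose cone contains `i` have a nonzero derivative in this
direction. -/
lemma abs_partialDeriv_normSum_le (hh : LocalFamily h cone B p q) (hB : 0 ≤ B) (i : ι)
    (Θ : ι → ℝ) : |partialDeriv (normSum c h) i Θ| ≤ |c| * (q * (2 * B)) := by
  rw [hh.partialDeriv_normSum, abs_mul]
  gcongr
  rw [← Finset.sum_filter_of_ne (p := fun k => i ∈ cone k)]
  · refine (Finset.abs_sum_le_sum_abs _ _).trans ?_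
    refine (Finset.sum_le_sum fun k _ =>
      (hh.shiftRule k).abs_partialDeriv_le (hh.abs_le k) i Θ).trans ?_
    rw [Finset.sum_const, nsmul_eq_mul]
    have := hh.card_filter_le i
    gcongr
  · intro k _ hk
    by_contra hi
    exact hk ((hh.dependsOnlyOn k).partialDeriv_eq_zero (hh.shiftRule k) hi Θ)

/-- Cauchy–Schwarz inside each cone costs the factor `p`; double counting costs the factor `q`. -/
lemma sum_cone_sq_le (hh : LocalFamily h cone B p q) (v : ι → ℝ) :
    ∑ k, (∑ i ∈ cone k, |v i|) ^ 2 ≤ p * q * l2 v ^ 2 := by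
  calc ∑ k, (∑ i ∈ cone k, |v i|) ^ 2 ≤ ∑ k, p * ∑ i ∈ cone k, v i ^ 2 := by
        refine Finset.sum_le_sum fun k _ => ?_
        refine (sq_sum_le_card_mul_sum_sq (s := cone k) (f := fun i => |v i|)).trans ?_
        simp_rw [sq_abs]
        have := hh.card_cone_le k
        have : 0 ≤ ∑ i ∈ cone k, v i ^ 2 := Finset.sum_nonneg fun i _ => sq_nonneg _
        gcongr
    _ ≤ p * q * l2 v ^ 2 := by
        rw [← Finset.mul_sum, mul_assoc, l2_sq]
        gcongr
        exact hh.sum_cone_le fun i => sq_nonneg _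

/-- The Hessian of a normalized sum of local functions has a small operator norm. -/
lemma abs_hessian_le (hh : LocalFamily h cone B p q) (hB : 0 ≤ B) (Θ v w : ι → ℝ) :
    |∑ i, ∑ j, v i * w j * partialDeriv (partialDeriv (normSum c h) i) j Θ|
      ≤ 4 * B * |c| * (p * q) * l2 v * l2 w := by
  have h1 : ∑ i, ∑ j, v i * w j * partialDeriv (partialDeriv (normSum c h) i) j Θ
      = c * ∑ k, ∑ i, ∑ j, v i * w j * partialDeriv (partialDeriv (h k) i) j Θ := by
    simp_rw [hh.partialDeriv_partialDeriv_normSum, Finset.mul_sum]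
    rw [Finset.sum_comm]
    simp_rw [Finset.sum_comm (γ := κ)]
    rw [Finset.sum_comm]
    refine Finset.sum_congr rfl fun _ _ => Finset.sum_congr rfl fun _ _ =>
      Finset.sum_congr rfl fun _ _ => by ring
  -- Second derivatives of `h k` vanish off its cone, and the shift rule applied twice bounds the
  -- others by `4 * B`.
  have h2 : ∀ k, |∑ i, ∑ j, v i * w j * partialDeriv (partialDeriv (h k) i) j Θ|
      ≤ 4 * B * ((∑ i ∈ cone k, |v i|) * ∑ j ∈ cone k, |w j|) := fun k => by
    have hs := hh.shiftRule k
    have hl := hh.dependsOnlyOn k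
    calc |∑ i, ∑ j, v i * w j * partialDeriv (partialDeriv (h k) i) j Θ|
        = |∑ i ∈ cone k, ∑ j ∈ cone k, v i * w j * partialDeriv (partialDeriv (h k) i) j Θ| := by
          congr 1
          rw [← Finset.sum_subset (Finset.subset_univ (cone k))]
          · refine Finset.sum_congr rfl fun i _ => ?_
            rw [← Finset.sum_subset (Finset.subset_univ (cone k))]
            intro j _ hj
            rw [(hl.partialDeriv hs i).partialDeriv_eq_zero (hs.partialDeriv i) hj, mul_zero]
          · intro i _ hi
            refine Finset.sum_eq_zero fun j _ => ?_
            have : partialDeriv (h k) i = fun _ => 0 :=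
              funext fun Θ => hl.partialDeriv_eq_zero hs hi Θ
            rw [this]
            simp [partialDeriv]
      _ ≤ ∑ i ∈ cone k, ∑ j ∈ cone k, |v i| * |w j| * (4 * B) := by
          refine (Finset.abs_sum_le_sum_abs _ _).trans (Finset.sum_le_sum fun i _ => ?_)
          refine (Finset.abs_sum_le_sum_abs _ _).trans (Finset.sum_le_sum fun j _ => ?_)
          rw [abs_mul, abs_mul]
          gcongr
          have := (hs.partialDeriv i).abs_partialDeriv_le
            (fun Θ => hs.abs_partialDeriv_le (hh.abs_le k) i Θ) j Θ
          linarith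
      _ = _ := by
          rw [Finset.sum_mul_sum, Finset.mul_sum]
          refine Finset.sum_congr rfl fun i _ => ?_
          rw [Finset.mul_sum]
          exact Finset.sum_congr rfl fun i _ => by ring
  rw [h1, abs_mul]
  -- Cauchy–Schwarz over `k` separates `v` from `w`.
  have h3 : ∑ k, (∑ i ∈ cone k, |v i|) * ∑ j ∈ cone k, |w j| ≤ p * q * (l2 v * l2 w) := by
    apply le_of_sq_le_sq _ (by have := l2_nonneg v; have := l2_nonneg w; positivity)
    refine (Finset.sum_mul_sq_le_sq_mul_sq _ _ _).trans ?_
    calc _ ≤ (p * q * l2 v ^ 2) * (p * q * l2 w ^ 2) := by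
          refine mul_le_mul (hh.sum_cone_sq_le v) (hh.sum_cone_sq_le w) ?_ (by positivity)
          exact Finset.sum_nonneg fun k _ => sq_nonneg _
      _ = _ := by ring
  calc _ ≤ |c| * ∑ k, 4 * B * ((∑ i ∈ cone k, |v i|) * ∑ j ∈ cone k, |w j|) := by
        gcongr
        exact (Finset.abs_sum_le_sum_abs _ _).trans (Finset.sum_le_sum fun k _ => h2 k)
    _ = |c| * (4 * B) * ∑ k, ((∑ i ∈ cone k, |v i|) * ∑ j ∈ cone k, |w j|) := by
        rw [← Finset.mul_sum]; ring
    _ ≤ |c| * (4 * B) * (p * q * (l2 v * l2 w)) := by gcongr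
    _ = _ := by ring

/-- The gradient of a normalized sum of local functions is Lipschitz. -/
lemma l2_grad_sub_le (hh : LocalFamily h cone B p q) (hB : 0 ≤ B) (Θ Δ : ι → ℝ) :
    l2 (grad (normSum c h) (Θ + Δ) - grad (normSum c h) Θ)
      ≤ 4 * B * |c| * (p * q) * l2 Δ := by
  set v := grad (normSum c h) (Θ + Δ) - grad (normSum c h) Θ with hv
  set H := 4 * B * |c| * (p * q) with hH
  have hH0 : 0 ≤ H := by positivity
  -- The gradient along the segment is paired with its own total increment `v`: then `φ 1 - φ 0` is
  -- `l2 v ^ 2`, the Hessian bound makes it at most `H * l2 v * l2 Δ`, and one factor `l2 v`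
  -- cancels.
  set φ : ℝ → ℝ := fun s => ∑ i, v i * partialDeriv (normSum c h) i (Θ + s • Δ) with hφ
  have hd : ∀ s, HasDerivAt φ (∑ i, v i * ∑ j, Δ j *
      partialDeriv (partialDeriv (normSum c h) i) j (Θ + s • Δ)) s := fun s => by
    refine HasDerivAt.fun_sum fun i _ => HasDerivAt.const_mul _ ?_
    exact hasDerivAt_line ((hh.shiftRule_normSum c).partialDeriv i).differentiable Θ Δ s
  have hb : ∀ s ∈ Set.Icc (0 : ℝ) 1, ‖∑ i, v i * ∑ j, Δ j *
      partialDeriv (partialDeriv (normSum c h) i) j (Θ + s • Δ)‖ ≤ H * l2 v * l2 Δ := by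
    intro s _
    rw [Real.norm_eq_abs]
    convert hh.abs_hessian_le (c := c) hB (Θ + s • Δ) v Δ using 2
    refine Finset.sum_congr rfl fun i _ => ?_
    rw [Finset.mul_sum]
    exact Finset.sum_congr rfl fun j _ => by ring
  have := (convex_Icc (0 : ℝ) 1).norm_image_sub_le_of_norm_hasDerivWithin_le
    (fun s _ => (hd s).hasDerivWithinAt) hb (Set.left_mem_Icc.2 zero_le_one)
    (Set.right_mem_Icc.2 zero_le_one)
  have e : φ 1 - φ 0 = l2 v ^ 2 := by
    rw [l2_sq, hφ]
    simp only [one_smul, zero_smul, add_zero]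
    rw [← Finset.sum_sub_distrib]
    refine Finset.sum_congr rfl fun i _ => ?_
    simp only [hv, grad, Pi.sub_apply]
    ring
  rw [e, sub_zero, norm_one, mul_one, Real.norm_eq_abs, abs_of_nonneg (sq_nonneg _)] at this
  rcases (l2_nonneg v).eq_or_lt with h0 | h0
  · rw [← h0]; exact mul_nonneg hH0 (l2_nonneg _)
  · exact le_of_mul_le_mul_left (by nlinarith) h0

/-- First-order Taylor expansion of a normalized sum of local functions. -/
lemma abs_taylor_le (hh : LocalFamily h cone B p q) (hB : 0 ≤ B) (Θ Δ : ι → ℝ) :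
    |normSum c h (Θ + Δ) - normSum c h Θ - ∑ i, Δ i * grad (normSum c h) Θ i|
      ≤ 4 * B * |c| * (p * q) * l2 Δ ^ 2 := by
  set H := 4 * B * |c| * (p * q) with hH
  have hH0 : 0 ≤ H := by positivity
  -- The derivative of this remainder is an increment of the gradient paired with `Δ`. Bounding `s`
  -- by one gives away the factor `1 / 2` of the sharp Taylor estimate.
  set φ : ℝ → ℝ := fun s => normSum c h (Θ + s • Δ) - s * ∑ i, Δ i * grad (normSum c h) Θ i
    with hφ
  have hd : ∀ s, HasDerivAt φ (∑ i, Δ i * partialDeriv (normSum c h) i (Θ + s • Δ)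
      - 1 * ∑ i, Δ i * grad (normSum c h) Θ i) s := fun s =>
    (hasDerivAt_line (hh.shiftRule_normSum c).differentiable Θ Δ s).fun_sub
      ((hasDerivAt_id s).mul_const _)
  have hb : ∀ s ∈ Set.Icc (0 : ℝ) 1, ‖∑ i, Δ i * partialDeriv (normSum c h) i (Θ + s • Δ)
      - 1 * ∑ i, Δ i * grad (normSum c h) Θ i‖ ≤ H * l2 Δ ^ 2 := by
    intro s hs
    rw [one_mul, ← Finset.sum_sub_distrib, Real.norm_eq_abs]
    have := abs_sum_mul_le_l2 Δ (grad (normSum c h) (Θ + s • Δ) - grad (normSum c h) Θ)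
    calc _ = |∑ i, Δ i * (grad (normSum c h) (Θ + s • Δ) - grad (normSum c h) Θ) i| := by
          congr 1
          refine Finset.sum_congr rfl fun i _ => ?_
          simp only [grad, Pi.sub_apply]
          ring
      _ ≤ l2 Δ * (H * l2 (s • Δ)) :=
          this.trans (mul_le_mul_of_nonneg_left (hh.l2_grad_sub_le hB Θ _) (l2_nonneg _))
      _ ≤ l2 Δ * (H * l2 Δ) := by
          rw [l2_smul, abs_of_nonneg hs.1]
          have := mul_le_mul_of_nonneg_right hs.2 (l2_nonneg Δ)
          have := l2_nonneg Δ
          gcongr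
          linarith
      _ = _ := by ring
  have := (convex_Icc (0 : ℝ) 1).norm_image_sub_le_of_norm_hasDerivWithin_le
    (fun s _ => (hd s).hasDerivWithinAt) hb (Set.left_mem_Icc.2 zero_le_one)
    (Set.right_mem_Icc.2 zero_le_one)
  rw [sub_zero, norm_one, mul_one, Real.norm_eq_abs] at this
  convert this using 2
  simp [hφ]
  ring

/-- The derivative of the scalar product of two gradients. -/
def kernelDeriv (F F' : (ι → ℝ) → ℝ) (j : ι) (Θ : ι → ℝ) : ℝ :=
  ∑ i, (partialDeriv (partialDeriv F i) j Θ * partialDeriv F' i Θ +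
    partialDeriv F i Θ * partialDeriv (partialDeriv F' i) j Θ)

/-- Paired with itself, this vector becomes a sum of two Hessian forms: the Hessian of each
function, evaluated at the gradient of the other function and at the vector. -/
lemma l2_kernelDeriv_le (hh : LocalFamily h cone B p q) (hh' : LocalFamily h' cone B p q)
    (hB : 0 ≤ B) (Θ : ι → ℝ) :
    l2 (fun j => kernelDeriv (normSum c h) (normSum c h') j Θ) ≤
      4 * B * |c| * (p * q) * (l2 (grad (normSum c h) Θ) + l2 (grad (normSum c h') Θ)) := by
  set w : ι → ℝ := fun j => kernelDeriv (normSum c h) (normSum c h') j Θ with hw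
  set H := 4 * B * |c| * (p * q) with hH
  have hH0 : 0 ≤ H := by positivity
  have e : l2 w ^ 2 = ∑ i, ∑ j, grad (normSum c h') Θ i * w j *
      partialDeriv (partialDeriv (normSum c h) i) j Θ +
      ∑ i, ∑ j, grad (normSum c h) Θ i * w j *
      partialDeriv (partialDeriv (normSum c h') i) j Θ := by
    rw [l2_sq, Finset.sum_comm, Finset.sum_comm (γ := ι) (f := fun i j =>
      grad (normSum c h) Θ i * w j * partialDeriv (partialDeriv (normSum c h') i) j Θ),
      ← Finset.sum_add_distrib]
    refine Finset.sum_congr rfl fun j _ => ?_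
    rw [← Finset.sum_add_distrib, pow_two]
    conv_lhs => rw [hw]
    simp only [kernelDeriv]
    rw [Finset.mul_sum]
    refine Finset.sum_congr rfl fun i _ => ?_
    simp only [hw, kernelDeriv, grad]
    ring
  have h1 := le_of_abs_le (hh.abs_hessian_le (c := c) hB Θ (grad (normSum c h') Θ) w)
  have h2 := le_of_abs_le (hh'.abs_hessian_le (c := c) hB Θ (grad (normSum c h) Θ) w)
  rcases (l2_nonneg w).eq_or_lt with h0 | h0
  · rw [← h0]
    exact mul_nonneg hH0 (add_nonneg (l2_nonneg _) (l2_nonneg _))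
  · refine le_of_mul_le_mul_left ?_ h0
    nlinarith

end LocalFamily

end Family

end QNN

end

open MeasureTheory ProbabilityTheory Filter Topology

noncomputable section

namespace QNN

/-! ### Local functions of independent uniform parameters -/

/-- The law of independent parameters, uniform in `[0, π]`. -/
def unifPi (ι : Type*) [Fintype ι] : Measure (ι → ℝ) := Measure.pi fun _ => unifLaw

instance {ι : Type*} [Fintype ι] : IsProbabilityMeasure (unifPi ι) := by
  unfold unifPi; infer_instance

section Independence

/-- The irrelevant parameters are frozen at zero. -/
lemma DependsOnlyOn.exists_comp {ι E : Type*} [DecidableEq ι] [TopologicalSpace E] {F : (ι → ℝ) → E} {S : Finset ι}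
    (hF : ∀ Θ Θ' : ι → ℝ, (∀ i ∈ S, Θ i = Θ' i) → F Θ = F Θ') (hc : Continuous F) :
    ∃ G : (S → ℝ) → E, Continuous G ∧ ∀ Θ, F Θ = G fun i => Θ i := by
  refine ⟨fun u => F fun i => if h : i ∈ S then u ⟨i, h⟩ else 0, hc.comp ?_, fun Θ => ?_⟩
  · refine continuous_pi fun i => ?_
    by_cases h : i ∈ S
    · simpa [h] using continuous_apply (⟨i, h⟩ : S)
    · simpa [h] using continuous_const
  · exact hF _ _ fun i hi => by simp [hi]

variable {ι : Type*} [Fintype ι] [DecidableEq ι]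

/-- Disjoint blocks of independent coordinates are independent. The values are complex because
Stein's method applies this to exponentials. -/
lemma integral_mul_of_dependsOnlyOn {F G : (ι → ℝ) → ℂ} {S T : Finset ι} (hST : Disjoint S T)
    (hF : ∀ Θ Θ' : ι → ℝ, (∀ i ∈ S, Θ i = Θ' i) → F Θ = F Θ') (hFc : Continuous F)
    (hG : ∀ Θ Θ' : ι → ℝ, (∀ i ∈ T, Θ i = Θ' i) → G Θ = G Θ') (hGc : Continuous G) :
    ∫ Θ, F Θ * G Θ ∂(unifPi ι) = (∫ Θ, F Θ ∂(unifPi ι)) * ∫ Θ, G Θ ∂(unifPi ι) := by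
  obtain ⟨F', hF'c, hF'⟩ := DependsOnlyOn.exists_comp hF hFc
  obtain ⟨G', hG'c, hG'⟩ := DependsOnlyOn.exists_comp hG hGc
  have hi : iIndepFun (fun i (ω : ι → ℝ) => ω i) (unifPi ι) :=
    iIndepFun_pi (X := fun _ t => t) fun _ => aemeasurable_id
  have hi2 := hi.indepFun_finset S T hST fun i => measurable_pi_apply i
  simp_rw [hF', hG']
  exact hi2.integral_fun_comp_mul_comp
    (measurable_pi_lambda _ fun i => measurable_pi_apply _).aemeasurable
    (measurable_pi_lambda _ fun i => measurable_pi_apply _).aemeasurable hF'c.aestronglyMeasurable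
    hG'c.aestronglyMeasurable

lemma integral_mul_of_dependsOnlyOn_real {F G : (ι → ℝ) → ℝ} {S T : Finset ι} (hST : Disjoint S T)
    (hF : DependsOnlyOn F S) (hFc : Continuous F)
    (hG : DependsOnlyOn G T) (hGc : Continuous G) :
    ∫ Θ, F Θ * G Θ ∂(unifPi ι) = (∫ Θ, F Θ ∂(unifPi ι)) * ∫ Θ, G Θ ∂(unifPi ι) := by
  have := integral_mul_of_dependsOnlyOn hST (F := fun Θ => (F Θ : ℂ)) (G := fun Θ => (G Θ : ℂ))
    (fun Θ Θ' h => by rw [hF Θ Θ' h]) (by fun_prop) (fun Θ Θ' h => by rw [hG Θ Θ' h]) (by fun_prop)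
  simp_rw [← Complex.ofReal_mul, integral_complex_ofReal, ← Complex.ofReal_mul] at this
  exact_mod_cast this

end Independence

/-- Taylor's estimate for small `u`, the triangle inequality for large `u`; the constant `2` covers
both. -/
lemma norm_exp_sub_one_sub_le (u : ℝ) :
    ‖Complex.exp (Complex.I * u) - 1 - Complex.I * u‖ ≤ 2 * u ^ 2 := by
  have hn : ‖Complex.I * (u : ℂ)‖ = |u| := by simp
  rcases le_or_gt |u| 1 with h | h
  · have := Complex.norm_exp_sub_one_sub_id_le (x := Complex.I * u) (by rwa [hn])
    rw [hn, sq_abs] at this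
    nlinarith [sq_nonneg u]
  · refine (norm_sub_le _ _).trans ?_
    have := Real.norm_exp_I_mul_ofReal_sub_one_le (x := u)
    rw [Real.norm_eq_abs] at this
    rw [hn]
    nlinarith [sq_abs u]

namespace LocalFamily

variable {ι κ : Type*} [Fintype ι] [DecidableEq ι] [Fintype κ]
  {h h' : κ → (ι → ℝ) → ℝ} {cone : κ → Finset ι} {B : ℝ} {p q : ℕ} {c : ℝ}

lemma const_mul (hh : LocalFamily h cone B p q) (c : ℝ) :
    LocalFamily (fun k Θ => c * h k Θ) cone (|c| * B) p q where
  shiftRule k := (hh.shiftRule k).const_mul c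
  abs_le k Θ := by
    rw [abs_mul]
    exact mul_le_mul_of_nonneg_left (hh.abs_le k Θ) (abs_nonneg _)
  dependsOnlyOn k Θ Θ' hΘ := by simp only; rw [hh.dependsOnlyOn k Θ Θ' hΘ]
  card_cone_le := hh.card_cone_le
  card_filter_le := hh.card_filter_le

/-- The cones do not depend on `x`, so combining several inputs enlarges neither `p` nor `q`. This
reduces the joint limit theorem to a scalar one. Nonemptiness serves to read off the two cardinality
bounds. -/
lemma linearCombination {𝒳 : Type*} [Fintype 𝒳] {h : 𝒳 → κ → (ι → ℝ) → ℝ}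
    (hh : ∀ x, LocalFamily (h x) cone B p q) (a : 𝒳 → ℝ) (h𝒳 : Nonempty 𝒳) :
    LocalFamily (fun k Θ => ∑ x, a x * h x k Θ) cone ((∑ x, |a x|) * B) p q where
  shiftRule k := ShiftRule.sum fun x _ => ((hh x).shiftRule k).const_mul _
  abs_le k Θ := by
    refine (Finset.abs_sum_le_sum_abs _ _).trans ?_
    rw [Finset.sum_mul]
    refine Finset.sum_le_sum fun x _ => ?_
    rw [abs_mul]
    exact mul_le_mul_of_nonneg_left ((hh x).abs_le k Θ) (abs_nonneg _)
  dependsOnlyOn k Θ Θ' hΘ := Finset.sum_congr rfl fun x _ => by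
    rw [(hh x).dependsOnlyOn k Θ Θ' hΘ]
  card_cone_le := h𝒳.elim fun x => (hh x).card_cone_le
  card_filter_le := h𝒳.elim fun x => (hh x).card_filter_le

/-- The indices whose cones intersect the cone of `k`. -/
def neighbours (cone : κ → Finset ι) (k : κ) : Finset κ :=
  Finset.univ.filter fun k' => ¬ Disjoint (cone k) (cone k')

/-- A neighbour shares one of at most `p` parameters, and each of these lies in at most `q` cones.
-/
lemma card_neighbours_le (hh : LocalFamily h cone B p q) (k : κ) :
    (neighbours cone k).card ≤ p * q := by
  classical
  have : neighbours cone k ⊆ (cone k).biUnion fun i => Finset.univ.filter fun k' => i ∈ cone k' := by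
    intro k' hk'
    simp only [neighbours, Finset.mem_filter, Finset.mem_univ, true_and,
      Finset.not_disjoint_iff] at hk'
    obtain ⟨i, hi, hi'⟩ := hk'
    simp only [Finset.mem_biUnion, Finset.mem_filter, Finset.mem_univ, true_and]
    exact ⟨i, hi, hi'⟩
  calc _ ≤ _ := Finset.card_le_card this
    _ ≤ (cone k).card * q := Finset.card_biUnion_le_card_mul _ _ _ fun i _ => hh.card_filter_le i
    _ ≤ p * q := Nat.mul_le_mul_right _ (hh.card_cone_le k)

/-- The sum over the neighbours of `k`. -/
def neighbourSum (h : κ → (ι → ℝ) → ℝ) (cone : κ → Finset ι) (k : κ) (Θ : ι → ℝ) : ℝ :=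
  ∑ k' ∈ neighbours cone k, h k' Θ

lemma continuous (hh : LocalFamily h cone B p q) (k : κ) : Continuous (h k) :=
  (hh.shiftRule k).continuous

lemma continuous_neighbourSum (hh : LocalFamily h cone B p q) (k : κ) :
    Continuous (neighbourSum h cone k) :=
  continuous_finsetSum _ fun k' _ => hh.continuous k'

lemma abs_neighbourSum_le (hh : LocalFamily h cone B p q) (hB : 0 ≤ B) (k : κ) (Θ : ι → ℝ) :
    |neighbourSum h cone k Θ| ≤ p * q * B := by
  refine (Finset.abs_sum_le_sum_abs _ _).trans ?_
  refine (Finset.sum_le_sum fun k _ => hh.abs_le k Θ).trans ?_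
  rw [Finset.sum_const, nsmul_eq_mul]
  gcongr
  exact_mod_cast hh.card_neighbours_le k

lemma abs_mul_neighbourSum_le (hh : LocalFamily h cone B p q) (hB : 0 ≤ B) (k : κ) (Θ : ι → ℝ) :
    |h k Θ * neighbourSum h cone k Θ| ≤ B * (p * q * B) := by
  rw [abs_mul]
  have := hh.abs_le k Θ
  have := hh.abs_neighbourSum_le hB k Θ
  gcongr

lemma abs_sum_le (hh : LocalFamily h cone B p q) (Θ : ι → ℝ) :
    |∑ k, h k Θ| ≤ Fintype.card κ * B := by
  refine (Finset.abs_sum_le_sum_abs _ _).trans ?_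
  refine (Finset.sum_le_sum fun k _ => hh.abs_le k Θ).trans ?_
  simp

lemma integral_mul_eq_zero (hh : LocalFamily h cone B p q)
    (hh' : LocalFamily h' cone B p q)
    (h0 : ∀ k, ∫ Θ, h k Θ ∂(unifPi ι) = 0) {k k' : κ} (hk : k' ∉ neighbours cone k) :
    ∫ Θ, h k Θ * h' k' Θ ∂(unifPi ι) = 0 := by
  have hd : Disjoint (cone k) (cone k') := by simpa [neighbours] using hk
  rw [integral_mul_of_dependsOnlyOn_real hd (hh.dependsOnlyOn k) (hh.continuous k)
    (hh'.dependsOnlyOn k') (hh'.continuous k'), h0, zero_mul]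

lemma integrable_mul (hh : LocalFamily h cone B p q) (hB : 0 ≤ B) (k k' : κ) :
    Integrable (fun Θ => h k Θ * h k' Θ) (unifPi ι) := by
  refine integrable_of_abs_le (B := B * B)
    ((hh.continuous k).mul (hh.continuous k')).aestronglyMeasurable fun Θ => ?_
  rw [abs_mul]
  have := hh.abs_le k Θ
  have := hh.abs_le k' Θ
  gcongr

/-- Non-neighbours are independent and centered, so only neighbouring pairs survive. An index with
empty cone is not its own neighbour; its diagonal term vanishes by the same argument. -/
lemma integral_sum_sq (hh : LocalFamily h cone B p q) (hB : 0 ≤ B)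
    (h0 : ∀ k, ∫ Θ, h k Θ ∂(unifPi ι) = 0) :
    ∫ Θ, (∑ k, h k Θ) ^ 2 ∂(unifPi ι)
      = ∫ Θ, ∑ k, h k Θ * neighbourSum h cone k Θ ∂(unifPi ι) := by
  have e1 : ∀ Θ, (∑ k, h k Θ) ^ 2 = ∑ k, ∑ k', h k Θ * h k' Θ := fun Θ => by
    rw [pow_two, Finset.sum_mul_sum]
  have e2 : ∀ Θ, ∑ k, h k Θ * neighbourSum h cone k Θ
      = ∑ k, ∑ k' ∈ neighbours cone k, h k Θ * h k' Θ := fun Θ => by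
    simp_rw [neighbourSum, Finset.mul_sum]
  simp_rw [e1, e2]
  rw [integral_finsetSum _ fun k _ => integrable_finsetSum _ fun k' _ => hh.integrable_mul hB k k',
    integral_finsetSum _ fun k _ => integrable_finsetSum _ fun k' _ => hh.integrable_mul hB k k']
  refine Finset.sum_congr rfl fun k _ => ?_
  rw [integral_finsetSum _ fun k' _ => hh.integrable_mul hB k k',
    integral_finsetSum _ fun k' _ => hh.integrable_mul hB k k']
  symm
  refine Finset.sum_subset (Finset.subset_univ _) fun k' _ hk' => ?_
  exact hh.integral_mul_eq_zero hh h0 hk'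

lemma integral_sum_sq_le (hh : LocalFamily h cone B p q) (hB : 0 ≤ B)
    (h0 : ∀ k, ∫ Θ, h k Θ ∂(unifPi ι) = 0) :
    ∫ Θ, (∑ k, h k Θ) ^ 2 ∂(unifPi ι) ≤ Fintype.card κ * (p * q) * B ^ 2 := by
  rw [hh.integral_sum_sq hB h0]
  refine le_of_abs_le (abs_integral_le_of_abs_le fun Θ => ?_)
  refine (Finset.abs_sum_le_sum_abs _ _).trans ?_
  refine (Finset.sum_le_sum fun k _ => hh.abs_mul_neighbourSum_le hB k Θ).trans (le_of_eq ?_)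
  simp
  ring

/-- Variance of a normalized sum of local functions: Poincaré inequality. -/
lemma poincare_normSum (hh : LocalFamily h cone B p q) (c : ℝ) :
    ∫ Θ, normSum c h Θ ^ 2 ∂(unifPi ι) - (∫ Θ, normSum c h Θ ∂(unifPi ι)) ^ 2
      ≤ Real.pi ^ 2 * ∫ Θ, l2 (grad (normSum c h) Θ) ^ 2 ∂(unifPi ι) := by
  have hs := hh.shiftRule_normSum c
  have hb := hh.abs_normSum_le c
  have hd := hs.abs_partialDeriv_le hb
  have := poincare (B := 2 * (|c| * (Fintype.card κ * B))) (normSum c h)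
    (fun i => partialDeriv (normSum c h) i) hs.continuous
    (fun Θ => (hb Θ).trans (by linarith [(abs_nonneg _).trans (hb Θ)]))
    hs.continuous_partialDeriv hd
    (hasDerivAt_comp_update hs.differentiable)
  refine this.trans (le_of_eq ?_)
  simp_rw [l2_sq]
  rw [integral_finsetSum]
  · rfl
  · intro i _
    refine integrable_of_abs_le (B := (2 * (|c| * (Fintype.card κ * B))) ^ 2)
      ((hs.continuous_partialDeriv i).pow 2).aestronglyMeasurable fun Θ => ?_
    rw [abs_pow]
    exact pow_le_pow_left₀ (abs_nonneg _) (hd i Θ) 2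

/-- Variance of the scalar product of the gradients of two normalized sums of local functions. -/
lemma poincare_kernel (hh : LocalFamily h cone B p q) (hh' : LocalFamily h' cone B p q)
    (hB : 0 ≤ B) (c : ℝ) :
    ∫ Θ, (∑ i, grad (normSum c h) Θ i * grad (normSum c h') Θ i) ^ 2 ∂(unifPi ι)
      - (∫ Θ, ∑ i, grad (normSum c h) Θ i * grad (normSum c h') Θ i ∂(unifPi ι)) ^ 2
      ≤ Real.pi ^ 2 * (2 * (4 * B * |c| * (p * q)) ^ 2 *
        (∫ Θ, l2 (grad (normSum c h) Θ) ^ 2 ∂(unifPi ι)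
          + ∫ Θ, l2 (grad (normSum c h') Θ) ^ 2 ∂(unifPi ι))) := by
  have hs := hh.shiftRule_normSum c
  have hb := hh.abs_normSum_le c
  have hd := hs.abs_partialDeriv_le hb
  have hdd := fun i => (hs.partialDeriv i).abs_partialDeriv_le (hd i)
  have hs' := hh'.shiftRule_normSum c
  have hb' := hh'.abs_normSum_le c
  have hd' := hs'.abs_partialDeriv_le hb'
  have hdd' := fun i => (hs'.partialDeriv i).abs_partialDeriv_le (hd' i)
  set b := |c| * (Fintype.card κ * B)
  have hb0 : 0 ≤ b := by positivity
  have hD : ∀ j, Continuous (kernelDeriv (normSum c h) (normSum c h') j) := fun j => by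
    refine continuous_finsetSum _ fun i _ => ?_
    have := hs.continuous_partialDeriv i
    have := hs'.continuous_partialDeriv i
    have := (hs.partialDeriv i).continuous_partialDeriv j
    have := (hs'.partialDeriv i).continuous_partialDeriv j
    fun_prop
  -- A crude bound for integrability; it does not enter the conclusion.
  have hDB : ∀ j Θ, |kernelDeriv (normSum c h) (normSum c h') j Θ|
      ≤ Fintype.card ι * (16 * b ^ 2) := fun j Θ => by
    refine (Finset.abs_sum_le_sum_abs _ _).trans ?_
    calc _ ≤ ∑ i : ι, (16 * b ^ 2) := by
          refine Finset.sum_le_sum fun i _ => (abs_add_le _ _).trans ?_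
          rw [abs_mul, abs_mul]
          have h1 := mul_le_mul (hdd i j Θ) (hd' i Θ) (abs_nonneg _) (by positivity)
          have h2 := mul_le_mul (hd i Θ) (hdd' i j Θ) (abs_nonneg _) (by positivity)
          nlinarith
      _ = _ := by simp
  have hint : ∀ (h : κ → (ι → ℝ) → ℝ), LocalFamily h cone B p q →
      Integrable (fun Θ => l2 (grad (normSum c h) Θ) ^ 2) (unifPi ι) := fun h hh => by
    have hs := hh.shiftRule_normSum c
    simp_rw [l2_sq]
    refine integrable_finsetSum _ fun i _ => ?_
    refine integrable_of_abs_le (B := (2 * b) ^ 2)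
      ((hs.continuous_partialDeriv i).pow 2).aestronglyMeasurable fun Θ => ?_
    rw [abs_pow]
    exact pow_le_pow_left₀ (abs_nonneg _) (hs.abs_partialDeriv_le (hh.abs_normSum_le c) i Θ) 2
  have := poincare (B := Fintype.card ι * (16 * b ^ 2))
    (fun Θ => ∑ i, grad (normSum c h) Θ i * grad (normSum c h') Θ i)
    (kernelDeriv (normSum c h) (normSum c h')) ?_ ?_ hD hDB ?_
  · refine this.trans ?_
    gcongr
    rw [← integral_finsetSum, ← integral_add (hint h hh) (hint h' hh'), ← integral_const_mul]
    · refine integral_mono_of_nonneg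
        (ae_of_all _ fun Θ => Finset.sum_nonneg fun j _ => sq_nonneg _)
        (((hint h hh).add (hint h' hh')).const_mul _) (ae_of_all _ fun Θ => ?_)
      have h1 := hh.l2_kernelDeriv_le (c := c) hh' hB Θ
      have h2 := pow_le_pow_left₀ (l2_nonneg _) h1 2
      rw [l2_sq] at h2
      refine h2.trans ?_
      rw [mul_pow]
      have h3 : (l2 (grad (normSum c h) Θ) + l2 (grad (normSum c h') Θ)) ^ 2 ≤
        2 * (l2 (grad (normSum c h) Θ) ^ 2 + l2 (grad (normSum c h') Θ) ^ 2) := add_sq_le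
      have h4 := mul_le_mul_of_nonneg_left h3 (sq_nonneg (4 * B * |c| * (p * q)))
      simp only
      linarith
    · intro j _
      refine integrable_of_abs_le (B := (Fintype.card ι * (16 * b ^ 2)) ^ 2)
        ((hD j).pow 2).aestronglyMeasurable fun Θ => ?_
      rw [abs_pow]
      exact pow_le_pow_left₀ (abs_nonneg _) (hDB j Θ) 2
  · refine continuous_finsetSum _ fun i _ => ?_
    exact (hs.continuous_partialDeriv i).mul (hs'.continuous_partialDeriv i)
  · intro Θ
    refine (Finset.abs_sum_le_sum_abs _ _).trans ?_
    calc _ ≤ ∑ i : ι, (16 * b ^ 2) := by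
          refine Finset.sum_le_sum fun i _ => ?_
          rw [abs_mul]
          have h1 := mul_le_mul (hd i Θ) (hd' i Θ) (abs_nonneg _) (by positivity)
          simp only [grad]
          nlinarith
      _ = _ := by simp
  · intro j Θ t
    refine HasDerivAt.fun_sum fun i _ => ?_
    exact (hasDerivAt_comp_update (hs.partialDeriv i).differentiable j Θ t).mul
      (hasDerivAt_comp_update (hs'.partialDeriv i).differentiable j Θ t)

end LocalFamily

end QNN

end

/-! ### Stein's method for sums of local functions -/

open MeasureTheory ProbabilityTheory Filter Topology

noncomputable section

namespace QNN

/-- Jensen's inequality, as the nonnegativity of the variance of `|W - w|`. -/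
lemma integral_abs_sub_le_sqrt {α : Type*} [MeasurableSpace α] {μ : Measure α}
    [IsProbabilityMeasure μ] {W : α → ℝ} (hW : AEStronglyMeasurable W μ) {b V : ℝ}
    (hb : ∀ a, |W a| ≤ b) (hV : ∫ a, W a ^ 2 ∂μ - (∫ a, W a ∂μ) ^ 2 ≤ V) :
    ∫ a, |W a - ∫ a, W a ∂μ| ∂μ ≤ √V := by
  set w := ∫ a, W a ∂μ with hw
  have hWi : Integrable W μ := integrable_of_abs_le hW hb
  have hW2 : Integrable (fun a => W a ^ 2) μ :=
    integrable_of_abs_le (B := b ^ 2) (hW.pow 2) fun a => by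
      rw [abs_pow]; exact pow_le_pow_left₀ (abs_nonneg _) (hb a) 2
  have h1 : Integrable (fun a => (W a - w) ^ 2) μ := by
    have : (fun a => (W a - w) ^ 2) = fun a => W a ^ 2 - 2 * w * W a + w ^ 2 := by ext; ring
    rw [this]
    exact (hW2.sub (hWi.const_mul _)).add (integrable_const _)
  have h2 : ∫ a, (W a - w) ^ 2 ∂μ = ∫ a, W a ^ 2 ∂μ - w ^ 2 := by
    have : (fun a => (W a - w) ^ 2) = fun a => W a ^ 2 - 2 * w * W a + w ^ 2 := by ext; ring
    have h3 : Integrable (fun a => W a ^ 2 - 2 * w * W a) μ := hW2.sub (hWi.const_mul _)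
    rw [this, integral_add h3 (integrable_const _), integral_sub hW2 (hWi.const_mul _),
      integral_const_mul, ← hw]
    simp
    ring
  have habs : Integrable (fun a => |W a - w|) μ := (hWi.sub (integrable_const w)).abs
  apply Real.le_sqrt_of_sq_le
  set c := ∫ a, |W a - w| ∂μ with hc
  have h4 : 0 ≤ ∫ a, (|W a - w| - c) ^ 2 ∂μ := integral_nonneg fun a => sq_nonneg _
  have h5 : (fun a => (|W a - w| - c) ^ 2) = fun a => (W a - w) ^ 2 - 2 * c * |W a - w| + c ^ 2 := by
    ext a
    rw [← sq_abs (W a - w)]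
    ring
  have h6 : Integrable (fun a => (W a - w) ^ 2 - 2 * c * |W a - w|) μ := h1.sub (habs.const_mul _)
  rw [h5, integral_add h6 (integrable_const _), integral_sub h1 (habs.const_mul _),
    integral_const_mul, ← hc, h2] at h4
  simp at h4
  linarith

namespace LocalFamily

variable {ι κ : Type*} [Fintype ι] [DecidableEq ι] [Fintype κ]
  {h : κ → (ι → ℝ) → ℝ} {cone : κ → Finset ι} {B : ℝ} {p q : ℕ}

lemma sum_abs_partialDeriv_le (hh : LocalFamily h cone B p q) (hB : 0 ≤ B) (j : ι)
    (Θ : ι → ℝ) : ∑ k, |partialDeriv (h k) j Θ| ≤ q * (2 * B) := by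
  rw [← Finset.sum_filter_of_ne (p := fun k => j ∈ cone k)]
  · refine (Finset.sum_le_sum fun k _ =>
      (hh.shiftRule k).abs_partialDeriv_le (hh.abs_le k) j Θ).trans ?_
    rw [Finset.sum_const, nsmul_eq_mul]
    have := hh.card_filter_le j
    gcongr
  · intro k _ hk
    by_contra hi
    exact hk (by rw [(hh.dependsOnlyOn k).partialDeriv_eq_zero (hh.shiftRule k) hi Θ, abs_zero])

/-- The variance of `∑ k, h k * neighbourSum h k`. -/
lemma variance_sum_mul_neighbourSum_le (hh : LocalFamily h cone B p q) (hB : 0 ≤ B) :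
    ∫ Θ, (∑ k, h k Θ * neighbourSum h cone k Θ) ^ 2 ∂(unifPi ι)
      - (∫ Θ, ∑ k, h k Θ * neighbourSum h cone k Θ ∂(unifPi ι)) ^ 2
      ≤ Real.pi ^ 2 * (Fintype.card ι * (4 * B ^ 2 * p * q ^ 2) ^ 2) := by
  set D : ι → (ι → ℝ) → ℝ := fun j Θ => ∑ k, (partialDeriv (h k) j Θ * neighbourSum h cone k Θ +
    h k Θ * ∑ k' ∈ neighbours cone k, partialDeriv (h k') j Θ) with hD
  have hDc : ∀ j, Continuous (D j) := fun j => by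
    refine continuous_finsetSum _ fun k _ => ?_
    have h1 := fun k => (hh.shiftRule k).continuous_partialDeriv j
    exact ((h1 k).mul (hh.continuous_neighbourSum k)).add
      ((hh.continuous k).mul (continuous_finsetSum _ fun k' _ => h1 k'))
  have hDB : ∀ j Θ, |D j Θ| ≤ 4 * B ^ 2 * p * q ^ 2 := fun j Θ => by
    have hs := hh.sum_abs_partialDeriv_le hB j Θ
    calc |D j Θ| ≤ ∑ k, (|partialDeriv (h k) j Θ| * |neighbourSum h cone k Θ| +
          |h k Θ| * ∑ k' ∈ neighbours cone k, |partialDeriv (h k') j Θ|) := by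
          refine (Finset.abs_sum_le_sum_abs _ _).trans (Finset.sum_le_sum fun k _ => ?_)
          refine (abs_add_le _ _).trans ?_
          rw [abs_mul, abs_mul]
          gcongr
          exact Finset.abs_sum_le_sum_abs _ _
      _ ≤ ∑ k, (|partialDeriv (h k) j Θ| * (p * q * B)) +
          ∑ k, B * ∑ k' ∈ neighbours cone k, |partialDeriv (h k') j Θ| := by
          rw [← Finset.sum_add_distrib]
          refine Finset.sum_le_sum fun k _ => ?_
          have h1 := hh.abs_neighbourSum_le hB k Θ
          have h2 := hh.abs_le k Θ
          have h3 : 0 ≤ ∑ k' ∈ neighbours cone k, |partialDeriv (h k') j Θ| :=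
            Finset.sum_nonneg fun _ _ => abs_nonneg _
          gcongr
      -- Being neighbours is symmetric, so after exchanging the sums each derivative is counted once
      -- per neighbour.
      _ = ∑ k, (|partialDeriv (h k) j Θ| * (p * q * B)) +
          ∑ k', (neighbours cone k').card * (B * |partialDeriv (h k') j Θ|) := by
          congr 1
          simp_rw [Finset.mul_sum]
          rw [Finset.sum_comm' (t' := Finset.univ) (s' := fun k' => neighbours cone k')]
          · simp
          · intro x y
            simp [neighbours, disjoint_comm]
      _ ≤ ∑ k, (|partialDeriv (h k) j Θ| * (p * q * B)) +
          ∑ k, (|partialDeriv (h k) j Θ| * (p * q * B)) := by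
          refine add_le_add le_rfl (Finset.sum_le_sum fun k _ => ?_)
          have h1 : ((neighbours cone k).card : ℝ) ≤ p * q := by
            exact_mod_cast hh.card_neighbours_le k
          have h2 : 0 ≤ B * |partialDeriv (h k) j Θ| := by positivity
          nlinarith [mul_le_mul_of_nonneg_right h1 h2]
      _ ≤ 2 * ((q * (2 * B)) * (p * q * B)) := by
          rw [← Finset.sum_mul, two_mul]
          gcongr
      _ = _ := by ring
  have hb : ∀ Θ, |∑ k, h k Θ * neighbourSum h cone k Θ|
      ≤ Fintype.card κ * (B * (p * q * B)) := fun Θ => by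
    refine (Finset.abs_sum_le_sum_abs _ _).trans ?_
    refine (Finset.sum_le_sum fun k _ => hh.abs_mul_neighbourSum_le hB k Θ).trans (le_of_eq ?_)
    simp
  refine (poincare (B := max (Fintype.card κ * (B * (p * q * B))) (4 * B ^ 2 * p * q ^ 2))
    _ D ?_ (fun Θ => (hb Θ).trans (le_max_left _ _)) hDc
    (fun j Θ => (hDB j Θ).trans (le_max_right _ _)) ?_).trans ?_
  · exact continuous_finsetSum _ fun k _ => (hh.continuous k).mul (hh.continuous_neighbourSum k)
  · intro j Θ t
    refine HasDerivAt.fun_sum fun k _ => ?_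
    refine (hasDerivAt_comp_update (hh.shiftRule k).differentiable j Θ t).mul ?_
    exact HasDerivAt.fun_sum fun k' _ =>
      hasDerivAt_comp_update (hh.shiftRule k').differentiable j Θ t
  · gcongr
    calc _ ≤ ∑ j : ι, (4 * B ^ 2 * p * q ^ 2) ^ 2 := by
          refine Finset.sum_le_sum fun j _ => le_of_abs_le (abs_integral_le_of_abs_le fun Θ => ?_)
          rw [abs_pow]
          exact pow_le_pow_left₀ (abs_nonneg _) (hDB j Θ) 2
      _ = _ := by simp

/-- One step of Stein's method: replacing a local function by its mean. -/
lemma norm_integral_stein_le (hh : LocalFamily h cone B p q) (hB : 0 ≤ B)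
    (h0 : ∀ k, ∫ Θ, h k Θ ∂(unifPi ι) = 0) (s : ℝ) (k : κ) :
    ‖∫ Θ, (h k Θ : ℂ) * Complex.exp (Complex.I * (s * ∑ k, h k Θ : ℝ)) ∂(unifPi ι)
      - Complex.I * s * ∫ Θ, (h k Θ * neighbourSum h cone k Θ : ℝ) *
        Complex.exp (Complex.I * (s * ∑ k, h k Θ : ℝ)) ∂(unifPi ι)‖
      ≤ B * (2 * (s * (p * q * B)) ^ 2) := by
  classical
  set S : (ι → ℝ) → ℝ := fun Θ => ∑ k, h k Θ with hS
  set R := neighbourSum h cone k with hR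
  have hSc : Continuous S := continuous_finsetSum _ fun k _ => hh.continuous k
  have hRc : Continuous R := hh.continuous_neighbourSum k
  have hkc : Continuous (h k) := hh.continuous k
  have hcompl : ∀ Θ, S Θ - R Θ = ∑ k' ∈ (neighbours cone k)ᶜ, h k' Θ := fun Θ => by
    rw [sub_eq_iff_eq_add, hR, neighbourSum, add_comm]
    exact (Finset.sum_add_sum_compl _ _).symm
  -- Members that are not neighbours of `k` see no parameter of its cone. So `S - R` is independent
  -- of `h k`, which has mean zero.
  have hzero : ∫ Θ, (h k Θ : ℂ) * Complex.exp (Complex.I * (s * (S Θ - R Θ) : ℝ)) ∂(unifPi ι)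
      = 0 := by
    rw [integral_mul_of_dependsOnlyOn (S := cone k) (T := (cone k)ᶜ) disjoint_compl_right
      (F := fun Θ => (h k Θ : ℂ))
      (G := fun Θ => Complex.exp (Complex.I * (s * (S Θ - R Θ) : ℝ))), integral_complex_ofReal,
      h0 k]
    · simp
    · intro Θ Θ' hΘ
      rw [hh.dependsOnlyOn k Θ Θ' hΘ]
    · fun_prop
    · intro Θ Θ' hΘ
      rw [hcompl, hcompl]
      congr 4
      refine Finset.sum_congr rfl fun k' hk' => hh.dependsOnlyOn k' Θ Θ' fun i hi => hΘ i ?_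
      simp only [neighbours, Finset.mem_compl, Finset.mem_filter, Finset.mem_univ, true_and,
        not_not] at hk'
      exact Finset.mem_compl.2 fun hi' => Finset.disjoint_left.1 hk' hi' hi
    · fun_prop
  have hint : ∀ (f : (ι → ℝ) → ℝ) (g : (ι → ℝ) → ℝ) (b : ℝ), Continuous f → Continuous g →
      (∀ Θ, |f Θ| ≤ b) →
      Integrable (fun Θ => (f Θ : ℂ) * Complex.exp (Complex.I * (g Θ : ℝ))) (unifPi ι) := by
    intro f g b hf hg hfb
    refine Integrable.of_bound (C := b) (by fun_prop) (ae_of_all _ fun Θ => ?_)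
    rw [norm_mul, Complex.norm_exp_I_mul_ofReal, mul_one, Complex.norm_real]
    exact hfb Θ
  have i1 := hint (h k) (fun Θ => s * S Θ) B hkc (by fun_prop) (hh.abs_le k)
  have i2 := hint (fun Θ => h k Θ * R Θ) (fun Θ => s * S Θ) _ (by fun_prop) (by fun_prop)
    (hh.abs_mul_neighbourSum_le hB k)
  have i3 := hint (h k) (fun Θ => s * (S Θ - R Θ)) B hkc (by fun_prop) (hh.abs_le k)
  have hsplit : ∫ Θ, (h k Θ : ℂ) * Complex.exp (Complex.I * (s * S Θ : ℝ)) ∂(unifPi ι)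
      - Complex.I * s * ∫ Θ, (h k Θ * R Θ : ℝ) *
        Complex.exp (Complex.I * (s * S Θ : ℝ)) ∂(unifPi ι) =
      ∫ Θ, ((h k Θ : ℂ) * Complex.exp (Complex.I * (s * S Θ : ℝ)) - Complex.I * s *
        ((h k Θ * R Θ : ℝ) * Complex.exp (Complex.I * (s * S Θ : ℝ))) -
        (h k Θ : ℂ) * Complex.exp (Complex.I * (s * (S Θ - R Θ) : ℝ))) ∂(unifPi ι) := by
    have i12 : Integrable (fun Θ => (h k Θ : ℂ) * Complex.exp (Complex.I * (s * S Θ : ℝ)) -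
        Complex.I * s * ((h k Θ * R Θ : ℝ) * Complex.exp (Complex.I * (s * S Θ : ℝ))))
        (unifPi ι) := i1.sub (i2.const_mul _)
    rw [integral_sub i12 i3, hzero, sub_zero,
      integral_sub i1 (i2.const_mul _), integral_const_mul]
  rw [hsplit]
  refine (norm_integral_le_of_norm_le_const (C := B * (2 * (s * (p * q * B)) ^ 2))
    (ae_of_all _ fun Θ => ?_)).trans (by simp)
  -- Subtracting the term with vanishing integral leaves `-h k * exp (i s S)` times the second-order
  -- remainder of the exponential at `-i s R`.
  have e : (h k Θ : ℂ) * Complex.exp (Complex.I * (s * S Θ : ℝ)) - Complex.I * s *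
        ((h k Θ * R Θ : ℝ) * Complex.exp (Complex.I * (s * S Θ : ℝ))) -
        (h k Θ : ℂ) * Complex.exp (Complex.I * (s * (S Θ - R Θ) : ℝ))
      = -((h k Θ : ℂ) * Complex.exp (Complex.I * (s * S Θ : ℝ)) *
        (Complex.exp (Complex.I * (-(s * R Θ) : ℝ)) - 1 - Complex.I * (-(s * R Θ) : ℝ))) := by
    have : Complex.exp (Complex.I * (s * (S Θ - R Θ) : ℝ)) =
        Complex.exp (Complex.I * (s * S Θ : ℝ)) * Complex.exp (Complex.I * (-(s * R Θ) : ℝ)) := by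
      rw [← Complex.exp_add]
      congr 1
      push_cast
      ring
    rw [this]
    push_cast
    ring
  rw [e, norm_neg, norm_mul, norm_mul, Complex.norm_exp_I_mul_ofReal, mul_one, Complex.norm_real,
    Real.norm_eq_abs]
  have h1 := hh.abs_le k Θ
  have h2 := norm_exp_sub_one_sub_le (-(s * R Θ))
  have h3 : (-(s * R Θ)) ^ 2 ≤ (s * (p * q * B)) ^ 2 := by
    rw [neg_sq, mul_pow, mul_pow]
    refine mul_le_mul_of_nonneg_left ?_ (sq_nonneg _)
    rw [← sq_abs (R Θ)]
    exact pow_le_pow_left₀ (abs_nonneg _) (hh.abs_neighbourSum_le hB k Θ) 2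
  exact mul_le_mul h1 (h2.trans (by linarith)) (norm_nonneg _) hB

/-- **Quantitative central limit theorem** for sums of local functions. -/
theorem norm_charFun_sub_le (hh : LocalFamily h cone B p q) (hB : 0 ≤ B)
    (h0 : ∀ k, ∫ Θ, h k Θ ∂(unifPi ι) = 0) :
    ‖∫ Θ, Complex.exp (Complex.I * (∑ k, h k Θ : ℝ)) ∂(unifPi ι)
      - Complex.exp (-((∫ Θ, (∑ k, h k Θ) ^ 2 ∂(unifPi ι) : ℝ) / 2 : ℂ))‖
      ≤ √(Real.pi ^ 2 * (Fintype.card ι * (4 * B ^ 2 * p * q ^ 2) ^ 2)) +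
        Fintype.card κ * (B * (2 * (p * q * B) ^ 2)) := by
  set S : (ι → ℝ) → ℝ := fun Θ => ∑ k, h k Θ with hS
  set W : (ι → ℝ) → ℝ := fun Θ => ∑ k, h k Θ * neighbourSum h cone k Θ with hW
  set σ2 : ℝ := ∫ Θ, S Θ ^ 2 ∂(unifPi ι) with hσ
  have hσW : σ2 = ∫ Θ, W Θ ∂(unifPi ι) := hh.integral_sum_sq hB h0
  have hσ0 : 0 ≤ σ2 := integral_nonneg fun Θ => sq_nonneg _
  set V : ℝ := Real.pi ^ 2 * (Fintype.card ι * (4 * B ^ 2 * p * q ^ 2) ^ 2) with hV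
  set E : ℝ := Fintype.card κ * (B * (2 * (p * q * B) ^ 2)) with hE
  have hSc : Continuous S := continuous_finsetSum _ fun k _ => hh.continuous k
  have hWc : Continuous W :=
    continuous_finsetSum _ fun k _ => (hh.continuous k).mul (hh.continuous_neighbourSum k)
  have hWb : ∀ Θ, |W Θ| ≤ Fintype.card κ * (B * (p * q * B)) := fun Θ => by
    refine (Finset.abs_sum_le_sum_abs _ _).trans ?_
    refine (Finset.sum_le_sum fun k _ => hh.abs_mul_neighbourSum_le hB k Θ).trans (le_of_eq ?_)
    simp
  set φ : ℝ → ℂ := fun s => ∫ Θ, Complex.exp (Complex.I * (s * S Θ : ℝ)) ∂(unifPi ι) with hφ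
  have hint : ∀ (f : (ι → ℝ) → ℝ) (g : (ι → ℝ) → ℝ) (b : ℝ), Continuous f → Continuous g →
      (∀ Θ, |f Θ| ≤ b) →
      Integrable (fun Θ => (f Θ : ℂ) * Complex.exp (Complex.I * (g Θ : ℝ))) (unifPi ι) := by
    intro f g b hf hg hfb
    refine Integrable.of_bound (C := b) (by fun_prop) (ae_of_all _ fun Θ => ?_)
    rw [norm_mul, Complex.norm_exp_I_mul_ofReal, mul_one, Complex.norm_real]
    exact hfb Θ
  have hφd : ∀ s, HasDerivAt φ (∫ Θ, Complex.I * ((S Θ : ℂ) *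
      Complex.exp (Complex.I * (s * S Θ : ℝ))) ∂(unifPi ι)) s := fun s => by
    refine (hasDerivAt_integral_of_dominated_loc_of_deriv_le (s := Set.univ)
      (bound := fun _ => Fintype.card κ * B) (F' := fun s Θ => Complex.I * ((S Θ : ℂ) *
      Complex.exp (Complex.I * (s * S Θ : ℝ)))) Filter.univ_mem ?_ ?_ ?_ ?_ ?_ ?_).2
    · exact Eventually.of_forall fun s => by fun_prop
    · refine Integrable.of_bound (C := 1) (by fun_prop) (ae_of_all _ fun Θ => ?_)
      rw [Complex.norm_exp_I_mul_ofReal]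
    · fun_prop
    · refine ae_of_all _ fun Θ s _ => ?_
      rw [norm_mul, norm_mul, Complex.norm_exp_I_mul_ofReal, mul_one, Complex.norm_I, one_mul,
        Complex.norm_real]
      exact hh.abs_sum_le Θ
    · exact integrable_const _
    · refine ae_of_all _ fun Θ s _ => ?_
      have h1 : HasDerivAt (fun s : ℝ => Complex.I * ((s * S Θ : ℝ) : ℂ))
          (Complex.I * ((1 * S Θ : ℝ) : ℂ)) s :=
        (((hasDerivAt_id s).mul_const (S Θ)).ofReal_comp).const_mul _
      refine h1.cexp.congr_deriv ?_
      rw [one_mul]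
      ring
  -- The characteristic function almost solves `φ' = -s σ2 φ`, the equation of the Gaussian one. The
  -- defect has two sources: the Taylor errors of the Stein steps, summed to `E`, and the
  -- fluctuation of `W` about its mean `σ2`, at most `√V`.
  have hbound : ∀ s ∈ Set.Icc (0 : ℝ) 1,
      ‖(∫ Θ, Complex.I * ((S Θ : ℂ) * Complex.exp (Complex.I * (s * S Θ : ℝ))) ∂(unifPi ι))
        + s * σ2 * φ s‖ ≤ √V + E := by
    intro s hs
    have iW := hint W (fun Θ => s * S Θ) _ hWc (by fun_prop) hWb
    have i1 : Integrable (fun Θ => Complex.exp (Complex.I * (s * S Θ : ℝ))) (unifPi ι) := by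
      refine Integrable.of_bound (C := 1) (by fun_prop) (ae_of_all _ fun Θ => ?_)
      rw [Complex.norm_exp_I_mul_ofReal]
    have iWk := fun k => hint (fun Θ => h k Θ * neighbourSum h cone k Θ) (fun Θ => s * S Θ) _
      ((hh.continuous k).mul (hh.continuous_neighbourSum k)) (by fun_prop)
      (hh.abs_mul_neighbourSum_le hB k)
    have ik := fun k => hint (h k) (fun Θ => s * S Θ) _ (hh.continuous k) (by fun_prop)
      (hh.abs_le k)
    have e1 : ∫ Θ, (S Θ : ℂ) * Complex.exp (Complex.I * (s * S Θ : ℝ)) ∂(unifPi ι)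
        = ∑ k, ∫ Θ, (h k Θ : ℂ) * Complex.exp (Complex.I * (s * S Θ : ℝ)) ∂(unifPi ι) := by
      rw [← integral_finsetSum _ fun k _ => ik k]
      congr with Θ
      rw [← Finset.sum_mul, hS]
      push_cast
      rfl
    have e2 : ∫ Θ, (W Θ : ℂ) * Complex.exp (Complex.I * (s * S Θ : ℝ)) ∂(unifPi ι)
        = ∑ k, ∫ Θ, (h k Θ * neighbourSum h cone k Θ : ℝ) *
          Complex.exp (Complex.I * (s * S Θ : ℝ)) ∂(unifPi ι) := by
      rw [← integral_finsetSum _ fun k _ => iWk k]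
      congr with Θ
      rw [← Finset.sum_mul, hW]
      push_cast
      rfl
    have e3 : ∫ Θ, ((W Θ - σ2 : ℝ) : ℂ) * Complex.exp (Complex.I * (s * S Θ : ℝ)) ∂(unifPi ι)
        = ∫ Θ, (W Θ : ℂ) * Complex.exp (Complex.I * (s * S Θ : ℝ)) ∂(unifPi ι) - σ2 * φ s := by
      rw [hφ]
      simp only
      rw [← integral_const_mul, ← integral_sub iW (i1.const_mul _)]
      congr with Θ
      push_cast
      ring
    have e4 : (∫ Θ, Complex.I * ((S Θ : ℂ) * Complex.exp (Complex.I * (s * S Θ : ℝ))) ∂(unifPi ι))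
        + s * σ2 * φ s =
        Complex.I * (∑ k, ((∫ Θ, (h k Θ : ℂ) * Complex.exp (Complex.I * (s * S Θ : ℝ)) ∂(unifPi ι))
          - Complex.I * s * ∫ Θ, (h k Θ * neighbourSum h cone k Θ : ℝ) *
          Complex.exp (Complex.I * (s * S Θ : ℝ)) ∂(unifPi ι)))
        - s * ∫ Θ, ((W Θ - σ2 : ℝ) : ℂ) * Complex.exp (Complex.I * (s * S Θ : ℝ)) ∂(unifPi ι) := by
      rw [e3, integral_const_mul, e1, Finset.sum_sub_distrib, ← Finset.mul_sum, ← e2]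
      linear_combination ((s : ℂ) * ∫ Θ, (W Θ : ℂ) *
        Complex.exp (Complex.I * (s * S Θ : ℝ)) ∂(unifPi ι)) * Complex.I_mul_I
    have n1 : ‖∫ Θ, ((W Θ - σ2 : ℝ) : ℂ) * Complex.exp (Complex.I * (s * S Θ : ℝ)) ∂(unifPi ι)‖
        ≤ √V := by
      refine (norm_integral_le_integral_norm _).trans ?_
      simp_rw [norm_mul, Complex.norm_exp_I_mul_ofReal, mul_one, Complex.norm_real,
        Real.norm_eq_abs, hσW]
      exact integral_abs_sub_le_sqrt hWc.aestronglyMeasurable hWb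
        (hh.variance_sum_mul_neighbourSum_le hB)
    rw [e4]
    refine (norm_sub_le _ _).trans ?_
    rw [norm_mul, norm_mul, Complex.norm_I, one_mul, add_comm]
    have hs1 : ‖(s : ℂ)‖ ≤ 1 := by
      rw [Complex.norm_real, Real.norm_eq_abs, abs_of_nonneg hs.1]
      exact hs.2
    refine add_le_add ?_ ?_
    · calc _ ≤ 1 * √V := mul_le_mul hs1 n1 (norm_nonneg _) zero_le_one
        _ = _ := one_mul _
    · refine (norm_sum_le _ _).trans ?_
      calc _ ≤ ∑ k : κ, B * (2 * (p * q * B) ^ 2) := by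
            refine Finset.sum_le_sum fun k _ => (hh.norm_integral_stein_le hB h0 s k).trans ?_
            have : (s * (p * q * B)) ^ 2 ≤ (p * q * B) ^ 2 := by
              rw [mul_pow]
              have : s ^ 2 ≤ 1 := by nlinarith [hs.1, hs.2]
              nlinarith [sq_nonneg ((p : ℝ) * q * B)]
            gcongr
        _ = _ := by simp [hE]
  -- The integrating factor: the derivative of `ψ` is the defect times an exponential at most `exp
  -- (σ2 / 2)`. Multiplication by `exp (-σ2 / 2)` at the end cancels this, so the bound does not
  -- involve `σ2`.
  set ψ : ℝ → ℂ := fun s => φ s * Complex.exp ((σ2 * s ^ 2 / 2 : ℝ) : ℂ) with hψ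
  have hψd : ∀ s, HasDerivAt ψ (((∫ Θ, Complex.I * ((S Θ : ℂ) *
      Complex.exp (Complex.I * (s * S Θ : ℝ))) ∂(unifPi ι)) + s * σ2 * φ s) *
      Complex.exp ((σ2 * s ^ 2 / 2 : ℝ) : ℂ)) s := fun s => by
    have h1 : HasDerivAt (fun s : ℝ => σ2 * s ^ 2 / 2) (σ2 * s) s := by
      refine (((hasDerivAt_pow 2 s).const_mul σ2).div_const 2).congr_deriv ?_
      simp
      ring
    refine ((hφd s).mul h1.ofReal_comp.cexp).congr_deriv ?_
    push_cast
    ring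
  have hψb : ∀ s ∈ Set.Icc (0 : ℝ) 1, ‖((∫ Θ, Complex.I * ((S Θ : ℂ) *
      Complex.exp (Complex.I * (s * S Θ : ℝ))) ∂(unifPi ι)) + s * σ2 * φ s) *
      Complex.exp ((σ2 * s ^ 2 / 2 : ℝ) : ℂ)‖ ≤ (√V + E) * Real.exp (σ2 / 2) := by
    intro s hs
    rw [norm_mul, ← Complex.ofReal_exp, Complex.norm_real, Real.norm_eq_abs, Real.abs_exp]
    have h1 := hbound s hs
    have h2 : Real.exp (σ2 * s ^ 2 / 2) ≤ Real.exp (σ2 / 2) := by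
      apply Real.exp_le_exp.2
      have : s ^ 2 ≤ 1 := by nlinarith [hs.1, hs.2]
      nlinarith
    exact mul_le_mul h1 h2 (Real.exp_pos _).le ((norm_nonneg _).trans h1)
  have hfin := (convex_Icc (0 : ℝ) 1).norm_image_sub_le_of_norm_hasDerivWithin_le
    (fun s _ => (hψd s).hasDerivWithinAt) hψb (Set.left_mem_Icc.2 zero_le_one)
    (Set.right_mem_Icc.2 zero_le_one)
  have hψ0 : ψ 0 = 1 := by simp [hψ, hφ]
  have hψ1 : ψ 1 = φ 1 * Real.exp (σ2 / 2) := by simp [hψ]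
  rw [hψ0, hψ1, sub_zero, norm_one, mul_one] at hfin
  have e5 : φ 1 - Complex.exp (-((σ2 : ℂ) / 2)) =
      (φ 1 * Real.exp (σ2 / 2) - 1) * Real.exp (-(σ2 / 2)) := by
    have : (Real.exp (σ2 / 2) : ℂ) * Real.exp (-(σ2 / 2)) = 1 := by
      rw [← Complex.ofReal_mul, ← Real.exp_add]; simp
    rw [sub_mul, mul_assoc, this]
    push_cast
    ring_nf
  have hφ1 : φ 1 = ∫ Θ, Complex.exp (Complex.I * (S Θ : ℝ)) ∂(unifPi ι) := by simp [hφ]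
  rw [← hφ1, e5, norm_mul, Complex.norm_real, Real.norm_eq_abs, Real.abs_exp]
  calc _ ≤ (√V + E) * Real.exp (σ2 / 2) * Real.exp (-(σ2 / 2)) := by gcongr
    _ = _ := by rw [mul_assoc, ← Real.exp_add]; simp

end LocalFamily

end QNN

end

open MeasureTheory ProbabilityTheory Filter Topology

noncomputable section

namespace QNN

/-! ### Tensor products of one- and two-qubit operators -/

section Operators

open Matrix
open scoped Kronecker

variable {m : ℕ}

/-- Operators on `m` qubits. -/
abbrev Op (m : ℕ) : Type := Matrix (Fin m → Fin 2) (Fin m → Fin 2) ℂ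

lemma tensorOp_apply (A : Fin m → Matrix (Fin 2) (Fin 2) ℂ) (s s' : Fin m → Fin 2) :
    tensorOp A s s' = ∏ k, A k (s k) (s' k) := rfl

lemma tensorOp_one : tensorOp (1 : Fin m → Matrix (Fin 2) (Fin 2) ℂ) = 1 := by
  ext s s'
  rw [tensorOp_apply, Matrix.one_apply]
  by_cases h : s = s'
  · subst h
    rw [if_pos rfl]
    exact Finset.prod_eq_one fun k _ => Matrix.one_apply_eq _
  · rw [if_neg h]
    obtain ⟨k, hk⟩ := Function.ne_iff.1 h
    exact Finset.prod_eq_zero (Finset.mem_univ k) (by simp [hk])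

lemma tensorOp_mul (A B : Fin m → Matrix (Fin 2) (Fin 2) ℂ) :
    tensorOp A * tensorOp B = tensorOp (A * B) := by
  ext s s'
  simp only [Matrix.mul_apply, tensorOp_apply, Pi.mul_apply, Finset.prod_univ_sum,
    Fintype.piFinset_univ, Finset.prod_mul_distrib]

lemma tensorOp_conjTranspose (A : Fin m → Matrix (Fin 2) (Fin 2) ℂ) :
    (tensorOp A)ᴴ = tensorOp fun k => (A k)ᴴ := by
  ext s s'
  simp [tensorOp_apply, Matrix.conjTranspose_apply]

lemma tensorOp_update_apply (A : Fin m → Matrix (Fin 2) (Fin 2) ℂ) (k : Fin m)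
    (B : Matrix (Fin 2) (Fin 2) ℂ) (s s' : Fin m → Fin 2) :
    tensorOp (Function.update A k B) s s' =
      B (s k) (s' k) * ∏ j ∈ Finset.univ.erase k, A j (s j) (s' j) := by
  rw [tensorOp_apply, ← Finset.mul_prod_erase _ _ (Finset.mem_univ k)]
  simp only [Function.update_self]
  congr 1
  refine Finset.prod_congr rfl fun j hj => ?_
  rw [Function.update_of_ne (Finset.ne_of_mem_erase hj)]

lemma tensorOp_update_add (A : Fin m → Matrix (Fin 2) (Fin 2) ℂ) (k : Fin m)
    (B B' : Matrix (Fin 2) (Fin 2) ℂ) :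
    tensorOp (Function.update A k (B + B')) =
      tensorOp (Function.update A k B) + tensorOp (Function.update A k B') := by
  ext s s'
  simp [tensorOp_update_apply, add_mul]

lemma tensorOp_update_smul (A : Fin m → Matrix (Fin 2) (Fin 2) ℂ) (k : Fin m) (c : ℂ)
    (B : Matrix (Fin 2) (Fin 2) ℂ) :
    tensorOp (Function.update A k (c • B)) = c • tensorOp (Function.update A k B) := by
  ext s s'
  simp [tensorOp_update_apply, mul_assoc]

lemma onQubit_eq (k : Fin m) (A : Matrix (Fin 2) (Fin 2) ℂ) :
    onQubit k A = tensorOp (Function.update 1 k A) := rfl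

lemma onQubit_mul (k : Fin m) (A B : Matrix (Fin 2) (Fin 2) ℂ) :
    onQubit k A * onQubit k B = onQubit k (A * B) := by
  simp only [onQubit_eq, tensorOp_mul]
  congr 1
  ext1 j
  by_cases h : j = k
  · subst h; simp
  · simp [h]

lemma onQubit_one (k : Fin m) : onQubit k (1 : Matrix (Fin 2) (Fin 2) ℂ) = 1 := by
  have h : Function.update (1 : Fin m → Matrix (Fin 2) (Fin 2) ℂ) k 1 = 1 :=
    Function.update_eq_self k _
  rw [onQubit_eq, h, tensorOp_one]

lemma onQubit_conjTranspose (k : Fin m) (A : Matrix (Fin 2) (Fin 2) ℂ) :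
    (onQubit k A)ᴴ = onQubit k Aᴴ := by
  rw [onQubit_eq, tensorOp_conjTranspose, onQubit_eq]
  congr 1
  ext1 j
  by_cases h : j = k
  · subst h; simp
  · simp [h]

lemma onQubit_add (k : Fin m) (A B : Matrix (Fin 2) (Fin 2) ℂ) :
    onQubit k (A + B) = onQubit k A + onQubit k B := tensorOp_update_add _ _ _ _

lemma onQubit_commute {k k' : Fin m} (h : k ≠ k') (A B : Matrix (Fin 2) (Fin 2) ℂ) :
    Commute (onQubit k A) (onQubit k' B) := by
  rw [Commute, SemiconjBy, onQubit_eq, onQubit_eq, tensorOp_mul, tensorOp_mul]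
  congr 1
  ext1 j
  by_cases h1 : j = k
  · subst h1; simp [h]
  · simp [h1]

/-- The tensor product of the one-qubit operators `A k` on the fixed points `k` of an involution
and of the two-qubit operators `B k` on its other orbits. -/
def pairOp (p : Fin m → Fin m) (A : Fin m → Matrix (Fin 2) (Fin 2) ℂ)
    (B : Fin m → Matrix (Fin 2 × Fin 2) (Fin 2 × Fin 2) ℂ) : Op m :=
  Matrix.of fun s s' =>
    (∏ k with p k = k, A k (s k) (s' k)) *
    (∏ k with k < p k, B k (s k, s (p k)) (s' k, s' (p k)))

lemma pairOp_apply (p : Fin m → Fin m) (A : Fin m → Matrix (Fin 2) (Fin 2) ℂ)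
    (B : Fin m → Matrix (Fin 2 × Fin 2) (Fin 2 × Fin 2) ℂ) (s s' : Fin m → Fin 2) :
    pairOp p A B s s' = (∏ k with p k = k, A k (s k) (s' k)) *
      (∏ k with k < p k, B k (s k, s (p k)) (s' k, s' (p k))) := rfl

/-- A bit string, as a family of one-bit strings at the fixed points of an involution, and of
two-bit strings at its other orbits. -/
def splitEquiv {p : Fin m → Fin m} (hp : Function.Involutive p) : (Fin m → Fin 2) ≃
    ({k // p k = k} → Fin 2) × ({k // k < p k} → Fin 2 × Fin 2) where
  toFun s := (fun k => s k, fun k => (s k, s (p k)))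
  -- Pairs are indexed by their smaller element, so the larger element of a pair reads the second
  -- bit stored at its partner.
  invFun u k := if h : p k = k then u.1 ⟨k, h⟩ else if h' : k < p k then (u.2 ⟨k, h'⟩).1 else
    (u.2 ⟨p k, by rw [hp k]; exact lt_of_le_of_ne (not_lt.1 h') h⟩).2
  left_inv s := by
    ext1 k
    by_cases h : p k = k
    · simp [h]
    · by_cases h' : k < p k
      · simp [h, h']
      · simp [h, h', hp k]
  right_inv u := by
    refine Prod.ext ?_ ?_
    · ext1 ⟨k, hk⟩
      simp [hk]
    · ext1 ⟨k, hk⟩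
      refine Prod.ext ?_ ?_
      · simp [hk, hk.ne']
      · simp [hk.ne, hp k, hk.not_gt]

/-- Through `splitEquiv` the sum over intermediate bit strings factors over the orbits of the
involution. -/
lemma pairOp_mul {p : Fin m → Fin m} (hp : Function.Involutive p)
    (A A' : Fin m → Matrix (Fin 2) (Fin 2) ℂ)
    (B B' : Fin m → Matrix (Fin 2 × Fin 2) (Fin 2 × Fin 2) ℂ) :
    pairOp p A B * pairOp p A' B' = pairOp p (A * A') (B * B') := by
  ext s s'
  have e1 : ∀ f : Fin m → ℂ, ∏ k with p k = k, f k = ∏ k : {k // p k = k}, f k := fun f =>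
    Finset.prod_subtype _ (by simp) f
  have e2 : ∀ f : Fin m → ℂ, ∏ k with k < p k, f k = ∏ k : {k // k < p k}, f k := fun f =>
    Finset.prod_subtype _ (by simp) f
  rw [Matrix.mul_apply, pairOp_apply, e1, e2]
  simp only [Pi.mul_apply, Matrix.mul_apply, pairOp_apply, e1, e2]
  rw [Finset.prod_univ_sum, Finset.prod_univ_sum, Fintype.piFinset_univ, Fintype.piFinset_univ,
    Finset.sum_mul_sum, ← Finset.sum_product', Finset.univ_product_univ]
  refine Fintype.sum_equiv (splitEquiv hp) _ _ fun r => ?_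
  simp only [splitEquiv, Equiv.coe_fn_mk, Finset.prod_mul_distrib]
  ring

/-- The factors at the larger elements of the pairs are reindexed by the smaller ones. Tensor
products of one-qubit operators can thus be multiplied orbit by orbit with pair operators. -/
lemma tensorOp_eq_pairOp {p : Fin m → Fin m} (hp : Function.Involutive p)
    (A : Fin m → Matrix (Fin 2) (Fin 2) ℂ) :
    tensorOp A = pairOp p A fun k => A k ⊗ₖ A (p k) := by
  ext s s'
  simp only [tensorOp_apply, pairOp_apply, Matrix.kroneckerMap_apply, Finset.prod_mul_distrib]
  set f : Fin m → ℂ := fun k => A k (s k) (s' k)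
  change ∏ k, f k = (∏ k with p k = k, f k) * ((∏ k with k < p k, f k) * ∏ k with k < p k, f (p k))
  have e : ∏ k with k < p k, f (p k) = ∏ k with p k < k, f k := by
    refine Finset.prod_nbij' p p ?_ ?_ ?_ ?_ ?_ <;> simp [hp _]
  rw [e, ← Finset.prod_filter_mul_prod_filter_not Finset.univ (fun k => p k = k),
    ← Finset.prod_filter_mul_prod_filter_not (Finset.univ.filter fun k => ¬ p k = k)
      (fun k => k < p k), Finset.filter_filter, Finset.filter_filter]
  congr 2
  · refine Finset.prod_congr (Finset.filter_congr fun k _ => ?_) fun _ _ => rfl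
    exact ⟨fun h => h.2, fun h => ⟨h.ne', h⟩⟩
  · refine Finset.prod_congr (Finset.filter_congr fun k _ => ?_) fun _ _ => rfl
    exact ⟨fun h => lt_of_le_of_ne (not_lt.1 h.2) h.1, fun h => ⟨h.ne, not_lt.2 h.le⟩⟩

lemma pairOp_one {p : Fin m → Fin m} (hp : Function.Involutive p) : pairOp p 1 1 = 1 := by
  rw [← tensorOp_one, tensorOp_eq_pairOp hp]
  congr 1
  ext1 k
  simp

lemma pairOp_conjTranspose (p : Fin m → Fin m) (A : Fin m → Matrix (Fin 2) (Fin 2) ℂ)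
    (B : Fin m → Matrix (Fin 2 × Fin 2) (Fin 2 × Fin 2) ℂ) :
    (pairOp p A B)ᴴ = pairOp p (fun k => (A k)ᴴ) fun k => (B k)ᴴ := by
  ext s s'
  simp [pairOp_apply, Matrix.conjTranspose_apply]

lemma pairOp_update_apply {p : Fin m → Fin m} {k : Fin m} (hk : k < p k)
    (A : Fin m → Matrix (Fin 2) (Fin 2) ℂ)
    (B : Fin m → Matrix (Fin 2 × Fin 2) (Fin 2 × Fin 2) ℂ)
    (D : Matrix (Fin 2 × Fin 2) (Fin 2 × Fin 2) ℂ) (s s' : Fin m → Fin 2) :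
    pairOp p A (Function.update B k D) s s' = D (s k, s (p k)) (s' k, s' (p k)) *
      ((∏ k with p k = k, A k (s k) (s' k)) *
      ∏ j ∈ (Finset.univ.filter fun k => k < p k).erase k,
        B j (s j, s (p j)) (s' j, s' (p j))) := by
  rw [pairOp_apply, ← Finset.mul_prod_erase (Finset.univ.filter fun k => k < p k) _
    (by simpa using hk)]
  simp only [Function.update_self]
  have : ∏ j ∈ (Finset.univ.filter fun k => k < p k).erase k,
      Function.update B k D j (s j, s (p j)) (s' j, s' (p j)) =
      ∏ j ∈ (Finset.univ.filter fun k => k < p k).erase k,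
      B j (s j, s (p j)) (s' j, s' (p j)) :=
    Finset.prod_congr rfl fun j hj => by
      rw [Function.update_of_ne (Finset.ne_of_mem_erase hj)]
  rw [this]
  ring

lemma pairOp_update_one_mul {p : Fin m → Fin m} (hp : Function.Involutive p) (k : Fin m)
    (D D' : Matrix (Fin 2 × Fin 2) (Fin 2 × Fin 2) ℂ) :
    pairOp p 1 (Function.update 1 k D) * pairOp p 1 (Function.update 1 k D')
      = pairOp p 1 (Function.update 1 k (D * D')) := by
  rw [pairOp_mul hp, mul_one]
  congr 1
  ext1 j
  by_cases h : j = k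
  · subst h; simp
  · simp [h]

/-- This lemma and the next two place a one-qubit operator in the factor of its orbit: at a fixed
point, at the smaller and at the larger element of a pair. -/
lemma onQubit_eq_pairOp_of_fixed {p : Fin m → Fin m} (hp : Function.Involutive p) {k : Fin m}
    (hk : p k = k) (C : Matrix (Fin 2) (Fin 2) ℂ) :
    onQubit k C = pairOp p (Function.update 1 k C) 1 := by
  rw [onQubit_eq, tensorOp_eq_pairOp hp]
  ext s s'
  rw [pairOp_apply, pairOp_apply]
  congr 1
  refine Finset.prod_congr rfl fun j hj => ?_
  have hj' : j < p j := by simpa using hj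
  have h1 : j ≠ k := by rintro rfl; exact hj'.ne' hk
  have h2 : p j ≠ k := by
    intro h; have := hp j; rw [h, hk] at this; exact h1 this.symm
  rw [Function.update_of_ne h1, Function.update_of_ne h2, Pi.one_apply, Pi.one_apply, Pi.one_apply,
    Matrix.one_kronecker_one]

lemma onQubit_eq_pairOp_of_lt {p : Fin m → Fin m} (hp : Function.Involutive p) {k : Fin m}
    (hk : k < p k) (C : Matrix (Fin 2) (Fin 2) ℂ) :
    onQubit k C = pairOp p 1 (Function.update 1 k (C ⊗ₖ 1)) := by
  rw [onQubit_eq, tensorOp_eq_pairOp hp]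
  ext s s'
  rw [pairOp_apply, pairOp_apply]
  congr 1
  · refine Finset.prod_congr rfl fun j hj => ?_
    have hj' : p j = j := by simpa using hj
    have h1 : j ≠ k := by rintro rfl; exact hk.ne' hj'
    simp [h1]
  · refine Finset.prod_congr rfl fun j hj => ?_
    have hj' : j < p j := by simpa using hj
    have h2 : p j ≠ k := by
      rintro rfl; rw [hp j] at hk; exact absurd hk (not_lt.2 hj'.le)
    by_cases h1 : j = k
    · subst h1; simp [h2]
    · rw [Function.update_of_ne h1, Function.update_of_ne h1, Function.update_of_ne h2,
        Pi.one_apply, Pi.one_apply, Pi.one_apply, Matrix.one_kronecker_one]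

lemma onQubit_partner_eq_pairOp {p : Fin m → Fin m} (hp : Function.Involutive p) {k : Fin m}
    (hk : k < p k) (C : Matrix (Fin 2) (Fin 2) ℂ) :
    onQubit (p k) C = pairOp p 1 (Function.update 1 k (1 ⊗ₖ C)) := by
  rw [onQubit_eq, tensorOp_eq_pairOp hp]
  ext s s'
  rw [pairOp_apply, pairOp_apply]
  congr 1
  · refine Finset.prod_congr rfl fun j hj => ?_
    have hj' : p j = j := by simpa using hj
    have h1 : j ≠ p k := by
      rintro rfl; rw [hp k] at hj'; exact hk.ne hj'
    simp [h1]
  · refine Finset.prod_congr rfl fun j hj => ?_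
    have hj' : j < p j := by simpa using hj
    have h2 : j ≠ p k := by
      rintro rfl; rw [hp k] at hj'; exact absurd hk (not_lt.2 hj'.le)
    by_cases h1 : j = k
    · subst h1; simp [h2]
    · have h3 : p j ≠ p k := fun h => h1 (hp.injective h)
      rw [Function.update_of_ne h1, Function.update_of_ne h2, Function.update_of_ne h3,
        Pi.one_apply, Pi.one_apply, Pi.one_apply, Matrix.one_kronecker_one]

/-- Every operator on the qubits `k` and `p k` commutes with an operator which commutes with all
one-qubit operators on `k` and on `p k`. -/
lemma commute_pairOp {p : Fin m → Fin m} (hp : Function.Involutive p) {k : Fin m}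
    (hk : k < p k) {A : Op m} (h1 : ∀ C, Commute A (onQubit k C))
    (h2 : ∀ C, Commute A (onQubit (p k) C)) (D : Matrix (Fin 2 × Fin 2) (Fin 2 × Fin 2) ℂ) :
    Commute A (pairOp p 1 (Function.update 1 k D)) := by
  induction D using Matrix.induction_on' with
  | h_zero =>
    have : pairOp p 1 (Function.update 1 k 0) = 0 := by
      ext s s'
      rw [pairOp_update_apply hk]
      simp
    rw [this]
    exact Commute.zero_right A
  | h_add D D' hD hD' =>
    have : pairOp p 1 (Function.update 1 k (D + D')) =
        pairOp p 1 (Function.update 1 k D) + pairOp p 1 (Function.update 1 k D') := by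
      ext s s'
      rw [Matrix.add_apply, pairOp_update_apply hk, pairOp_update_apply hk, pairOp_update_apply hk,
        Matrix.add_apply, add_mul]
    rw [this]
    exact hD.add_right hD'
  | h_std_basis i j x =>
    -- By linearity matrix units suffice, and a two-qubit matrix unit is a product of one-qubit
    -- operators on the two qubits.
    have : Matrix.single i j x =
        ((Matrix.single i.1 j.1 x ⊗ₖ (1 : Matrix (Fin 2) (Fin 2) ℂ)) *
        ((1 : Matrix (Fin 2) (Fin 2) ℂ) ⊗ₖ Matrix.single i.2 j.2 1)) := by
      rw [← Matrix.mul_kronecker_mul, mul_one, one_mul, Matrix.single_kronecker_single, mul_one]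
    rw [this, ← pairOp_update_one_mul hp, ← onQubit_eq_pairOp_of_lt hp hk,
      ← onQubit_partner_eq_pairOp hp hk]
    exact (h1 _).mul_right (h2 _)

/-- Conjugation of a one-qubit operator by a tensor product of one- and two-qubit unitaries. -/
lemma commute_pairOp_conj {p : Fin m → Fin m} (hp : Function.Involutive p)
    {A : Fin m → Matrix (Fin 2) (Fin 2) ℂ} {B : Fin m → Matrix (Fin 2 × Fin 2) (Fin 2 × Fin 2) ℂ}
    (hA : ∀ k, A k * (A k)ᴴ = 1) (hB : ∀ k, B k * (B k)ᴴ = 1) {k : Fin m} {M : Op m}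
    (h1 : ∀ C, Commute M (onQubit k C)) (h2 : ∀ C, Commute M (onQubit (p k) C))
    (C : Matrix (Fin 2) (Fin 2) ℂ) :
    Commute M (pairOp p A B * onQubit k C * (pairOp p A B)ᴴ) := by
  -- By unitarity the conjugation cancels in every factor except that of `k₀`.
  have key : ∀ (k₀ : Fin m) (D : Matrix (Fin 2 × Fin 2) (Fin 2 × Fin 2) ℂ),
      pairOp p A B * pairOp p 1 (Function.update 1 k₀ D) * (pairOp p A B)ᴴ =
        pairOp p 1 (Function.update 1 k₀ (B k₀ * D * (B k₀)ᴴ)) := fun k₀ D => by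
    rw [pairOp_conjTranspose, pairOp_mul hp, pairOp_mul hp]
    congr 1
    · ext1 j
      simp [hA]
    · ext1 j
      by_cases h : j = k₀
      · subst h; simp
      · simp [h, hB]
  rcases lt_trichotomy k (p k) with hk | hk | hk
  · rw [onQubit_eq_pairOp_of_lt hp hk, key]
    exact commute_pairOp hp hk h1 h2 _
  · have e : pairOp p A B * onQubit k C * (pairOp p A B)ᴴ = onQubit k (A k * C * (A k)ᴴ) := by
      rw [onQubit_eq_pairOp_of_fixed hp hk.symm, onQubit_eq_pairOp_of_fixed hp hk.symm,
        pairOp_conjTranspose, pairOp_mul hp, pairOp_mul hp]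
      congr 1
      · ext1 j
        by_cases h : j = k
        · subst h; simp
        · simp [h, hA]
      · ext1 j
        simp [hB]
    rw [e]
    exact h1 _
  · have hk' : p k < p (p k) := by rwa [hp k]
    have e := onQubit_partner_eq_pairOp hp hk' C
    rw [hp k] at e
    rw [e, key]
    exact commute_pairOp hp hk' h2 (by rwa [hp k]) _

/-- An operator which commutes with the one-qubit operators outside `S` commutes with the tensor
products of one-qubit operators which are trivial on `S`. -/
lemma commute_tensorOp {S : Finset (Fin m)} {M : Op m}
    (hM : ∀ k ∉ S, ∀ C, Commute M (onQubit k C)) {A : Fin m → Matrix (Fin 2) (Fin 2) ℂ}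
    (hA : ∀ k ∈ S, A k = 1) : Commute M (tensorOp A) := by
  have key : ∀ T : Finset (Fin m), Commute M (tensorOp fun k => if k ∈ T then A k else 1) := by
    intro T
    induction T using Finset.induction_on with
    | empty =>
      have : tensorOp (fun k => if k ∈ (∅ : Finset (Fin m)) then A k else 1) = 1 := by
        rw [← tensorOp_one]
        congr 1
      rw [this]
      exact Commute.one_right M
    | insert a T ha ih =>
      have : tensorOp (fun k => if k ∈ insert a T then A k else 1) =
          onQubit a (A a) * tensorOp fun k => if k ∈ T then A k else 1 := by
        rw [onQubit_eq, tensorOp_mul]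
        congr 1
        ext1 j
        by_cases h : j = a
        · subst h; simp [ha]
        · simp [h]
      rw [this]
      refine Commute.mul_right ?_ ih
      by_cases haS : a ∈ S
      · rw [hA a haS, onQubit_one]
        exact Commute.one_right M
      · exact hM a haS _
  simpa using key Finset.univ

end Operators

end QNN

end

/-! ### Gates and layers as unitary operators -/

open MeasureTheory ProbabilityTheory Filter Topology

noncomputable section

namespace QNN

open Matrix

/-- The exponential of a generator with spectrum `{-1, 1}`. -/
lemma exp_generator {G : Matrix (Fin 2) (Fin 2) ℂ} (hG : G.IsHermitian)
    (hs : spectrum ℝ G = {-1, 1}) (θ : ℝ) :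
    NormedSpace.exp ((-(Complex.I * (θ : ℂ))) • G) =
      (Real.cos θ : ℂ) • (1 : Matrix (Fin 2) (Fin 2) ℂ) - ((Real.sin θ : ℂ) * Complex.I) • G := by
  -- In an eigenbasis the claim is Euler's formula at the eigenvalues `-1` and `1`.
  set U : Matrix (Fin 2) (Fin 2) ℂ := hG.eigenvectorUnitary.1 with hU
  have hU1 : U * star U = 1 := Unitary.mul_star_self_of_mem hG.eigenvectorUnitary.2
  have hinv : U⁻¹ = star U := Matrix.inv_eq_right_inv hU1
  have hu : IsUnit U := IsUnit.of_mul_eq_one (star U) hU1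
  have hspec : G = U * diagonal (fun i => (hG.eigenvalues i : ℂ)) * U⁻¹ := by
    conv_lhs => rw [hG.spectral_theorem]
    rw [hinv]
    rfl
  have hsmul : ∀ (c : ℂ) (d : Fin 2 → ℂ), c • (U * diagonal d * U⁻¹) =
      U * diagonal (fun i => c * d i) * U⁻¹ := fun c d => by
    have : (diagonal fun i => c * d i) = c • diagonal d := by
      rw [← Matrix.diagonal_smul]; rfl
    rw [this, Matrix.mul_smul, Matrix.smul_mul]
  have e1 : (-(Complex.I * (θ : ℂ))) • G =
      U * diagonal (fun i => -(Complex.I * (θ : ℂ)) * (hG.eigenvalues i : ℂ)) * U⁻¹ := by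
    conv_lhs => rw [hspec]
    exact hsmul _ _
  have e2 : (Real.cos θ : ℂ) • (1 : Matrix (Fin 2) (Fin 2) ℂ) - ((Real.sin θ : ℂ) * Complex.I) • G
      = U * diagonal (fun i => (Real.cos θ : ℂ) - (Real.sin θ : ℂ) * Complex.I *
        (hG.eigenvalues i : ℂ)) * U⁻¹ := by
    have h1 : (1 : Matrix (Fin 2) (Fin 2) ℂ) = U * diagonal (fun _ => 1) * U⁻¹ := by
      rw [Matrix.diagonal_one, mul_one, hinv, hU1]
    conv_lhs => rw [hspec, h1]
    rw [hsmul, hsmul, ← Matrix.sub_mul, ← Matrix.mul_sub, Matrix.diagonal_sub]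
    congr 3
    ext i
    simp
  rw [e1, e2, Matrix.exp_conj _ _ hu, Matrix.exp_diagonal]
  congr 3
  ext i
  rw [Pi.coe_exp, ← Complex.exp_eq_exp_ℂ]
  have hi : hG.eigenvalues i = -1 ∨ hG.eigenvalues i = 1 := by
    have := hG.eigenvalues_mem_spectrum_real i
    rw [hs] at this
    simpa using this
  have hexp : ∀ x : ℝ, Complex.exp (x * Complex.I) = Real.cos x + Real.sin x * Complex.I :=
    fun x => by rw [Complex.exp_mul_I, Complex.ofReal_cos, Complex.ofReal_sin]
  rcases hi with hi | hi
  · rw [hi]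
    have : -(Complex.I * (θ : ℂ)) * ((-1 : ℝ) : ℂ) = (θ : ℝ) * Complex.I := by push_cast; ring
    rw [this, hexp]
    push_cast
    ring
  · rw [hi]
    have : -(Complex.I * (θ : ℂ)) * ((1 : ℝ) : ℂ) = ((-θ : ℝ) : ℂ) * Complex.I := by
      push_cast; ring
    rw [this, hexp, Real.cos_neg, Real.sin_neg]
    push_cast
    ring

namespace Circuit

variable {𝒳 : Type*} {m : ℕ} (C : Circuit 𝒳 m)

lemma paramGate_eq (Θ : C.Params) (ℓ : Fin C.depth) (k : Fin m) :
    C.paramGate Θ ℓ k = (Real.cos (Θ (ℓ, k)) : ℂ) • (1 : Matrix (Fin 2) (Fin 2) ℂ)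
      - ((Real.sin (Θ (ℓ, k)) : ℂ) * Complex.I) • C.generator ℓ k :=
  exp_generator (C.generator_isHermitian ℓ k) (C.generator_spectrum ℓ k) _

lemma paramGate_conjTranspose_mul (Θ : C.Params) (ℓ : Fin C.depth) (k : Fin m) :
    (C.paramGate Θ ℓ k)ᴴ * C.paramGate Θ ℓ k = 1 := by
  rw [paramGate, ← Matrix.exp_conjTranspose, ← Matrix.exp_add_of_commute]
  · have : ((-(Complex.I * (Θ (ℓ, k) : ℂ))) • C.generator ℓ k)ᴴ =
        -((-(Complex.I * (Θ (ℓ, k) : ℂ))) • C.generator ℓ k) := by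
      rw [Matrix.conjTranspose_smul, (C.generator_isHermitian ℓ k).eq, ← neg_smul]
      simp
    rw [this]
    simp
  · rw [Matrix.conjTranspose_smul, (C.generator_isHermitian ℓ k).eq]
    exact ((Commute.refl _).smul_left _).smul_right _

lemma paramGate_mul_conjTranspose (Θ : C.Params) (ℓ : Fin C.depth) (k : Fin m) :
    C.paramGate Θ ℓ k * (C.paramGate Θ ℓ k)ᴴ = 1 :=
  mul_eq_one_comm.1 (C.paramGate_conjTranspose_mul Θ ℓ k)

/-- The tensor product of the parameterized gates of a layer. -/
def rotation (Θ : C.Params) (ℓ : Fin C.depth) : Op m := tensorOp (C.paramGate Θ ℓ)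

lemma rotation_mul_conjTranspose (Θ : C.Params) (ℓ : Fin C.depth) :
    C.rotation Θ ℓ * (C.rotation Θ ℓ)ᴴ = 1 := by
  rw [rotation, tensorOp_conjTranspose, tensorOp_mul, ← tensorOp_one]
  congr 1
  ext1 k
  exact C.paramGate_mul_conjTranspose Θ ℓ k

lemma rotation_conjTranspose_mul (Θ : C.Params) (ℓ : Fin C.depth) :
    (C.rotation Θ ℓ)ᴴ * C.rotation Θ ℓ = 1 := mul_eq_one_comm.1 (C.rotation_mul_conjTranspose Θ ℓ)

lemma gate₁_mul (ℓ : Fin C.depth) (k : Fin m) (x : 𝒳) :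
    (C.gate₁ ℓ k x : Matrix (Fin 2) (Fin 2) ℂ) * (C.gate₁ ℓ k x : Matrix (Fin 2) (Fin 2) ℂ)ᴴ = 1 :=
  Unitary.mul_star_self_of_mem (C.gate₁ ℓ k x).2

lemma gate₂_mul (ℓ : Fin C.depth) (k : Fin m) (x : 𝒳) :
    (C.gate₂ ℓ k x : Matrix (Fin 2 × Fin 2) (Fin 2 × Fin 2) ℂ) *
      (C.gate₂ ℓ k x : Matrix (Fin 2 × Fin 2) (Fin 2 × Fin 2) ℂ)ᴴ = 1 :=
  Unitary.mul_star_self_of_mem (C.gate₂ ℓ k x).2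

lemma encoding_eq (x : 𝒳) (ℓ : Fin C.depth) : C.encoding x ℓ = pairOp (C.partner ℓ)
    (fun k => (C.gate₁ ℓ k x : Matrix (Fin 2) (Fin 2) ℂ))
    (fun k => (C.gate₂ ℓ k x : Matrix (Fin 2 × Fin 2) (Fin 2 × Fin 2) ℂ)) := rfl

lemma encoding_mul_conjTranspose (x : 𝒳) (ℓ : Fin C.depth) :
    C.encoding x ℓ * (C.encoding x ℓ)ᴴ = 1 := by
  rw [encoding_eq, pairOp_conjTranspose, pairOp_mul (C.partner_involutive ℓ),
    ← pairOp_one (C.partner_involutive ℓ)]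
  congr 1
  · ext1 k
    exact C.gate₁_mul ℓ k x
  · ext1 k
    exact C.gate₂_mul ℓ k x

lemma encoding_conjTranspose_mul (x : 𝒳) (ℓ : Fin C.depth) :
    (C.encoding x ℓ)ᴴ * C.encoding x ℓ = 1 := mul_eq_one_comm.1 (C.encoding_mul_conjTranspose x ℓ)

lemma layer_conjTranspose_mul (Θ : C.Params) (x : 𝒳) (ℓ : Fin C.depth) :
    (C.layer Θ x ℓ)ᴴ * C.layer Θ x ℓ = 1 := by
  change (C.encoding x ℓ * C.rotation Θ ℓ)ᴴ * (C.encoding x ℓ * C.rotation Θ ℓ) = 1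
  rw [Matrix.conjTranspose_mul, Matrix.mul_assoc, ← Matrix.mul_assoc (C.encoding x ℓ)ᴴ,
    encoding_conjTranspose_mul, one_mul, rotation_conjTranspose_mul]

lemma unitary_conjTranspose_mul (Θ : C.Params) (x : 𝒳) :
    (C.unitary Θ x)ᴴ * C.unitary Θ x = 1 := by
  rw [unitary]
  generalize List.finRange C.depth = l
  induction l with
  | nil => simp
  | cons ℓ l ih =>
    rw [List.map_cons, List.reverse_cons, List.prod_append, List.prod_singleton,
      Matrix.conjTranspose_mul, Matrix.mul_assoc, ← Matrix.mul_assoc _ _ (C.layer Θ x ℓ), ih,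
      one_mul, layer_conjTranspose_mul]

/-! ### Light cones -/

/-- The product of the layers from the layer `ℓ` on. -/
def tailProd (Θ : C.Params) (x : 𝒳) (ℓ : ℕ) : Op m :=
  ((((List.finRange C.depth).drop ℓ).map (C.layer Θ x)).reverse).prod

lemma tailProd_depth (Θ : C.Params) (x : 𝒳) : C.tailProd Θ x C.depth = 1 := by
  rw [tailProd, List.drop_eq_nil_of_le (by simp)]
  rfl

lemma tailProd_eq (Θ : C.Params) (x : 𝒳) {ℓ : ℕ} (h : ℓ < C.depth) :
    C.tailProd Θ x ℓ = C.tailProd Θ x (ℓ + 1) * C.layer Θ x ⟨ℓ, h⟩ := by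
  rw [tailProd, List.drop_eq_getElem_cons (by simpa using h), List.map_cons, List.reverse_cons,
    List.prod_append, List.prod_singleton, tailProd]
  simp

/-- The observable of the qubit `k` evolved through the layers from the layer `ℓ` on. -/
def heisenberg (k : Fin m) (Θ : C.Params) (x : 𝒳) (ℓ : ℕ) : Op m :=
  (C.tailProd Θ x ℓ)ᴴ * onQubit k (C.obs k) * C.tailProd Θ x ℓ

lemma heisenberg_eq (k : Fin m) (Θ : C.Params) (x : 𝒳) {ℓ : ℕ} (h : ℓ < C.depth) :
    C.heisenberg k Θ x ℓ = (C.rotation Θ ⟨ℓ, h⟩)ᴴ * ((C.encoding x ⟨ℓ, h⟩)ᴴ *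
      C.heisenberg k Θ x (ℓ + 1) * C.encoding x ⟨ℓ, h⟩) * C.rotation Θ ⟨ℓ, h⟩ := by
  rw [heisenberg, tailProd_eq _ _ _ h, heisenberg]
  change (C.tailProd Θ x (ℓ + 1) * (C.encoding x ⟨ℓ, h⟩ * C.rotation Θ ⟨ℓ, h⟩))ᴴ * _ * _ = _
  simp only [Matrix.conjTranspose_mul, Matrix.mul_assoc]
  rfl

/-- Conjugation by a unitary is moved from one operator of a commuting pair to the other. -/
lemma commute_conj {M V Q : Op m} (hV : V * Vᴴ = 1) (h : Commute M (V * Q * Vᴴ)) :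
    Commute (Vᴴ * M * V) Q := by
  have hV' : Vᴴ * V = 1 := mul_eq_one_comm.1 hV
  have h1 : M * (V * Q * Vᴴ) = V * Q * Vᴴ * M := h
  have h2 : Vᴴ * (M * (V * Q * Vᴴ)) * V = Vᴴ * (V * Q * Vᴴ * M) * V := by rw [h1]
  have e1 : Vᴴ * (M * (V * Q * Vᴴ)) * V = Vᴴ * M * V * Q * (Vᴴ * V) := by
    simp only [Matrix.mul_assoc]
  have e2 : Vᴴ * (V * Q * Vᴴ * M) * V = (Vᴴ * V) * Q * (Vᴴ * M * V) := by
    simp only [Matrix.mul_assoc]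
  rw [e1, e2, hV', mul_one, one_mul] at h2
  exact h2

lemma backwardCone_depth (k : Fin m) : C.backwardCone k C.depth = {k} := by
  rw [backwardCone]
  simp

lemma backwardCone_eq (k : Fin m) {ℓ : ℕ} (h : ℓ < C.depth) :
    C.backwardCone k ℓ = (C.backwardCone k (ℓ + 1)).biUnion (C.interaction ⟨ℓ, h⟩) := by
  rw [backwardCone]
  simp [h]

/-- Support in `S` is expressed as commuting with all one-qubit operators outside `S`. A qubit
outside `S'` lies outside `S` together with its partner, the latter because `partner` is an
involution; its one-qubit operators, conjugated by the encoding, stay on these two qubits. -/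
lemma commute_encoding_conj (x : 𝒳) (ℓ : Fin C.depth) {S S' : Finset (Fin m)} {M : Op m}
    (hM : ∀ k ∉ S, ∀ A, Commute M (onQubit k A))
    (hS : S' = S.biUnion (C.interaction ℓ)) {k : Fin m} (hk : k ∉ S') (A) :
    Commute ((C.encoding x ℓ)ᴴ * M * C.encoding x ℓ) (onQubit k A) := by
  refine commute_conj (C.encoding_mul_conjTranspose x ℓ) ?_
  have h1 : k ∉ S := fun h => hk (by
    rw [hS]
    exact Finset.mem_biUnion.2 ⟨k, h, by simp [interaction]⟩)
  have h2 : C.partner ℓ k ∉ S := fun h => hk (by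
    rw [hS]
    exact Finset.mem_biUnion.2 ⟨_, h, by simp [interaction, C.partner_involutive ℓ k]⟩)
  exact commute_pairOp_conj (C.partner_involutive ℓ) (fun k => C.gate₁_mul ℓ k x)
    (fun k => C.gate₂_mul ℓ k x) (hM k h1) (hM _ h2) A

/-- Single-qubit rotations do not enlarge supports. -/
lemma rotation_mul_onQubit (Θ : C.Params) (ℓ : Fin C.depth) (k : Fin m)
    (A : Matrix (Fin 2) (Fin 2) ℂ) :
    C.rotation Θ ℓ * onQubit k A * (C.rotation Θ ℓ)ᴴ =
      onQubit k (C.paramGate Θ ℓ k * A * (C.paramGate Θ ℓ k)ᴴ) := by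
  rw [rotation, onQubit_eq, tensorOp_conjTranspose, tensorOp_mul, tensorOp_mul, onQubit_eq]
  congr 1
  ext1 j
  by_cases h : j = k
  · subst h; simp
  · simp [h, C.paramGate_mul_conjTranspose]

/-- Backward induction over the layers, starting from the bare observable: each encoding widens the
support by one interaction, and the rotations leave it unchanged. -/
lemma commute_heisenberg (k : Fin m) (Θ : C.Params) (x : 𝒳) {ℓ : ℕ} (h : ℓ ≤ C.depth) :
    ∀ k' ∉ C.backwardCone k ℓ, ∀ A, Commute (C.heisenberg k Θ x ℓ) (onQubit k' A) := by
  induction h using Nat.decreasingInduction with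
  | self =>
    intro k' hk' A
    rw [backwardCone_depth] at hk'
    rw [heisenberg, tailProd_depth, Matrix.conjTranspose_one, one_mul, mul_one]
    exact onQubit_commute (fun h => hk' (by simp [h])) _ _
  | of_succ ℓ hℓ ih =>
    intro k' hk' A
    rw [C.heisenberg_eq k Θ x hℓ]
    refine commute_conj (C.rotation_mul_conjTranspose Θ _) ?_
    rw [rotation_mul_onQubit]
    exact C.commute_encoding_conj x ⟨ℓ, hℓ⟩ ih (C.backwardCone_eq k hℓ) hk' _

/-- The evolved observable depends only on the parameters in the past light cone. -/
lemma heisenberg_congr (k : Fin m) {Θ Θ' : C.Params} (hΘ : ∀ i ∈ C.pastCone k, Θ i = Θ' i) (x : 𝒳)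
    {ℓ : ℕ} (h : ℓ ≤ C.depth) : C.heisenberg k Θ x ℓ = C.heisenberg k Θ' x ℓ := by
  induction h using Nat.decreasingInduction with
  | self => simp only [heisenberg, tailProd_depth]
  | of_succ ℓ hℓ ih =>
    rw [C.heisenberg_eq k Θ x hℓ, C.heisenberg_eq k Θ' x hℓ, ih]
    set M := (C.encoding x ⟨ℓ, hℓ⟩)ᴴ * C.heisenberg k Θ' x (ℓ + 1) * C.encoding x ⟨ℓ, hℓ⟩ with hM
    -- `R` is the discrepancy between the rotations for `Θ` and `Θ'`. It is trivial on the cone at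
    -- this layer, where the parameters agree, so it commutes with `M` and drops out of the
    -- conjugation.
    set R := fun j => C.paramGate Θ ⟨ℓ, hℓ⟩ j * (C.paramGate Θ' ⟨ℓ, hℓ⟩ j)ᴴ with hR
    have hR1 : C.rotation Θ ⟨ℓ, hℓ⟩ = tensorOp R * C.rotation Θ' ⟨ℓ, hℓ⟩ := by
      rw [rotation, rotation, tensorOp_mul]
      congr 1
      ext1 j
      rw [Pi.mul_apply, hR, Matrix.mul_assoc, paramGate_conjTranspose_mul, mul_one]
    have hR2 : (tensorOp R)ᴴ * tensorOp R = 1 := by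
      rw [tensorOp_conjTranspose, tensorOp_mul, ← tensorOp_one]
      congr 1
      ext1 j
      simp only [Pi.mul_apply, hR, Matrix.conjTranspose_mul, Matrix.conjTranspose_conjTranspose]
      rw [Matrix.mul_assoc, ← Matrix.mul_assoc _ (C.paramGate Θ ⟨ℓ, hℓ⟩ j),
        paramGate_conjTranspose_mul, one_mul, paramGate_mul_conjTranspose]
      rfl
    have hc : Commute M (tensorOp R) := by
      refine commute_tensorOp (S := C.backwardCone k ℓ) (fun k' hk' A => ?_) (fun j hj => ?_)
      · exact C.commute_encoding_conj x ⟨ℓ, hℓ⟩ (C.commute_heisenberg k Θ' x hℓ)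
          (C.backwardCone_eq k hℓ) hk' A
      · have : Θ (⟨ℓ, hℓ⟩, j) = Θ' (⟨ℓ, hℓ⟩, j) := hΘ _ (by simpa [pastCone] using hj)
        have h2 : C.paramGate Θ ⟨ℓ, hℓ⟩ j = C.paramGate Θ' ⟨ℓ, hℓ⟩ j := by
          rw [paramGate, paramGate, this]
        rw [hR]
        simp only
        rw [h2, paramGate_mul_conjTranspose]
    have hc' : M * tensorOp R = tensorOp R * M := hc
    rw [hR1, Matrix.conjTranspose_mul]
    calc (C.rotation Θ' ⟨ℓ, hℓ⟩)ᴴ * (tensorOp R)ᴴ * M * (tensorOp R * C.rotation Θ' ⟨ℓ, hℓ⟩)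
        = (C.rotation Θ' ⟨ℓ, hℓ⟩)ᴴ * ((tensorOp R)ᴴ * (M * tensorOp R)) *
          C.rotation Θ' ⟨ℓ, hℓ⟩ := by simp only [Matrix.mul_assoc]
      _ = _ := by rw [hc', ← Matrix.mul_assoc (tensorOp R)ᴴ, hR2, one_mul]

lemma localModel_eq (k : Fin m) (Θ : C.Params) (x : 𝒳) :
    C.localModel k Θ x = (C.heisenberg k Θ x 0 (fun _ => 0) (fun _ => 0)).re := rfl

lemma dependsOnlyOn_localModel (k : Fin m) (x : 𝒳) :
    DependsOnlyOn (fun Θ => C.localModel k Θ x) (C.pastCone k) := by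
  intro Θ Θ' h
  simp only [localModel_eq]
  rw [C.heisenberg_congr k h x (Nat.zero_le _)]

end Circuit

end QNN

end

open MeasureTheory ProbabilityTheory Filter Topology

noncomputable section

namespace QNN

open Matrix

namespace Circuit

variable {𝒳 : Type*} {m : ℕ} (C : Circuit 𝒳 m)

/-! ### Differentiability -/

/-- A matrix-valued function all of whose entries are differentiable. -/
def EntryDiff {E n : Type*} [NormedAddCommGroup E] [NormedSpace ℝ E] (A : E → Matrix n n ℂ) :
    Prop := ∀ s s', Differentiable ℝ fun Θ => A Θ s s'

lemma EntryDiff.mul {E n : Type*} [NormedAddCommGroup E] [NormedSpace ℝ E] [Fintype n]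
    {A B : E → Matrix n n ℂ} (hA : EntryDiff A) (hB : EntryDiff B) :
    EntryDiff fun Θ => A Θ * B Θ := fun s s' => by
  simp only [Matrix.mul_apply]
  exact Differentiable.fun_sum fun i _ => (hA s i).mul (hB i s')

lemma EntryDiff.conjTranspose {E n : Type*} [NormedAddCommGroup E] [NormedSpace ℝ E]
    {A : E → Matrix n n ℂ} (hA : EntryDiff A) : EntryDiff fun Θ => (A Θ)ᴴ := fun s s' => by
  simp only [Matrix.conjTranspose_apply]
  exact (hA s' s).star

lemma EntryDiff.const {E n : Type*} [NormedAddCommGroup E] [NormedSpace ℝ E] (A : Matrix n n ℂ) :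
    EntryDiff fun _ : E => A := fun _ _ => differentiable_const _

lemma entryDiff_layer (x : 𝒳) (ℓ : Fin C.depth) : EntryDiff fun Θ => C.layer Θ x ℓ := by
  refine (EntryDiff.const (E := C.Params) (C.encoding x ℓ)).mul
    (B := fun Θ : C.Params => tensorOp (C.paramGate Θ ℓ)) fun s s' => ?_
  simp only [tensorOp_apply, paramGate_eq, Matrix.sub_apply, Matrix.smul_apply, smul_eq_mul]
  have h1 : ∀ k, Differentiable ℝ fun Θ : C.Params => (Real.cos (Θ (ℓ, k)) : ℂ) := fun k =>
    Complex.ofRealCLM.differentiable.comp (Real.differentiable_cos.comp (by fun_prop))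
  have h2 : ∀ k, Differentiable ℝ fun Θ : C.Params => (Real.sin (Θ (ℓ, k)) : ℂ) := fun k =>
    Complex.ofRealCLM.differentiable.comp (Real.differentiable_sin.comp (by fun_prop))
  generalize (Finset.univ : Finset (Fin m)) = S
  induction S using Finset.cons_induction with
  | empty => simp
  | cons k S hk ih =>
    simp only [Finset.prod_cons]
    exact (((h1 k).mul_const _).sub (((h2 k).mul_const _).mul_const _)).mul ih

lemma entryDiff_unitary (x : 𝒳) : EntryDiff fun Θ => C.unitary Θ x := by
  simp only [unitary]
  generalize List.finRange C.depth = l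
  induction l with
  | nil => exact EntryDiff.const _
  | cons ℓ l ih =>
    simp only [List.map_cons, List.reverse_cons, List.prod_append, List.prod_singleton]
    exact ih.mul (C.entryDiff_layer x ℓ)

lemma differentiable_localModel (k : Fin m) (x : 𝒳) :
    Differentiable ℝ fun Θ => C.localModel k Θ x :=
  Complex.reCLM.differentiable.comp
    ((((C.entryDiff_unitary x).conjTranspose.mul (EntryDiff.const _)).mul
      (C.entryDiff_unitary x)) _ _)

/-! ### The parameter-shift rule -/

/-- The gate is linear in the cosine and the sine of its parameter, so the addition theorems express
any shift through the shifts by `0` and `π / 2`. -/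
lemma paramGate_add_single (Θ : C.Params) (i : Fin C.depth × Fin m) (t : ℝ) :
    C.paramGate (Θ + Pi.single i t) i.1 i.2 = (Real.cos t : ℂ) • C.paramGate Θ i.1 i.2 +
      (Real.sin t : ℂ) • C.paramGate (Θ + Pi.single i (Real.pi / 2)) i.1 i.2 := by
  simp only [paramGate_eq, Pi.add_apply, Prod.mk.eta, Pi.single_eq_same, Real.cos_add, Real.sin_add,
    Real.cos_pi_div_two, Real.sin_pi_div_two, Complex.ofReal_add, Complex.ofReal_sub,
    Complex.ofReal_mul, Complex.ofReal_zero, Complex.ofReal_one]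
  module

lemma paramGate_add_single_of_ne (Θ : C.Params) {i : Fin C.depth × Fin m} (t : ℝ)
    {ℓ : Fin C.depth} {k : Fin m} (h : (ℓ, k) ≠ i) :
    C.paramGate (Θ + Pi.single i t) ℓ k = C.paramGate Θ ℓ k := by
  simp [paramGate, h]

lemma layer_add_single_of_ne (Θ : C.Params) {i : Fin C.depth × Fin m} (t : ℝ) (x : 𝒳)
    {ℓ : Fin C.depth} (h : ℓ ≠ i.1) :
    C.layer (Θ + Pi.single i t) x ℓ = C.layer Θ x ℓ := by
  rw [layer, layer]
  congr 2
  ext1 k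
  exact C.paramGate_add_single_of_ne Θ t fun h' => h (by rw [← h'])

lemma layer_add_single (Θ : C.Params) (i : Fin C.depth × Fin m) (t : ℝ) (x : 𝒳) :
    C.layer (Θ + Pi.single i t) x i.1 = (Real.cos t : ℂ) • C.layer Θ x i.1 +
      (Real.sin t : ℂ) • C.layer (Θ + Pi.single i (Real.pi / 2)) x i.1 := by
  have hu : ∀ t, C.paramGate (Θ + Pi.single i t) i.1 = Function.update (C.paramGate Θ i.1) i.2
      (C.paramGate (Θ + Pi.single i t) i.1 i.2) := fun t => by
    ext1 k
    by_cases h : k = i.2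
    · subst h; simp
    · rw [Function.update_of_ne h, C.paramGate_add_single_of_ne Θ t fun h' => h (by rw [← h'])]
  have hu0 : C.paramGate Θ i.1 = Function.update (C.paramGate Θ i.1) i.2
      (C.paramGate Θ i.1 i.2) := (Function.update_eq_self _ _).symm
  have key : tensorOp (C.paramGate (Θ + Pi.single i t) i.1) =
      (Real.cos t : ℂ) • tensorOp (C.paramGate Θ i.1) +
      (Real.sin t : ℂ) • tensorOp (C.paramGate (Θ + Pi.single i (Real.pi / 2)) i.1) := by
    rw [hu t, paramGate_add_single, tensorOp_update_add, tensorOp_update_smul,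
      tensorOp_update_smul, ← hu0, ← hu]
  rw [layer, key, Matrix.mul_add, Matrix.mul_smul, Matrix.mul_smul]
  rfl

/-- The parameter occurs in a single tensor factor of a single layer, and the circuit is linear in
that factor. -/
lemma unitary_add_single (Θ : C.Params) (i : Fin C.depth × Fin m) (t : ℝ) (x : 𝒳) :
    C.unitary (Θ + Pi.single i t) x = (Real.cos t : ℂ) • C.unitary Θ x +
      (Real.sin t : ℂ) • C.unitary (Θ + Pi.single i (Real.pi / 2)) x := by
  have hmap : ∀ (t : ℝ) (l : List (Fin C.depth)), i.1 ∉ l →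
      l.map (C.layer (Θ + Pi.single i t) x) = l.map (C.layer Θ x) := fun t l hl =>
    List.map_congr_left fun ℓ hℓ => C.layer_add_single_of_ne Θ t x fun h => hl (h ▸ hℓ)
  obtain ⟨l₁, l₂, hl⟩ := List.append_of_mem (List.mem_finRange i.1)
  have hnd := List.nodup_finRange C.depth
  rw [hl, List.nodup_append, List.nodup_cons] at hnd
  have h1 : i.1 ∉ l₁ := fun h => hnd.2.2 _ h _ (by simp) rfl
  have h2 : i.1 ∉ l₂ := hnd.2.1.1
  simp only [unitary, hl, List.map_append, List.map_cons, List.reverse_append, List.reverse_cons,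
    List.prod_append, List.prod_singleton]
  rw [hmap t l₁ h1, hmap t l₂ h2, hmap _ l₁ h1, hmap _ l₂ h2, C.layer_add_single]
  simp only [Matrix.mul_add, Matrix.add_mul, Matrix.mul_smul, Matrix.smul_mul]

/-- As a function of a single parameter, a local output is a trigonometric polynomial. -/
lemma localModel_add_single (k : Fin m) (Θ : C.Params) (i : Fin C.depth × Fin m) (x : 𝒳) :
    ∃ a b c : ℝ, ∀ t : ℝ, C.localModel k (Θ + Pi.single i t) x =
      Real.cos t ^ 2 * a + Real.cos t * Real.sin t * b + Real.sin t ^ 2 * c := by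
  set U₀ := C.unitary Θ x
  set U₁ := C.unitary (Θ + Pi.single i (Real.pi / 2)) x
  set O := onQubit k (C.obs k)
  refine ⟨((U₀ᴴ * O * U₀) (fun _ => 0) (fun _ => 0)).re,
    ((U₀ᴴ * O * U₁) (fun _ => 0) (fun _ => 0)).re + ((U₁ᴴ * O * U₀) (fun _ => 0) (fun _ => 0)).re,
    ((U₁ᴴ * O * U₁) (fun _ => 0) (fun _ => 0)).re, fun t => ?_⟩
  rw [localModel, C.unitary_add_single]
  change ((((Real.cos t : ℂ) • U₀ + (Real.sin t : ℂ) • U₁)ᴴ * O *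
    ((Real.cos t : ℂ) • U₀ + (Real.sin t : ℂ) • U₁)) _ _).re = _
  have hc : ∀ r : ℝ, star (r : ℂ) = r := fun r => Complex.conj_ofReal r
  simp only [Matrix.conjTranspose_add, Matrix.conjTranspose_smul, hc, Matrix.mul_add,
    Matrix.add_mul, Matrix.mul_smul, Matrix.smul_mul, Matrix.add_apply, Matrix.smul_apply,
    smul_eq_mul, Complex.add_re, Complex.re_ofReal_mul]
  ring

/-- For `a cos² + b cos sin + c sin²` the derivative at zero is `b`. In the difference of the values
at `±π / 4` the even terms cancel and `2 cos sin = 1`. -/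
lemma shiftRule_localModel (k : Fin m) (x : 𝒳) : ShiftRule fun Θ => C.localModel k Θ x where
  differentiable := C.differentiable_localModel k x
  partialDeriv_eq i Θ := by
    obtain ⟨a, b, c, h⟩ := C.localModel_add_single k Θ i x
    have h1 : HasDerivAt (fun t : ℝ => C.localModel k (Θ + t • Pi.single i (1 : ℝ)) x)
        (partialDeriv (fun Θ => C.localModel k Θ x) i Θ) 0 := by
      have := hasDerivAt_line (C.differentiable_localModel k x) Θ (Pi.single i (1 : ℝ)) 0
      rw [Finset.sum_eq_single i (fun j _ hj => by simp [hj]) (by simp)] at this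
      simpa using this
    have h2 : HasDerivAt (fun t : ℝ => Real.cos t ^ 2 * a + Real.cos t * Real.sin t * b +
        Real.sin t ^ 2 * c) b 0 := by
      have hc := Real.hasDerivAt_cos 0
      have hs := Real.hasDerivAt_sin 0
      refine ((((hc.pow 2).mul_const a).add ((hc.mul hs).mul_const b)).add
        ((hs.pow 2).mul_const c)).congr_deriv ?_
      simp
    have h3 : (fun t : ℝ => C.localModel k (Θ + t • Pi.single i (1 : ℝ)) x) =
        fun t : ℝ => Real.cos t ^ 2 * a + Real.cos t * Real.sin t * b + Real.sin t ^ 2 * c := by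
      ext t
      rw [← h t, ← Pi.single_smul, smul_eq_mul, mul_one]
    rw [h3] at h1
    rw [h1.unique h2, h, sub_eq_add_neg Θ, ← Pi.single_neg, h, Real.cos_neg, Real.sin_neg,
      Real.cos_pi_div_four, Real.sin_pi_div_four]
    have h4 : √2 ^ 2 = (2 : ℝ) := Real.sq_sqrt (by norm_num)
    linear_combination (-(b : ℝ) / 2) * h4

/-! ### Boundedness -/

lemma exists_conjTranspose_mul_self {A : Matrix (Fin 2) (Fin 2) ℂ} (hA : A.IsHermitian) {d : ℝ}
    (hd : ∀ i, 0 ≤ 1 + d * hA.eigenvalues i) :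
    ∃ B : Matrix (Fin 2) (Fin 2) ℂ, 1 + (d : ℂ) • A = Bᴴ * B := by
  set U : Matrix (Fin 2) (Fin 2) ℂ := hA.eigenvectorUnitary.1 with hU
  have hU1 : U * Uᴴ = 1 := Unitary.mul_star_self_of_mem hA.eigenvectorUnitary.2
  have hspec : A = U * diagonal (fun i => (hA.eigenvalues i : ℂ)) * Uᴴ := by
    conv_lhs => rw [hA.spectral_theorem]
    rfl
  refine ⟨diagonal (fun i => (√(1 + d * hA.eigenvalues i) : ℂ)) * Uᴴ, ?_⟩
  have h1 : (diagonal (fun i => (√(1 + d * hA.eigenvalues i) : ℂ)))ᴴ *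
      diagonal (fun i => (√(1 + d * hA.eigenvalues i) : ℂ)) =
      1 + (d : ℂ) • diagonal (fun i => (hA.eigenvalues i : ℂ)) := by
    rw [Matrix.diagonal_conjTranspose, Matrix.diagonal_mul_diagonal, ← Matrix.diagonal_one,
      ← Matrix.diagonal_smul, Matrix.diagonal_add]
    congr 1
    ext i
    have : ((√(1 + d * hA.eigenvalues i) * √(1 + d * hA.eigenvalues i) : ℝ) : ℂ) =
        ((1 + d * hA.eigenvalues i : ℝ) : ℂ) := by rw [Real.mul_self_sqrt (hd i)]
    push_cast at this
    simpa using this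
  rw [Matrix.conjTranspose_mul, Matrix.conjTranspose_conjTranspose, Matrix.mul_assoc,
    ← Matrix.mul_assoc _ _ Uᴴ, h1, Matrix.add_mul, one_mul, Matrix.mul_add, hU1, Matrix.smul_mul,
    Matrix.mul_smul, ← Matrix.mul_assoc]
  conv_lhs => rw [hspec]

lemma re_conj_onQubit_nonneg (B : Matrix (Fin 2) (Fin 2) ℂ) (k : Fin m) (U : Op m)
    (s : Fin m → Fin 2) : 0 ≤ ((Uᴴ * onQubit k (Bᴴ * B) * U) s s).re := by
  have h : Uᴴ * onQubit k (Bᴴ * B) * U = (onQubit k B * U)ᴴ * (onQubit k B * U) := by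
    rw [← onQubit_mul, ← onQubit_conjTranspose, Matrix.conjTranspose_mul]
    simp only [Matrix.mul_assoc]
  rw [h, Matrix.mul_apply, Complex.re_sum]
  refine Finset.sum_nonneg fun i _ => ?_
  rw [Matrix.conjTranspose_apply, Complex.star_def, ← Complex.normSq_eq_conj_mul_self,
    Complex.ofReal_re]
  exact Complex.normSq_nonneg _

/-- Since the observable has spectrum in `[-1, 1]`, the operator `1 + d • obs` is positive and has a
factorization `Bᴴ * B`; its expectation in a unit vector is nonnegative. The cases `d = ±1` give
both bounds on the local output. -/
lemma one_add_mul_localModel_nonneg (k : Fin m) (Θ : C.Params) (x : 𝒳) {d : ℝ} (hd : |d| ≤ 1) :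
    0 ≤ 1 + d * C.localModel k Θ x := by
  have hO := C.obs_isHermitian k
  obtain ⟨B, hB⟩ := exists_conjTranspose_mul_self hO (d := d) fun i => by
    have h1 := C.obs_spectrum k (hO.eigenvalues_mem_spectrum_real i)
    have h2 : |d * hO.eigenvalues i| ≤ 1 := by
      rw [abs_mul]
      exact mul_le_one₀ hd (abs_nonneg _) (abs_le.2 h1)
    linarith [(abs_le.1 h2).1]
  have h := re_conj_onQubit_nonneg B k (C.unitary Θ x) (fun _ => 0)
  have hs : onQubit k ((d : ℂ) • C.obs k) = (d : ℂ) • onQubit k (C.obs k) := by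
    rw [onQubit, tensorOp_update_smul, onQubit]
  rw [← hB, onQubit_add, onQubit_one, hs, Matrix.mul_add, Matrix.add_mul, mul_one,
    unitary_conjTranspose_mul, Matrix.add_apply, Complex.add_re, Matrix.one_apply_eq,
    Complex.one_re, Matrix.mul_smul, Matrix.smul_mul, Matrix.smul_apply, smul_eq_mul,
    Complex.re_ofReal_mul] at h
  exact h

lemma abs_localModel_le (k : Fin m) (Θ : C.Params) (x : 𝒳) : |C.localModel k Θ x| ≤ 1 := by
  have h1 := C.one_add_mul_localModel_nonneg k Θ x (d := 1) (by simp)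
  have h2 := C.one_add_mul_localModel_nonneg k Θ x (d := -1) (by simp)
  rw [abs_le]
  constructor <;> linarith

/-- The local outputs of a circuit form a family of local functions. -/
lemma localFamily (x : 𝒳) :
    LocalFamily (fun k Θ => C.localModel k Θ x) C.pastCone 1 C.maxPast C.maxFuture where
  shiftRule k := C.shiftRule_localModel k x
  abs_le k Θ := C.abs_localModel_le k Θ x
  dependsOnlyOn k := C.dependsOnlyOn_localModel k x
  card_cone_le k := Finset.le_sup (f := fun k => (C.pastCone k).card) (Finset.mem_univ k)
  card_filter_le i := Finset.le_sup (f := fun i => (C.futureCone i).card) (Finset.mem_univ i)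

end Circuit

end QNN

end

open MeasureTheory ProbabilityTheory Filter Topology

noncomputable section

namespace QNN

/-! ### Consequences of the growth condition -/

section Growth

variable {l a q p N : ℕ → ℝ} {c : ℝ}

/-- The logarithm in the growth condition enters only through being eventually at least one. -/
lemma le_growth_of_log {x r s : ℝ} (hs : 1 ≤ Real.log s) (hr : 0 ≤ r) (hx : x ≤ r) :
    x ≤ r * Real.log s := hx.trans (le_mul_of_one_le_right hr hs)

lemma eventually_one_le_log (hN : Tendsto N atTop atTop) : ∀ᶠ m in atTop, 1 ≤ Real.log (N m) :=
  (Real.tendsto_log_atTop.comp hN).eventually_ge_atTop 1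

/-- In the application `l`, `a`, `q`, `p` are the depth, the number of qubits and the sizes of the
future and past cones. The lower bound on `a p q`, squared, replaces `a²` in the growth condition by
a multiple of `N⁴ / (p q)²`, which leaves `l² q⁴ p² / N`. -/
lemma tendsto_cone_sq_div (hN : Tendsto N atTop atTop)
    (hG : Tendsto (fun m => l m ^ 2 * a m ^ 2 * q m ^ 6 * p m ^ 4 / N m ^ 5 * Real.log (N m))
      atTop (𝓝 0)) (hc : 0 < c) (hcN : ∀ᶠ m in atTop, c * N m ^ 2 ≤ a m * (p m * q m))
    (h1 : ∀ᶠ m in atTop, 1 ≤ l m ∧ 1 ≤ a m ∧ 1 ≤ q m ∧ 1 ≤ p m) :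
    Tendsto (fun m => (p m * q m) ^ 2 / N m) atTop (𝓝 0) := by
  have hG' := hG.const_mul (1 / c ^ 2)
  rw [mul_zero] at hG'
  refine tendsto_of_tendsto_of_tendsto_of_le_of_le' tendsto_const_nhds hG' ?_ ?_
  · filter_upwards [hN.eventually_ge_atTop 1] with m hm
    positivity
  · filter_upwards [hN.eventually_ge_atTop 1, hcN, h1, eventually_one_le_log hN]
      with m hm hcm ⟨hl, ha, hq, hp⟩ hlog
    rw [← mul_assoc]
    refine le_growth_of_log hlog (by positivity) ?_
    rw [div_le_iff₀ (by positivity)]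
    have h2 : (c * N m ^ 2) ^ 2 ≤ (a m * (p m * q m)) ^ 2 :=
      pow_le_pow_left₀ (by positivity) hcm 2
    have h3 : (p m * q m) ^ 2 ≤ l m ^ 2 * q m ^ 4 * p m ^ 2 := by
      have e : l m ^ 2 * q m ^ 4 * p m ^ 2 = (l m ^ 2 * q m ^ 2) * (p m * q m) ^ 2 := by ring
      rw [e]
      exact le_mul_of_one_le_left (by positivity)
        (one_le_mul_of_one_le_of_one_le (one_le_pow₀ hl) (one_le_pow₀ hq))
    have h4 := mul_le_mul h2 h3 (by positivity) (by positivity)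
    have hNp : 0 < N m := by linarith
    have e : 1 / c ^ 2 * (l m ^ 2 * a m ^ 2 * q m ^ 6 * p m ^ 4 / N m ^ 5) * N m =
        ((a m * (p m * q m)) ^ 2 * (l m ^ 2 * q m ^ 4 * p m ^ 2)) / (c ^ 2 * N m ^ 4) := by
      field_simp
    rw [e, le_div_iff₀ (by positivity)]
    linarith [h4]

lemma tendsto_zero_of_sq_le {x y : ℕ → ℝ} (hy : Tendsto y atTop (𝓝 0))
    (h : ∀ᶠ m in atTop, x m ^ 2 ≤ y m) : Tendsto x atTop (𝓝 0) := by
  have h2 : Tendsto (fun m => √(y m)) atTop (𝓝 0) := by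
    rw [← Real.sqrt_zero]
    exact (Real.continuous_sqrt.tendsto 0).comp hy
  refine squeeze_zero_norm' ?_ h2
  filter_upwards [h] with m hm
  exact Real.abs_le_sqrt hm

/-- The square of this quantity is the growth ratio times `q² / N³`, and eventually `q² ≤ N` by the
preceding estimate of the cones. -/
lemma tendsto_growth_of_variance (hN : Tendsto N atTop atTop)
    (hG : Tendsto (fun m => l m ^ 2 * a m ^ 2 * q m ^ 6 * p m ^ 4 / N m ^ 5 * Real.log (N m))
      atTop (𝓝 0)) (hc : 0 < c) (hcN : ∀ᶠ m in atTop, c * N m ^ 2 ≤ a m * (p m * q m))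
    (h1 : ∀ᶠ m in atTop, 1 ≤ l m ∧ 1 ≤ a m ∧ 1 ≤ q m ∧ 1 ≤ p m) :
    Tendsto (fun m => l m * a m * (p m * q m ^ 2) ^ 2 / N m ^ 4) atTop (𝓝 0) := by
  refine tendsto_zero_of_sq_le hG ?_
  filter_upwards [hN.eventually_ge_atTop 1, h1, eventually_one_le_log hN,
    (tendsto_cone_sq_div hN hG hc hcN h1).eventually_le_const one_pos]
    with m hm ⟨hl, ha, hq, hp⟩ hlog hcone
  have hNp : 0 < N m := by linarith
  refine le_growth_of_log hlog (by positivity) ?_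
  rw [div_le_one hNp] at hcone
  have h2 : q m ^ 2 ≤ N m := by
    refine le_trans ?_ hcone
    rw [mul_pow]
    exact le_mul_of_one_le_left (by positivity) (one_le_pow₀ hp)
  have h3 : q m ^ 2 ≤ N m ^ 3 := h2.trans (le_self_pow₀ hm (by norm_num))
  have e : (l m * a m * (p m * q m ^ 2) ^ 2 / N m ^ 4) ^ 2 =
      (l m ^ 2 * a m ^ 2 * q m ^ 6 * p m ^ 4 / N m ^ 5) * (q m ^ 2 / N m ^ 3) := by
    field_simp
  rw [e]
  exact mul_le_of_le_one_right (by positivity) ((div_le_one (by positivity)).2 h3)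

/-- The growth ratio is the square of this quantity times `l² q² N`, which is eventually at least
one. -/
lemma tendsto_growth_of_stein (hN : Tendsto N atTop atTop)
    (hG : Tendsto (fun m => l m ^ 2 * a m ^ 2 * q m ^ 6 * p m ^ 4 / N m ^ 5 * Real.log (N m))
      atTop (𝓝 0))
    (h1 : ∀ᶠ m in atTop, 1 ≤ l m ∧ 1 ≤ a m ∧ 1 ≤ q m ∧ 1 ≤ p m) :
    Tendsto (fun m => a m * (p m * q m) ^ 2 / N m ^ 3) atTop (𝓝 0) := by
  refine tendsto_zero_of_sq_le hG ?_
  filter_upwards [hN.eventually_ge_atTop 1, h1, eventually_one_le_log hN]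
    with m hm ⟨hl, ha, hq, hp⟩ hlog
  have hNp : 0 < N m := by linarith
  refine le_growth_of_log hlog (by positivity) ?_
  have e : l m ^ 2 * a m ^ 2 * q m ^ 6 * p m ^ 4 / N m ^ 5 =
      (a m * (p m * q m) ^ 2 / N m ^ 3) ^ 2 * (l m ^ 2 * q m ^ 2 * N m) := by
    field_simp
  rw [e]
  exact le_mul_of_one_le_right (by positivity) (one_le_mul_of_one_le_of_one_le
    (one_le_mul_of_one_le_of_one_le (one_le_pow₀ hl) (one_le_pow₀ hq)) hm)

end Growth

/-! ### Bounds for the model, its gradient and its kernel -/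

namespace Circuit

variable {𝒳 : Type*} {m : ℕ} (C : Circuit 𝒳 m)

instance : IsProbabilityMeasure C.initLaw :=
  inferInstanceAs (IsProbabilityMeasure (unifPi (Fin C.depth × Fin m)))

lemma shiftRule_model (N : ℝ) (x : 𝒳) : ShiftRule fun Θ => C.model N Θ x :=
  (C.localFamily x).shiftRule_normSum (1 / N)

lemma continuous_model (N : ℝ) (x : 𝒳) : Continuous fun Θ => C.model N Θ x :=
  (C.shiftRule_model N x).continuous

lemma abs_model_le (N : ℝ) (Θ : C.Params) (x : 𝒳) : |C.model N Θ x| ≤ |1 / N| * m := by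
  have h := (C.localFamily x).abs_normSum_le (1 / N) Θ
  rwa [Fintype.card_fin, mul_one] at h

/-- The gradient of the model with respect to the parameters. -/
def modelGrad (N : ℝ) (x : 𝒳) (Θ : C.Params) : Fin C.depth × Fin m → ℝ :=
  grad (fun Θ => C.model N Θ x) Θ

lemma empiricalNTK_eq (N NK : ℝ) (Θ : C.Params) (x x' : 𝒳) : C.empiricalNTK N NK Θ x x' =
    (1 / NK) * ∑ i, C.modelGrad N x Θ i * C.modelGrad N x' Θ i := rfl

lemma empiricalNTK_self (N NK : ℝ) (Θ : C.Params) (x : 𝒳) : C.empiricalNTK N NK Θ x x =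
    (1 / NK) * l2 (C.modelGrad N x Θ) ^ 2 := by
  rw [empiricalNTK_eq, l2_sq]
  simp only [sq]

lemma empiricalNTK_comm (N NK : ℝ) (Θ : C.Params) (x x' : 𝒳) :
    C.empiricalNTK N NK Θ x x' = C.empiricalNTK N NK Θ x' x := by
  simp only [empiricalNTK, mul_comm]

lemma abs_modelGrad_le (N : ℝ) (x : 𝒳) (Θ : C.Params) (i : Fin C.depth × Fin m) :
    |C.modelGrad N x Θ i| ≤ |1 / N| * (C.maxFuture * 2) := by
  have h := (C.localFamily x).abs_partialDeriv_normSum_le (c := 1 / N) zero_le_one i Θ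
  rwa [mul_one] at h

lemma continuous_modelGrad (N : ℝ) (x : 𝒳) (i : Fin C.depth × Fin m) :
    Continuous fun Θ => C.modelGrad N x Θ i := (C.shiftRule_model N x).continuous_partialDeriv i

lemma continuous_empiricalNTK (N NK : ℝ) (x x' : 𝒳) :
    Continuous fun Θ => C.empiricalNTK N NK Θ x x' := by
  simp only [empiricalNTK_eq]
  exact continuous_const.mul (continuous_finsetSum _ fun i _ =>
    (C.continuous_modelGrad N x i).mul (C.continuous_modelGrad N x' i))

lemma abs_empiricalNTK_le (N NK : ℝ) (Θ : C.Params) (x x' : 𝒳) : |C.empiricalNTK N NK Θ x x'| ≤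
    |1 / NK| * ∑ _i : Fin C.depth × Fin m, (|1 / N| * (C.maxFuture * 2)) ^ 2 := by
  rw [empiricalNTK_eq, abs_mul]
  refine mul_le_mul_of_nonneg_left ((Finset.abs_sum_le_sum_abs _ _).trans
    (Finset.sum_le_sum fun i _ => ?_)) (abs_nonneg _)
  rw [abs_mul, sq]
  exact mul_le_mul (C.abs_modelGrad_le N x Θ i) (C.abs_modelGrad_le N x' Θ i) (abs_nonneg _)
    ((abs_nonneg _).trans (C.abs_modelGrad_le N x Θ i))

/-- The root of the number of parameters is replaced by the number itself; the size allowed to the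
noise is small enough to absorb this loss. -/
lemma l2_modelGrad_le (N : ℝ) (x : 𝒳) (Θ : C.Params) :
    l2 (C.modelGrad N x Θ) ≤ (C.depth * m : ℕ) * (|1 / N| * (C.maxFuture * 2)) := by
  have h0 : 0 ≤ |1 / N| * ((C.maxFuture : ℝ) * 2) := by positivity
  refine abs_le_of_sq_le_sq (a := l2 (C.modelGrad N x Θ)) ?_ (by positivity) |> (abs_le.1 · |>.2)
  rw [l2_sq]
  calc ∑ i, C.modelGrad N x Θ i ^ 2
      ≤ ∑ _i : Fin C.depth × Fin m, (|1 / N| * (C.maxFuture * 2)) ^ 2 :=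
        Finset.sum_le_sum fun i _ => by
          rw [← sq_abs]
          exact pow_le_pow_left₀ (abs_nonneg _) (C.abs_modelGrad_le N x Θ i) 2
    _ = ((C.depth * m : ℕ) : ℝ) * (|1 / N| * (C.maxFuture * 2)) ^ 2 := by simp
    _ ≤ ((C.depth * m : ℕ) : ℝ) ^ 2 * (|1 / N| * (C.maxFuture * 2)) ^ 2 := by
        refine mul_le_mul_of_nonneg_right ?_ (sq_nonneg _)
        exact_mod_cast Nat.le_self_pow two_ne_zero _
    _ = _ := (mul_pow _ _ 2).symm

/-- The bound for the operator norm of the Hessian of the model. -/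
def curvature (N : ℝ) : ℝ := 4 * 1 * |1 / N| * (C.maxPast * C.maxFuture)

lemma curvature_nonneg (N : ℝ) : 0 ≤ C.curvature N := by rw [curvature]; positivity

lemma l2_modelGrad_sub_le (N : ℝ) (x : 𝒳) (Θ Θ' : C.Params) :
    l2 (C.modelGrad N x Θ' - C.modelGrad N x Θ) ≤ C.curvature N * l2 (Θ' - Θ) := by
  have h := (C.localFamily x).l2_grad_sub_le (c := 1 / N) zero_le_one Θ (Θ' - Θ)
  rwa [add_sub_cancel] at h

lemma abs_model_taylor_le (N : ℝ) (x : 𝒳) (Θ Δ : C.Params) :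
    |C.model N (Θ + Δ) x - C.model N Θ x - ∑ i, Δ i * C.modelGrad N x Θ i| ≤
      C.curvature N * l2 Δ ^ 2 :=
  (C.localFamily x).abs_taylor_le (c := 1 / N) zero_le_one Θ Δ

lemma integral_model_sq_le (N : ℝ) (x : 𝒳)
    (h0 : ∀ k, ∫ Θ, C.localModel k Θ x ∂C.initLaw = 0) :
    ∫ Θ, C.model N Θ x ^ 2 ∂C.initLaw ≤ (1 / N) ^ 2 * (m * (C.maxPast * C.maxFuture)) := by
  have h := (C.localFamily x).integral_sum_sq_le zero_le_one h0
  simp only [model, mul_pow]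
  rw [integral_const_mul]
  refine mul_le_mul_of_nonneg_left ?_ (sq_nonneg _)
  rwa [Fintype.card_fin, one_pow, mul_one] at h

lemma integral_model_eq_zero (N : ℝ) (x : 𝒳)
    (h0 : ∀ k, ∫ Θ, C.localModel k Θ x ∂C.initLaw = 0) : ∫ Θ, C.model N Θ x ∂C.initLaw = 0 := by
  simp only [model]
  rw [integral_const_mul, integral_finsetSum, Finset.sum_eq_zero fun k _ => h0 k, mul_zero]
  exact fun k _ => integrable_of_abs_le
    ((C.localFamily x).shiftRule k).continuous.aestronglyMeasurable ((C.localFamily x).abs_le k)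

lemma mul_analyticNTK_self {NK : ℝ} (hNK : NK ≠ 0) (N : ℝ) (x : 𝒳) :
    NK * C.analyticNTK N NK x x = ∫ Θ, l2 (C.modelGrad N x Θ) ^ 2 ∂C.initLaw := by
  simp only [analyticNTK, empiricalNTK_self]
  rw [integral_const_mul]
  field_simp

/-- The Poincaré inequality for the centered model. Together with `mul_analyticNTK_self` it bounds
`N_K` from below. -/
lemma integral_model_sq_le_pi_sq_mul (N : ℝ) (x : 𝒳)
    (h0 : ∀ k, ∫ Θ, C.localModel k Θ x ∂C.initLaw = 0) :
    ∫ Θ, C.model N Θ x ^ 2 ∂C.initLaw ≤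
      Real.pi ^ 2 * ∫ Θ, l2 (C.modelGrad N x Θ) ^ 2 ∂C.initLaw := by
  have h := (C.localFamily x).poincare_normSum (1 / N)
  have h1 : ∫ Θ, normSum (1 / N) (fun k Θ => C.localModel k Θ x) Θ ∂unifPi _ = 0 :=
    C.integral_model_eq_zero N x h0
  rwa [h1, zero_pow two_ne_zero, sub_zero] at h

lemma analyticNTK_comm (N NK : ℝ) (x x' : 𝒳) :
    C.analyticNTK N NK x x' = C.analyticNTK N NK x' x := by
  simp only [analyticNTK, C.empiricalNTK_comm N NK _ x x']

/-- The variance of the empirical neural tangent kernel at initialization. -/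
lemma variance_empiricalNTK_le {NK : ℝ} (hNK : NK ≠ 0) (N : ℝ) (x x' : 𝒳) :
    ∫ Θ, (C.empiricalNTK N NK Θ x x' - C.analyticNTK N NK x x') ^ 2 ∂C.initLaw ≤
      Real.pi ^ 2 * (2 * C.curvature N ^ 2 *
        (1 / NK * (C.analyticNTK N NK x x + C.analyticNTK N NK x' x'))) := by
  have h := (C.localFamily x).poincare_kernel (C.localFamily x') zero_le_one (1 / N)
  change ∫ Θ, (∑ i, C.modelGrad N x Θ i * C.modelGrad N x' Θ i) ^ 2 ∂C.initLaw -
    (∫ Θ, ∑ i, C.modelGrad N x Θ i * C.modelGrad N x' Θ i ∂C.initLaw) ^ 2 ≤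
    Real.pi ^ 2 * (2 * C.curvature N ^ 2 * (∫ Θ, l2 (C.modelGrad N x Θ) ^ 2 ∂C.initLaw +
      ∫ Θ, l2 (C.modelGrad N x' Θ) ^ 2 ∂C.initLaw)) at h
  rw [← C.mul_analyticNTK_self hNK N x, ← C.mul_analyticNTK_self hNK N x'] at h
  have hm : AEStronglyMeasurable (fun Θ => C.empiricalNTK N NK Θ x x') C.initLaw :=
    (C.continuous_empiricalNTK N NK x x').aestronglyMeasurable
  have hLp : MemLp (fun Θ => C.empiricalNTK N NK Θ x x') 2 C.initLaw :=
    MemLp.of_bound hm _ (ae_of_all _ fun Θ => C.abs_empiricalNTK_le N NK Θ x x')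
  have e1 : ∫ Θ, (C.empiricalNTK N NK Θ x x' - C.analyticNTK N NK x x') ^ 2 ∂C.initLaw =
      ∫ Θ, C.empiricalNTK N NK Θ x x' ^ 2 ∂C.initLaw -
        (∫ Θ, C.empiricalNTK N NK Θ x x' ∂C.initLaw) ^ 2 := by
    have := variance_eq_sub hLp
    rw [variance_eq_integral hm.aemeasurable] at this
    exact this
  rw [e1]
  simp only [empiricalNTK_eq, mul_pow]
  rw [integral_const_mul, integral_const_mul, mul_pow, ← mul_sub]
  refine (mul_le_mul_of_nonneg_left h (sq_nonneg (1 / NK))).trans_eq ?_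
  field_simp

lemma depth_pos_of_maxFuture_pos (h : 0 < C.maxFuture) : 0 < C.depth := by
  rw [maxFuture, Finset.lt_sup_iff] at h
  obtain ⟨i, -, -⟩ := h
  exact i.1.pos

end Circuit

end QNN

end

/-! ### Consequences of the assumptions on the sequence of circuits -/

open MeasureTheory ProbabilityTheory Filter Topology

noncomputable section

namespace QNN

section Sequence

variable {𝒳 : Type*} {C : (m : ℕ) → Circuit 𝒳 m} {N NK : ℕ → ℝ} {Kcov Kbar : 𝒳 → 𝒳 → ℝ}
  {n : ℕ} {X : Fin n → 𝒳}

lemma NTKAssumption.apply_comm (h : NTKAssumption C N NK Kbar X) (x x' : 𝒳) :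
    Kbar x x' = Kbar x' x := by
  have h1 := h.tendsto.tendsto_at (x, x')
  have h2 := h.tendsto.tendsto_at (x', x)
  simp only [(C _).analyticNTK_comm (N _) (NK _) x x'] at h1
  exact tendsto_nhds_unique h1 h2

lemma NTKAssumption.nonempty (h : NTKAssumption C N NK Kbar X) : Nonempty 𝒳 := by
  by_contra hX
  rw [not_nonempty_iff] at hX
  exact h.ne_zero (funext fun x => hX.elim x)

/-- For `n = 0` the spectrum is empty and its infimum has the default value zero, which is not
positive. -/
lemma NTKAssumption.pos (h : NTKAssumption C N NK Kbar X) : 0 < n := by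
  have h0 := h.minEigenvalue_pos
  rcases Nat.eq_zero_or_pos n with rfl | hn
  · rw [minEigenvalue, spectrum.of_subsingleton, Real.sInf_empty] at h0
    exact absurd h0 (lt_irrefl _)
  · exact hn

lemma NTKAssumption.isHermitian_gram (h : NTKAssumption C N NK Kbar X) :
    (gram Kbar X).IsHermitian := by
  ext i j
  simp [gram, h.apply_comm (X i) (X j)]

lemma NTKAssumption.posDef_gram (h : NTKAssumption C N NK Kbar X) : (gram Kbar X).PosDef := by
  rw [h.isHermitian_gram.posDef_iff_eigenvalues_pos]
  intro i
  exact h.minEigenvalue_pos.trans_le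
    (csInf_le (Matrix.finite_real_spectrum).bddBelow
      (h.isHermitian_gram.eigenvalues_mem_spectrum_real i))

lemma NTKAssumption.diag_pos (h : NTKAssumption C N NK Kbar X) (j : Fin n) :
    0 < Kbar (X j) (X j) := h.posDef_gram.diag_pos (i := j)

lemma NTKAssumption.isUnit_det_gram (h : NTKAssumption C N NK Kbar X) :
    IsUnit (gram Kbar X).det := h.posDef_gram.det_pos.ne'.isUnit

lemma InitAssumption.tendsto_integral_sq (h : InitAssumption C N Kcov) (x : 𝒳) :
    Tendsto (fun m => ∫ Θ, (C m).model (N m) Θ x ^ 2 ∂(C m).initLaw) atTop (𝓝 (Kcov x x)) := by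
  simpa only [sq] using h.cov_tendsto.tendsto_at (x, x)

/-- The variance of the model is at most `m |𝒩| |ℳ| / N²` and has a positive limit. -/
lemma InitAssumption.eventually_mul_sq_le [Nonempty 𝒳] (h : InitAssumption C N Kcov)
    (hN : Tendsto N atTop atTop) : ∃ c > 0, ∀ᶠ m : ℕ in atTop,
      c * N m ^ 2 ≤ (m : ℝ) * ((C m).maxPast * (C m).maxFuture) := by
  obtain ⟨x⟩ := ‹Nonempty 𝒳›
  refine ⟨Kcov x x / 2, half_pos (h.diag_pos x), ?_⟩
  filter_upwards [(h.tendsto_integral_sq x).eventually_const_le (half_lt_self (h.diag_pos x)),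
    hN.eventually_gt_atTop 0] with m hm hNm
  have := hm.trans ((C m).integral_model_sq_le (N m) x fun k => h.mean_zero m k x)
  rwa [div_pow, one_pow, one_div_mul_eq_div, le_div_iff₀ (by positivity)] at this

lemma InitAssumption.eventually_one_le [Nonempty 𝒳] (h : InitAssumption C N Kcov)
    (hN : Tendsto N atTop atTop) : ∀ᶠ m : ℕ in atTop, (1 : ℝ) ≤ (C m).depth ∧ (1 : ℝ) ≤ m ∧
      (1 : ℝ) ≤ (C m).maxFuture ∧ (1 : ℝ) ≤ (C m).maxPast := by
  obtain ⟨c, hc, hcN⟩ := h.eventually_mul_sq_le hN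
  filter_upwards [hcN, hN.eventually_gt_atTop 0] with m hm hNm
  have h0 : (m : ℝ) * ((C m).maxPast * (C m).maxFuture) ≠ 0 :=
    ((by positivity : (0 : ℝ) < c * N m ^ 2).trans_le hm).ne'
  simp only [ne_eq, mul_eq_zero, not_or, Nat.cast_eq_zero] at h0
  obtain ⟨h1, h2, h3⟩ := h0
  have h4 := (C m).depth_pos_of_maxFuture_pos (Nat.pos_of_ne_zero h3)
  refine ⟨?_, ?_, ?_, ?_⟩ <;> exact_mod_cast (by omega)

/-- The growth condition on the architecture. -/
def Growth (C : (m : ℕ) → Circuit 𝒳 m) (N : ℕ → ℝ) : Prop :=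
  Tendsto (fun m : ℕ => ((C m).depth : ℝ) ^ 2 * (m : ℝ) ^ 2 * ((C m).maxFuture : ℝ) ^ 6 *
    ((C m).maxPast : ℝ) ^ 4 / N m ^ 5 * Real.log (N m)) atTop (𝓝 0)

/-- The curvature is `4 |𝒩| |ℳ| / N`, and `|𝒩| |ℳ| ≥ 1` allows replacing this product by its square.
-/
lemma InitAssumption.tendsto_curvature [Nonempty 𝒳] (h : InitAssumption C N Kcov)
    (hN : Tendsto N atTop atTop) (hG : Growth C N) :
    Tendsto (fun m => (C m).curvature (N m)) atTop (𝓝 0) := by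
  obtain ⟨c, hc, hcN⟩ := h.eventually_mul_sq_le hN
  have h1 := tendsto_cone_sq_div hN hG hc hcN (h.eventually_one_le hN)
  have h2 := h1.const_mul 4
  rw [mul_zero] at h2
  refine tendsto_of_tendsto_of_tendsto_of_le_of_le' tendsto_const_nhds h2
    (.of_forall fun m => (C m).curvature_nonneg _) ?_
  filter_upwards [h.eventually_one_le hN, hN.eventually_gt_atTop 0] with m ⟨_, _, hq, hp⟩ hNm
  have h3 : ((C m).maxPast * (C m).maxFuture : ℝ) ≤ ((C m).maxPast * (C m).maxFuture) ^ 2 :=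
    le_self_pow₀ (one_le_mul_of_one_le_of_one_le hp hq) two_ne_zero
  rw [Circuit.curvature, abs_of_pos (by positivity), mul_one, mul_assoc, one_div_mul_eq_div]
  gcongr

/-- Neither the sign nor the size of `NK` is prescribed. At a training input the variance of the
model has a positive limit and is at most `π² NK` times the diagonal of the kernel, which converges
to a positive number. -/
lemma eventually_le_normalization (h : InitAssumption C N Kcov) (hK : NTKAssumption C N NK Kbar X) :
    ∃ c > 0, ∀ᶠ m in atTop, c ≤ NK m := by
  let j : Fin n := ⟨0, hK.pos⟩
  have hk := hK.diag_pos j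
  set κ := Kbar (X j) (X j)
  have hv := h.diag_pos (X j)
  set v := Kcov (X j) (X j)
  have hA := hK.tendsto.tendsto_at (X j, X j)
  refine ⟨v / 2 / (Real.pi ^ 2 * (2 * κ)), by positivity, ?_⟩
  filter_upwards [(h.tendsto_integral_sq (X j)).eventually_const_le (half_lt_self hv),
    hA.eventually_const_le (half_lt_self hk),
    hA.eventually_le_const (by linarith : κ < 2 * κ)] with m h1 h2 h3
  have h2' : 0 < (C m).analyticNTK (N m) (NK m) (X j) (X j) := (half_pos hk).trans_le h2
  -- Division by zero gives zero, so `NK m = 0` would make the kernel vanish.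
  have hne : NK m ≠ 0 := fun h0 => by
    rw [h0, Circuit.analyticNTK] at h2'
    simp [Circuit.empiricalNTK] at h2'
  have h4 := h1.trans ((C m).integral_model_sq_le_pi_sq_mul (N m) (X j)
    fun k => h.mean_zero m k (X j))
  rw [← (C m).mul_analyticNTK_self hne] at h4
  have h5 : 0 < NK m := by
    by_contra hneg
    have : NK m * (C m).analyticNTK (N m) (NK m) (X j) (X j) ≤ 0 :=
      mul_nonpos_of_nonpos_of_nonneg (not_lt.1 hneg) h2'.le
    have h6 := mul_nonpos_of_nonneg_of_nonpos (sq_nonneg Real.pi) this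
    linarith
  rw [div_le_iff₀ (by positivity)]
  refine h4.trans ?_
  have : NK m * (C m).analyticNTK (N m) (NK m) (X j) (X j) ≤ NK m * (2 * κ) :=
    mul_le_mul_of_nonneg_left h3 h5.le
  calc _ ≤ Real.pi ^ 2 * (NK m * (2 * κ)) := mul_le_mul_of_nonneg_left this (sq_nonneg _)
    _ = _ := by ring

/-- The Poincaré bound is the squared curvature over `NK`, times a bounded factor; the curvature
vanishes and `NK` is bounded below. -/
lemma tendsto_variance_empiricalNTK (h : InitAssumption C N Kcov)
    (hK : NTKAssumption C N NK Kbar X) (hN : Tendsto N atTop atTop) (hG : Growth C N)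
    (x x' : 𝒳) : Tendsto (fun m => ∫ Θ, ((C m).empiricalNTK (N m) (NK m) Θ x x' -
      (C m).analyticNTK (N m) (NK m) x x') ^ 2 ∂(C m).initLaw) atTop (𝓝 0) := by
  have := hK.nonempty
  obtain ⟨c, hc, hNK⟩ := eventually_le_normalization h hK
  have hH := h.tendsto_curvature hN hG
  have hA := (hK.tendsto.tendsto_at (x, x)).add (hK.tendsto.tendsto_at (x', x'))
  have hlim : Tendsto (fun m => Real.pi ^ 2 * (2 * (C m).curvature (N m) ^ 2 *
      (1 / c * ((C m).analyticNTK (N m) (NK m) x x + (C m).analyticNTK (N m) (NK m) x' x'))))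
      atTop (𝓝 0) := by
    have h1 := (((hH.pow 2).const_mul 2).mul (hA.const_mul (1 / c))).const_mul (Real.pi ^ 2)
    rwa [zero_pow two_ne_zero, mul_zero, zero_mul, mul_zero] at h1
  refine tendsto_of_tendsto_of_tendsto_of_le_of_le' tendsto_const_nhds hlim
    (.of_forall fun m => integral_nonneg fun _ => sq_nonneg _) ?_
  filter_upwards [hNK] with m hm
  have hpos : 0 < NK m := hc.trans_le hm
  refine ((C m).variance_empiricalNTK_le hpos.ne' (N m) x x').trans ?_
  have h0 : ∀ x, 0 ≤ (C m).analyticNTK (N m) (NK m) x x := fun x => by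
    refine integral_nonneg fun Θ => ?_
    rw [Circuit.empiricalNTK_self]
    exact mul_nonneg (one_div_nonneg.2 hpos.le) (sq_nonneg _)
  exact mul_le_mul_of_nonneg_left (mul_le_mul_of_nonneg_left
    (mul_le_mul_of_nonneg_right (one_div_le_one_div_of_le hc hm) (add_nonneg (h0 x) (h0 x')))
    (mul_nonneg two_pos.le (sq_nonneg _))) (sq_nonneg _)

end Sequence

end QNN

end

open MeasureTheory ProbabilityTheory Filter Topology

noncomputable section

namespace QNN

/-! ### Convergence in probability along a sequence of probability spaces -/

section AsymptoticProbability

variable {Ω : ℕ → Type*} [∀ m, MeasurableSpace (Ω m)]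

/-- The filter of the events whose probability tends to one. Convergence along it is convergence in
probability. -/
def aas (P : (m : ℕ) → Measure (Ω m)) : Filter (Σ m, Ω m) where
  sets := {S | Tendsto (fun m => P m {ω | (⟨m, ω⟩ : Σ m, Ω m) ∉ S}) atTop (𝓝 0)}
  univ_sets := by simp
  sets_of_superset {S S'} hS h := tendsto_of_tendsto_of_tendsto_of_le_of_le tendsto_const_nhds hS
    (fun _ => zero_le) fun m => measure_mono fun ω hω hS' => hω (h hS')
  inter_sets {S S'} hS hS' := by
    have h := Tendsto.add hS hS'
    rw [add_zero] at h
    refine tendsto_of_tendsto_of_tendsto_of_le_of_le tendsto_const_nhds h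
      (fun _ => zero_le) fun m => (measure_mono fun ω hω => ?_).trans (measure_union_le _ _)
    by_cases h1 : (⟨m, ω⟩ : Σ m, Ω m) ∈ S
    · exact Or.inr fun h2 => hω ⟨h1, h2⟩
    · exact Or.inl h1

variable {P : (m : ℕ) → Measure (Ω m)}

lemma eventually_aas {Q : (Σ m, Ω m) → Prop} : (∀ᶠ p in aas P, Q p) ↔
    Tendsto (fun m => P m {ω | ¬ Q ⟨m, ω⟩}) atTop (𝓝 0) := Iff.rfl

lemma tendsto_fst_aas : Tendsto Sigma.fst (aas P) atTop := by
  intro S hS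
  refine tendsto_const_nhds.congr' ?_
  filter_upwards [hS] with m hm
  have : {ω : Ω m | (⟨m, ω⟩ : Σ m, Ω m) ∉ Sigma.fst ⁻¹' S} = ∅ := by
    ext ω; simpa using hm
  rw [this, measure_empty]

lemma tendsto_zero_aas_iff {Z : (Σ m, Ω m) → ℝ} : Tendsto Z (aas P) (𝓝 0) ↔
    ∀ ε > 0, Tendsto (fun m => P m {ω | ε ≤ |Z ⟨m, ω⟩|}) atTop (𝓝 0) := by
  rw [Metric.tendsto_nhds]
  refine forall₂_congr fun ε _ => ?_
  rw [eventually_aas]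
  simp only [Real.dist_eq, sub_zero, not_lt]

/-- A sequence of random variables which is bounded in probability. -/
def BoundedInProb (P : (m : ℕ) → Measure (Ω m)) (Z : (Σ m, Ω m) → ℝ) : Prop :=
  ∀ W, Tendsto W (aas P) (𝓝 0) → Tendsto (fun p => W p * Z p) (aas P) (𝓝 0)

namespace BoundedInProb

variable {Z Z' : (Σ m, Ω m) → ℝ}

lemma of_tendsto {a : ℝ} (h : Tendsto Z (aas P) (𝓝 a)) : BoundedInProb P Z := fun W hW => by
  simpa using hW.mul h

lemma add (h : BoundedInProb P Z) (h' : BoundedInProb P Z') :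
    BoundedInProb P fun p => Z p + Z' p := fun W hW => by
  simpa [mul_add] using (h W hW).add (h' W hW)

/-- Because boundedness is defined by its action on sequences vanishing in probability, stability
under products is associativity. -/
lemma mul (h : BoundedInProb P Z) (h' : BoundedInProb P Z') :
    BoundedInProb P fun p => Z p * Z' p := fun W hW => by
  simpa [mul_assoc] using h' _ (h W hW)

lemma const (c : ℝ) : BoundedInProb P fun _ => c := of_tendsto tendsto_const_nhds

lemma sum {α : Type*} {s : Finset α} {F : α → (Σ m, Ω m) → ℝ}
    (h : ∀ j ∈ s, BoundedInProb P (F j)) : BoundedInProb P fun p => ∑ j ∈ s, F j p :=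
  fun W hW => by
    simp only [Finset.mul_sum]
    simpa using tendsto_finsetSum s fun j hj => h j hj W hW

lemma mono (h : BoundedInProb P Z) (hle : ∀ᶠ p in aas P, |Z' p| ≤ |Z p|) :
    BoundedInProb P Z' := fun W hW => by
  refine squeeze_zero_norm' ?_ (tendsto_zero_iff_norm_tendsto_zero.1 (h W hW))
  filter_upwards [hle] with p hp
  simp only [Real.norm_eq_abs, abs_mul]
  exact mul_le_mul_of_nonneg_left hp (abs_nonneg _)

lemma abs (h : BoundedInProb P Z) : BoundedInProb P fun p => |Z p| :=
  h.mono (.of_forall fun _ => (abs_abs _).le)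

lemma of_sq (h : BoundedInProb P fun p => Z p ^ 2) : BoundedInProb P Z :=
  ((const 1).add h).mono (.of_forall fun p => by
    rw [abs_of_nonneg (by positivity : 0 ≤ 1 + Z p ^ 2), ← sq_abs]
    nlinarith [sq_nonneg (|Z p| - 1), abs_nonneg (Z p)])

lemma of_eventually_le {a : ℕ → ℝ} {c : ℝ} (h : ∀ᶠ m in atTop, |a m| ≤ c) :
    BoundedInProb P fun p => a p.1 :=
  (const c).mono (tendsto_fst_aas.eventually (h.mono fun _ hm => hm.trans (le_abs_self c)))

/-- Markov's inequality: up to probability `r` the variable `Z` stays below the threshold `(|c| + 1)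
/ r`, and then a large product forces `W` to be large. -/
lemma of_integral_le {c : ℝ} (h0 : ∀ p, 0 ≤ Z p) [∀ m, IsFiniteMeasure (P m)]
    (hint : ∀ᶠ m in atTop, Integrable (fun ω => Z ⟨m, ω⟩) (P m))
    (h : ∀ᶠ m in atTop, ∫ ω, Z ⟨m, ω⟩ ∂P m ≤ c) : BoundedInProb P Z := by
  intro W hW
  rw [tendsto_zero_aas_iff] at hW ⊢
  intro ε hε
  rw [ENNReal.tendsto_nhds_zero]
  intro η hη
  rcases eq_or_ne η ⊤ with rfl | hη'
  · simp
  have hη0 : 0 < η.toReal := ENNReal.toReal_pos hη.ne' hη'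
  set r := η.toReal / 2
  -- Chosen so that `δ` times the threshold is `ε`; adding one to `|c|` keeps the denominator
  -- positive.
  set δ := ε * r / (|c| + 1) with hδ
  have hc : 0 < |c| + 1 := by positivity
  have hδ0 : 0 < δ := by positivity
  have h1 := (ENNReal.tendsto_nhds_zero.1 (hW δ hδ0)) (ENNReal.ofReal r)
    (ENNReal.ofReal_pos.2 (half_pos hη0))
  filter_upwards [h1, hint, h] with m hm hi hle
  have h2 : P m {ω | (|c| + 1) / r ≤ Z ⟨m, ω⟩} ≤ ENNReal.ofReal r := by
    have h3 := mul_meas_ge_le_integral_of_nonneg (ae_of_all _ fun ω => h0 ⟨m, ω⟩) hi ((|c| + 1) / r)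
    have h4 : (P m).real {ω | (|c| + 1) / r ≤ Z ⟨m, ω⟩} ≤ r := by
      have h5 : (|c| + 1) / r * (P m).real {ω | (|c| + 1) / r ≤ Z ⟨m, ω⟩} ≤ |c| + 1 :=
        h3.trans (hle.trans (by linarith [le_abs_self c]))
      have hr : 0 < r := half_pos hη0
      rw [div_mul_eq_mul_div, div_le_iff₀ hr] at h5
      exact le_of_mul_le_mul_left h5 hc
    rw [Measure.real] at h4
    exact (ENNReal.le_ofReal_iff_toReal_le (measure_ne_top _ _) (half_pos hη0).le).2 h4
  calc P m {ω | ε ≤ |W ⟨m, ω⟩ * Z ⟨m, ω⟩|}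
      ≤ P m ({ω | δ ≤ |W ⟨m, ω⟩|} ∪ {ω | (|c| + 1) / r ≤ Z ⟨m, ω⟩}) := by
        refine measure_mono fun ω hω => ?_
        by_contra hcon
        simp only [Set.mem_union, Set.mem_ofPred_eq, not_or, not_le] at hcon
        have h6 : |W ⟨m, ω⟩ * Z ⟨m, ω⟩| < δ * ((|c| + 1) / r) := by
          rw [abs_mul, abs_of_nonneg (h0 _)]
          exact mul_lt_mul'' hcon.1 hcon.2 (abs_nonneg _) (h0 _)
        have h7 : δ * ((|c| + 1) / r) = ε := by
          have hr : r ≠ 0 := (half_pos hη0).ne'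
          rw [hδ]; field_simp
        exact absurd (h7 ▸ h6) (not_lt.2 hω)
    _ ≤ ENNReal.ofReal r + ENNReal.ofReal r := (measure_union_le _ _).trans (add_le_add hm h2)
    _ = η := by
        rw [← ENNReal.ofReal_add (half_pos hη0).le (half_pos hη0).le, add_halves,
          ENNReal.ofReal_toReal hη']

end BoundedInProb

lemma tendsto_aas_of_integral {Z : (Σ m, Ω m) → ℝ} [∀ m, IsFiniteMeasure (P m)]
    (h0 : ∀ p, 0 ≤ Z p) (hint : ∀ m, Integrable (fun ω => Z ⟨m, ω⟩) (P m))
    (h : Tendsto (fun m => ∫ ω, Z ⟨m, ω⟩ ∂P m) atTop (𝓝 0)) : Tendsto Z (aas P) (𝓝 0) := by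
  rw [tendsto_zero_aas_iff]
  intro ε hε
  have h1 := (ENNReal.continuous_ofReal.tendsto 0).comp (h.const_mul (1 / ε) |>.trans (by simp))
  rw [ENNReal.ofReal_zero] at h1
  refine tendsto_of_tendsto_of_tendsto_of_le_of_le tendsto_const_nhds h1 (fun _ => zero_le)
    fun m => ?_
  have h3 := mul_meas_ge_le_integral_of_nonneg (ae_of_all _ fun ω => h0 ⟨m, ω⟩) (hint m) ε
  simp only [abs_of_nonneg (h0 _), Function.comp_apply]
  refine (ENNReal.le_ofReal_iff_toReal_le (measure_ne_top _ _) ?_).2 ?_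
  · exact mul_nonneg (by positivity) (integral_nonneg fun ω => h0 _)
  · rw [one_div_mul_eq_div, le_div_iff₀ hε, mul_comm]
    exact h3

/-- The imaginary exponential is Lipschitz, which serves where the difference is small; elsewhere
the integrands differ by at most two, on an event of vanishing probability. -/
lemma tendsto_integral_cexp_sub [∀ m, IsProbabilityMeasure (P m)] {u v : (Σ m, Ω m) → ℝ}
    (hu : ∀ m, Measurable fun ω => u ⟨m, ω⟩) (hv : ∀ m, Measurable fun ω => v ⟨m, ω⟩)
    (h : Tendsto (fun p => u p - v p) (aas P) (𝓝 0)) :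
    Tendsto (fun m => ∫ ω, Complex.exp (Complex.I * (u ⟨m, ω⟩ : ℂ)) ∂P m -
      ∫ ω, Complex.exp (Complex.I * (v ⟨m, ω⟩ : ℂ)) ∂P m) atTop (𝓝 0) := by
  have hn : ∀ r : ℝ, ‖Complex.exp (Complex.I * (r : ℂ))‖ = 1 := fun r => by
    rw [mul_comm, Complex.norm_exp_ofReal_mul_I]
  have hint : ∀ {w : (Σ m, Ω m) → ℝ}, (∀ m, Measurable fun ω => w ⟨m, ω⟩) →
      ∀ m, Integrable (fun ω => Complex.exp (Complex.I * (w ⟨m, ω⟩ : ℂ))) (P m) := fun {w} hw m =>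
    Integrable.of_bound (Complex.measurable_exp.comp
      (measurable_const.mul (Complex.measurable_ofReal.comp (hw m)))).aestronglyMeasurable 1
      (ae_of_all _ fun ω => (hn _).le)
  rw [tendsto_zero_aas_iff] at h
  rw [Metric.tendsto_nhds]
  intro ε hε
  have h1 := (ENNReal.tendsto_nhds_zero.1 (h (ε / 2) (half_pos hε))) (ENNReal.ofReal (ε / 8))
    (ENNReal.ofReal_pos.2 (by positivity))
  filter_upwards [h1] with m hm
  rw [dist_zero_right, ← integral_sub (hint hu m) (hint hv m)]
  set S := {ω | ε / 2 ≤ |u ⟨m, ω⟩ - v ⟨m, ω⟩|} with hS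
  have hSm : MeasurableSet S := measurableSet_le measurable_const ((hu m).sub (hv m)).abs
  have hPS : (P m).real S ≤ ε / 8 :=
    ENNReal.toReal_le_of_le_ofReal (by positivity) hm
  have hb : ∀ ω, ‖Complex.exp (Complex.I * (u ⟨m, ω⟩ : ℂ)) -
      Complex.exp (Complex.I * (v ⟨m, ω⟩ : ℂ))‖ ≤ ε / 2 + S.indicator (fun _ => (2 : ℝ)) ω := by
    intro ω
    by_cases hω : ω ∈ S
    · rw [Set.indicator_of_mem hω]
      refine (norm_sub_le _ _).trans ?_
      rw [hn, hn]
      linarith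
    · rw [Set.indicator_of_notMem hω, add_zero]
      have e : Complex.exp (Complex.I * (u ⟨m, ω⟩ : ℂ)) - Complex.exp (Complex.I * (v ⟨m, ω⟩ : ℂ)) =
          Complex.exp (Complex.I * (v ⟨m, ω⟩ : ℂ)) *
            (Complex.exp (Complex.I * ((u ⟨m, ω⟩ - v ⟨m, ω⟩ : ℝ) : ℂ)) - 1) := by
        rw [mul_sub, mul_one, ← Complex.exp_add]
        congr 2
        push_cast
        ring
      rw [e, norm_mul, hn, one_mul]
      refine (Real.norm_exp_I_mul_ofReal_sub_one_le).trans ?_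
      rw [Real.norm_eq_abs]
      exact (not_le.1 hω).le
  calc _ ≤ ∫ ω, (ε / 2 + S.indicator (fun _ => (2 : ℝ)) ω) ∂P m :=
        norm_integral_le_of_norm_le ((integrable_const _).add
          ((integrable_const _).indicator hSm)) (ae_of_all _ hb)
    _ = ε / 2 + (P m).real S * 2 := by
        rw [integral_add (integrable_const _) ((integrable_const _).indicator hSm),
          integral_indicator_const _ hSm]
        simp
    _ < ε := by linarith

end AsymptoticProbability

end QNN

end

/-! ### The gradient of the loss and the noise of its estimator -/

open MeasureTheory ProbabilityTheory Filter Topology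

noncomputable section

namespace QNN

/-- A weight known from the past can be pulled out of the conditional expectation. -/
lemma integral_mul_sq_sub_condExp {Ω : Type*} {m m₀ : MeasurableSpace Ω} {μ : Measure Ω}
    [IsFiniteMeasure μ] (hm : m ≤ m₀) {Z w : Ω → ℝ} (hZ : MemLp Z 2 μ)
    (hw : StronglyMeasurable[m] w) {c : ℝ} (hc : ∀ ω, ‖w ω‖ ≤ c) :
    ∫ ω, w ω * (Z ω - (μ[Z | m]) ω) ^ 2 ∂μ = ∫ ω, w ω * condVar m Z μ ω ∂μ := by
  have hint : Integrable ((Z - μ[Z | m]) ^ 2) μ := (hZ.sub (hZ.condExp one_le_two)).integrable_sq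
  have h := condExp_stronglyMeasurable_mul_of_bound hm hw hint c (ae_of_all _ hc)
  rw [← integral_condExp hm]
  exact integral_congr_ae h

namespace Circuit

variable {𝒳 : Type*} {m : ℕ} (C : Circuit 𝒳 m) {Ω : Type*}

lemma differentiable_loss (N : ℝ) {n : ℕ} (X : Fin n → 𝒳) (Y : Fin n → ℝ) :
    Differentiable ℝ (C.loss N X Y) := by
  refine Differentiable.const_mul (Differentiable.fun_sum fun j _ => ?_) _
  exact ((C.shiftRule_model N (X j)).differentiable.sub_const _).pow 2

lemma loss_nonneg (N : ℝ) {n : ℕ} (X : Fin n → 𝒳) (Y : Fin n → ℝ) (Θ : C.Params) :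
    0 ≤ C.loss N X Y Θ :=
  mul_nonneg (by positivity) (Finset.sum_nonneg fun _ _ => sq_nonneg _)

lemma continuous_loss (N : ℝ) {n : ℕ} (X : Fin n → 𝒳) (Y : Fin n → ℝ) :
    Continuous (C.loss N X Y) := (C.differentiable_loss N X Y).continuous

lemma partialDeriv_loss (N : ℝ) {n : ℕ} (X : Fin n → 𝒳) (Y : Fin n → ℝ)
    (i : Fin C.depth × Fin m) (Θ : C.Params) : partialDeriv (C.loss N X Y) i Θ =
      (1 / (n : ℝ)) * ∑ j, (C.model N Θ (X j) - Y j) * C.modelGrad N (X j) Θ i := by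
  have hd : ∀ j, HasFDerivAt (fun Θ => (C.model N Θ (X j) - Y j) ^ 2)
      ((2 * (C.model N Θ (X j) - Y j)) • fderiv ℝ (fun Θ => C.model N Θ (X j)) Θ) Θ := fun j => by
    have := (((C.shiftRule_model N (X j)).differentiable Θ).hasFDerivAt.sub_const (Y j)).pow 2
    simpa using this
  have h := (HasFDerivAt.fun_sum fun j (_ : j ∈ Finset.univ) => hd j).const_mul
    (1 / (2 * (n : ℝ)))
  rw [partialDeriv, HasFDerivAt.fderiv (f := C.loss N X Y) h]
  simp only [smul_apply, sum_apply, smul_eq_mul,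
    Finset.mul_sum]
  refine Finset.sum_congr rfl fun j _ => ?_
  have : C.modelGrad N (X j) Θ i = fderiv ℝ (fun Θ => C.model N Θ (X j)) Θ (Pi.single i 1) := rfl
  rw [this]
  ring

/-- Unrolling the recursion, an iterate is a function of the initialization and of the earlier
estimates. -/
lemma measurable_iterate_history (η : ℝ) (Θ₀ : Ω → C.Params) (g : ℕ → C.Params → Ω → C.Params)
    (t s : ℕ) (h : s ≤ t) : Measurable[C.history η Θ₀ g t] (C.iterate η Θ₀ g s) := by
  induction s with
  | zero => exact (comap_measurable Θ₀).mono le_sup_left le_rfl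
  | succ s ih =>
    have h1 : Measurable[C.history η Θ₀ g t] fun ω => g s (C.iterate η Θ₀ g s ω) ω :=
      (comap_measurable _).mono ((le_iSup₂_of_le (f := fun k (_ : k < t) =>
        MeasurableSpace.comap (fun ω => g k (C.iterate η Θ₀ g k ω) ω) inferInstance) s h
        le_rfl).trans le_sup_right) le_rfl
    exact (ih (Nat.le_of_succ_le h)).sub (h1.const_smul η)

section Training

variable {N : ℝ} {n : ℕ} {X : Fin n → 𝒳} {Y : Fin n → ℝ} {η : ℝ} {T : ℕ} [mΩ : MeasurableSpace Ω]
  {P : Measure Ω} {Θ₀ : Ω → C.Params} {g : ℕ → C.Params → Ω → C.Params}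

variable {C}

lemma IsNoisyTraining.history_le (h : C.IsNoisyTraining N X Y η T P Θ₀ g) {t : ℕ} (ht : t ≤ T) :
    C.history η Θ₀ g t ≤ mΩ :=
  sup_le h.measurable_init.comap_le (iSup₂_le fun k hk =>
    (h.measurable_grad k (hk.le.trans ht)).comap_le)

lemma IsNoisyTraining.measurable_iterate (h : C.IsNoisyTraining N X Y η T P Θ₀ g) {t : ℕ}
    (ht : t ≤ T) : Measurable (C.iterate η Θ₀ g t) :=
  (C.measurable_iterate_history η Θ₀ g t t le_rfl).mono (h.history_le ht) le_rfl

lemma IsNoisyTraining.measurable_model (h : C.IsNoisyTraining N X Y η T P Θ₀ g) {t : ℕ}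
    (ht : t ≤ T) (x : 𝒳) : Measurable fun ω => C.model N (C.iterate η Θ₀ g t ω) x :=
  (C.continuous_model N x).measurable.comp (h.measurable_iterate ht)

variable (C) in
/-- The deviation of the estimate from the gradient of the loss at time `t`. -/
def noise (N : ℝ) (X : Fin n → 𝒳) (Y : Fin n → ℝ) (η : ℝ) (Θ₀ : Ω → C.Params)
    (g : ℕ → C.Params → Ω → C.Params) (t : ℕ) (ω : Ω) : C.Params :=
  fun i => g t (C.iterate η Θ₀ g t ω) ω i -
    partialDeriv (C.loss N X Y) i (C.iterate η Θ₀ g t ω)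

/-- The variance bound is proportional to the loss, whose expectation is not controlled uniformly in
`m`. The weight `(1 + loss)⁻¹` depends only on the past, and it turns the loss into `loss / (1 +
loss) ≤ 1`. -/
lemma IsNoisyTraining.integral_noise_sq_le [IsProbabilityMeasure P]
    (h : C.IsNoisyTraining N X Y η T P Θ₀ g) {t : ℕ} (ht : t ≤ T) {i : Fin C.depth × Fin m} {K : ℝ}
    (hK : 0 ≤ K) (hv : condVar (C.history η Θ₀ g t)
      (fun ω => g t (C.iterate η Θ₀ g t ω) ω i) P
        ≤ᵐ[P] fun ω => K * C.loss N X Y (C.iterate η Θ₀ g t ω)) :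
    Integrable (fun ω => (1 + C.loss N X Y (C.iterate η Θ₀ g t ω))⁻¹ *
      C.noise N X Y η Θ₀ g t ω i ^ 2) P ∧
    ∫ ω, (1 + C.loss N X Y (C.iterate η Θ₀ g t ω))⁻¹ *
      C.noise N X Y η Θ₀ g t ω i ^ 2 ∂P ≤ K := by
  set Z := fun ω => g t (C.iterate η Θ₀ g t ω) ω i with hZ
  set w := fun ω => (1 + C.loss N X Y (C.iterate η Θ₀ g t ω))⁻¹ with hw
  have hl : ∀ ω, 0 ≤ C.loss N X Y (C.iterate η Θ₀ g t ω) := fun ω => C.loss_nonneg N X Y _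
  have hw0 : ∀ ω, 0 ≤ w ω := fun ω => inv_nonneg.2 (by linarith [hl ω])
  have hw1 : ∀ ω, ‖w ω‖ ≤ 1 := fun ω => by
    rw [Real.norm_of_nonneg (hw0 ω)]
    exact inv_le_one_of_one_le₀ (by linarith [hl ω])
  have hmw : Measurable[C.history η Θ₀ g t] w :=
    ((continuous_const.add (C.continuous_loss N X Y)).measurable.inv).comp
      (C.measurable_iterate_history η Θ₀ g t t le_rfl)
  have hle := h.history_le ht
  have hcongr : ∀ᵐ ω ∂P, w ω * (Z ω - (P[Z | C.history η Θ₀ g t]) ω) ^ 2 =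
      w ω * C.noise N X Y η Θ₀ g t ω i ^ 2 := by
    filter_upwards [h.unbiased t ht i] with ω hω
    rw [hω, noise]
  have hsq : Integrable (fun ω => (Z ω - (P[Z | C.history η Θ₀ g t]) ω) ^ 2) P :=
    ((h.memLp_grad t ht i).sub ((h.memLp_grad t ht i).condExp one_le_two)).integrable_sq
  have hwm : AEStronglyMeasurable w P := (hmw.mono hle le_rfl).aestronglyMeasurable
  constructor
  · exact (hsq.bdd_mul hwm (ae_of_all _ hw1)).congr hcongr
  · rw [← integral_congr_ae hcongr, integral_mul_sq_sub_condExp hle (h.memLp_grad t ht i)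
      hmw.stronglyMeasurable hw1]
    have hint : Integrable (fun ω => w ω * condVar (C.history η Θ₀ g t) Z P ω) P :=
      integrable_condVar.bdd_mul hwm (ae_of_all _ hw1)
    calc _ ≤ ∫ _, K ∂P := by
          refine integral_mono_ae hint (integrable_const _) ?_
          filter_upwards [hv] with ω hω
          refine (mul_le_mul_of_nonneg_left hω (hw0 ω)).trans ?_
          have h1 : 0 < 1 + C.loss N X Y (C.iterate η Θ₀ g t ω) := by linarith [hl ω]
          simp only [hw]
          rw [inv_mul_le_iff₀ h1]
          nlinarith [hl ω]
      _ = K := by simp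

end Training

end Circuit

end QNN

end

/-! ### Linearization of training -/

open MeasureTheory ProbabilityTheory Filter Topology

noncomputable section

namespace QNN

lemma l2_sub_le {ι : Type*} [Fintype ι] (v w : ι → ℝ) : l2 (v - w) ≤ l2 v + l2 w := by
  have h := l2_add_le v ((-1 : ℝ) • w)
  rw [l2_smul, abs_neg, abs_one, one_mul, neg_one_smul, ← sub_eq_add_neg] at h
  exact h

/-- Bilinear expansion, each gradient being Lipschitz. One factor of curvature stands in front, so
that the bound is a vanishing sequence times one that is bounded in probability. -/
lemma Circuit.abs_empiricalNTK_sub_le {𝒳 : Type*} {m : ℕ} (C : Circuit 𝒳 m) (N NK : ℝ)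
    (Θ Θ' : C.Params) (x x' : 𝒳) :
    |C.empiricalNTK N NK Θ' x x' - C.empiricalNTK N NK Θ x x'| ≤
      C.curvature N * (l2 (Θ' - Θ) * (|1 / NK * l2 (C.modelGrad N x' Θ)| +
        |1 / NK| * (C.curvature N * l2 (Θ' - Θ)) + |1 / NK * l2 (C.modelGrad N x Θ)|)) := by
  set v := C.modelGrad N x Θ
  set v' := C.modelGrad N x Θ'
  set w := C.modelGrad N x' Θ
  set w' := C.modelGrad N x' Θ'
  have hv : l2 (v' - v) ≤ C.curvature N * l2 (Θ' - Θ) := C.l2_modelGrad_sub_le N x Θ Θ'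
  have hw : l2 (w' - w) ≤ C.curvature N * l2 (Θ' - Θ) := C.l2_modelGrad_sub_le N x' Θ Θ'
  have hH := C.curvature_nonneg N
  have e : C.empiricalNTK N NK Θ' x x' - C.empiricalNTK N NK Θ x x' =
      1 / NK * (∑ i, (v' - v) i * w i + ∑ i, (v' - v) i * (w' - w) i + ∑ i, v i * (w' - w) i) := by
    rw [C.empiricalNTK_eq, C.empiricalNTK_eq, ← mul_sub, ← Finset.sum_sub_distrib,
      ← Finset.sum_add_distrib, ← Finset.sum_add_distrib]
    congr 1
    refine Finset.sum_congr rfl fun i _ => ?_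
    simp only [Pi.sub_apply]
    ring
  have hl : ∀ u : C.Params, 0 ≤ l2 u := fun u => l2_nonneg u
  rw [e, abs_mul, abs_mul, abs_mul (1 / NK), abs_of_nonneg (hl w), abs_of_nonneg (hl v)]
  calc _ ≤ |1 / NK| * (C.curvature N * l2 (Θ' - Θ) * l2 w +
        C.curvature N * l2 (Θ' - Θ) * (C.curvature N * l2 (Θ' - Θ)) +
        l2 v * (C.curvature N * l2 (Θ' - Θ))) := by
        refine mul_le_mul_of_nonneg_left ?_ (abs_nonneg _)
        refine (abs_add_three _ _ _).trans (add_le_add (add_le_add ?_ ?_) ?_)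
        · exact (abs_sum_mul_le_l2 _ _).trans (mul_le_mul_of_nonneg_right hv (hl _))
        · exact (abs_sum_mul_le_l2 _ _).trans (mul_le_mul hv hw (hl _) (mul_nonneg hH (hl _)))
        · exact (abs_sum_mul_le_l2 _ _).trans (mul_le_mul_of_nonneg_left hw (hl _))
    _ = _ := by ring

/-- One step of linearized training with the kernel `Kbar`. -/
def linStep {𝒳 : Type*} (Kbar : 𝒳 → 𝒳 → ℝ) {n : ℕ} (X : Fin n → 𝒳) (Y : Fin n → ℝ) (η₀ : ℝ)
    (z : 𝒳 → ℝ) (x : 𝒳) : ℝ :=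
  z x - η₀ * ∑ j, Kbar x (X j) * (z (X j) - Y j)

variable {𝒳 : Type*} {Ω : ℕ → Type*} [∀ m, MeasurableSpace (Ω m)]

/-- Noisy gradient descent with parameters `Θ t` and noise `ξ t` for a sequence of circuits, in a
regime in which the neural tangent kernel is constant in the limit. -/
structure LazyDescent (C : (m : ℕ) → Circuit 𝒳 m) (N NK : ℕ → ℝ) {n : ℕ} (X : Fin n → 𝒳)
    (Y : Fin n → ℝ) (Kbar : 𝒳 → 𝒳 → ℝ) (η₀ : ℝ) (T : ℕ) (P : (m : ℕ) → Measure (Ω m))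
    (Θ ξ : ℕ → (p : Σ m, Ω m) → (C p.1).Params) : Prop where
  pos : 0 < n
  apply_comm : ∀ x x', Kbar x x' = Kbar x' x
  tendsto_inv : Tendsto (fun m => |1 / N m|) atTop (𝓝 0)
  tendsto_curvature : Tendsto (fun m => (C m).curvature (N m)) atTop (𝓝 0)
  normalization : ∃ c, ∀ᶠ m in atTop, |1 / NK m| ≤ c
  one_le_size : ∀ᶠ m in atTop, (1 : ℝ) ≤ (C m).maxFuture * ((C m).depth * m : ℕ)
  step : ∀ t p, Θ (t + 1) p = Θ t p - (n / NK p.1 * η₀) •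
    (fun i => partialDeriv ((C p.1).loss (N p.1) X Y) i (Θ t p)) - (n / NK p.1 * η₀) • ξ t p
  init_model : ∀ x, BoundedInProb P fun p => (C p.1).model (N p.1) (Θ 0 p) x
  init_kernel : ∀ x x', Tendsto (fun p => (C p.1).empiricalNTK (N p.1) (NK p.1) (Θ 0 p) x x')
    (aas P) (𝓝 (Kbar x x'))
  noise : ∀ t < T, BoundedInProb P fun p => (1 + (C p.1).loss (N p.1) X Y (Θ t p))⁻¹ *
    (((C p.1).maxFuture * ((C p.1).depth * p.1 : ℕ)) * l2 ((n / NK p.1 * η₀) • ξ t p)) ^ 2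

namespace LazyDescent

variable {C : (m : ℕ) → Circuit 𝒳 m} {N NK : ℕ → ℝ} {n : ℕ} {X : Fin n → 𝒳}
  {Y : Fin n → ℝ} {Kbar : 𝒳 → 𝒳 → ℝ} {η₀ : ℝ} {T : ℕ} {P : (m : ℕ) → Measure (Ω m)}
  {Θ ξ : ℕ → (p : Σ m, Ω m) → (C p.1).Params}

lemma boundedInProb_inv (h : LazyDescent C N NK X Y Kbar η₀ T P Θ ξ) :
    BoundedInProb P fun p => |1 / NK p.1| := by
  obtain ⟨c, hc⟩ := h.normalization
  exact BoundedInProb.of_eventually_le (a := fun m => |1 / NK m|) (c := c) (by simpa using hc)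

/-- The norm is at most one plus its square, and the square divided by `NK` is the diagonal of the
kernel. -/
lemma boundedInProb_grad (h : LazyDescent C N NK X Y Kbar η₀ T P Θ ξ) {t : ℕ} {x : 𝒳} {a : ℝ}
    (ht : Tendsto (fun p => (C p.1).empiricalNTK (N p.1) (NK p.1) (Θ t p) x x) (aas P) (𝓝 a)) :
    BoundedInProb P fun p => |1 / NK p.1 * l2 ((C p.1).modelGrad (N p.1) x (Θ t p))| := by
  refine (h.boundedInProb_inv.add (BoundedInProb.of_tendsto ht).abs).mono (.of_forall fun p => ?_)
  rw [abs_abs, abs_of_nonneg (by positivity : 0 ≤ |1 / NK p.1| + _), Circuit.empiricalNTK_self,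
    abs_mul, abs_mul, abs_of_nonneg (l2_nonneg _), abs_of_nonneg (sq_nonneg (l2 _))]
  nlinarith [sq_nonneg (l2 ((C p.1).modelGrad (N p.1) x (Θ t p)) - 1), abs_nonneg (1 / NK p.1),
    l2_nonneg ((C p.1).modelGrad (N p.1) x (Θ t p))]

/-- Along parameters at a bounded distance from the initialization the kernel does not change. -/
lemma tendsto_kernel (h : LazyDescent C N NK X Y Kbar η₀ T P Θ ξ) {t : ℕ}
    (hD : BoundedInProb P fun p => l2 (Θ t p - Θ 0 p)) (x x' : 𝒳) :
    Tendsto (fun p => (C p.1).empiricalNTK (N p.1) (NK p.1) (Θ t p) x x')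
      (aas P) (𝓝 (Kbar x x')) := by
  have hH : Tendsto (fun p : Σ m, Ω m => (C p.1).curvature (N p.1)) (aas P) (𝓝 0) :=
    h.tendsto_curvature.comp tendsto_fst_aas
  have hb := hD.mul (((h.boundedInProb_grad (h.init_kernel x' x')).add (h.boundedInProb_inv.mul
    ((BoundedInProb.of_tendsto hH).mul hD))).add (h.boundedInProb_grad (h.init_kernel x x)))
  have h0 := squeeze_zero_norm (f := fun p : Σ m, Ω m =>
    (C p.1).empiricalNTK (N p.1) (NK p.1) (Θ t p) x x' -
      (C p.1).empiricalNTK (N p.1) (NK p.1) (Θ 0 p) x x') (fun p => (C p.1).abs_empiricalNTK_sub_le (N p.1) (NK p.1)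
    (Θ 0 p) (Θ t p) x x') (hb _ hH)
  simpa using h0.add (h.init_kernel x x')

lemma boundedInProb_loss {t : ℕ}
    (hf : ∀ x, BoundedInProb P fun p => (C p.1).model (N p.1) (Θ t p) x) :
    BoundedInProb P fun p => 1 + (C p.1).loss (N p.1) X Y (Θ t p) := by
  have h1 : ∀ j, BoundedInProb P fun p => (C p.1).model (N p.1) (Θ t p) (X j) - Y j := fun j => by
    simpa only [sub_eq_add_neg] using (hf (X j)).add (BoundedInProb.const (-Y j))
  refine (BoundedInProb.const 1).add ((BoundedInProb.const (1 / (2 * (n : ℝ)))).mul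
    (BoundedInProb.sum fun j _ => ?_))
  simpa only [sq] using (h1 j).mul (h1 j)

lemma boundedInProb_iterate_linStep (h : LazyDescent C N NK X Y Kbar η₀ T P Θ ξ) (t : ℕ) (x : 𝒳) :
    BoundedInProb P fun p =>
      (linStep Kbar X Y η₀)^[t] (fun x => (C p.1).model (N p.1) (Θ 0 p) x) x := by
  induction t generalizing x with
  | zero => exact h.init_model x
  | succ t ih =>
    simp only [Function.iterate_succ_apply', linStep, sub_eq_add_neg, ← neg_mul]
    exact (ih x).add ((BoundedInProb.const (-η₀)).mul (BoundedInProb.sum fun j _ =>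
      (BoundedInProb.const _).mul ((ih (X j)).add (BoundedInProb.const (-Y j)))))

/-- The factor `n` in the learning rate cancels the average in the loss. -/
lemma gradient_eq (h : LazyDescent C N NK X Y Kbar η₀ T P Θ ξ) (t : ℕ) (p : Σ m, Ω m) :
    ((n / NK p.1 * η₀) • fun i => partialDeriv ((C p.1).loss (N p.1) X Y) i (Θ t p)) =
      ∑ j, (1 / NK p.1 * (η₀ * ((C p.1).model (N p.1) (Θ t p) (X j) - Y j))) •
        (C p.1).modelGrad (N p.1) (X j) (Θ t p) := by
  have hn : (n : ℝ) ≠ 0 := by exact_mod_cast h.pos.ne'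
  ext i
  rw [Pi.smul_apply, Circuit.partialDeriv_loss, Finset.sum_apply, smul_eq_mul, ← mul_assoc,
    Finset.mul_sum]
  refine Finset.sum_congr rfl fun j _ => ?_
  rw [Pi.smul_apply, smul_eq_mul]
  field_simp

lemma boundedInProb_gradient (h : LazyDescent C N NK X Y Kbar η₀ T P Θ ξ) {t : ℕ}
    (hD : BoundedInProb P fun p => l2 (Θ t p - Θ 0 p))
    (hf : ∀ x, BoundedInProb P fun p => (C p.1).model (N p.1) (Θ t p) x) :
    BoundedInProb P fun p => l2 ((n / NK p.1 * η₀) •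
      fun i => partialDeriv ((C p.1).loss (N p.1) X Y) i (Θ t p)) := by
  refine (BoundedInProb.sum (s := Finset.univ) fun j _ => ((BoundedInProb.const η₀).mul
    ((hf (X j)).add (BoundedInProb.const (-Y j)))).abs.mul
    (h.boundedInProb_grad (h.tendsto_kernel hD (X j) (X j)))).mono (.of_forall fun p => ?_)
  rw [abs_of_nonneg (l2_nonneg _), h.gradient_eq]
  refine ((l2_sum_le _).trans (Finset.sum_le_sum fun j _ => ?_)).trans (le_abs_self _)
  rw [l2_smul, abs_mul, abs_mul (1 / NK p.1) (l2 _), abs_of_nonneg (l2_nonneg _), sub_eq_add_neg]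
  exact le_of_eq (by ring)

/-- The weight in the noise estimate is removed by multiplying with `1 + loss`, which is bounded in
probability because the model is. -/
lemma boundedInProb_scaled_noise (h : LazyDescent C N NK X Y Kbar η₀ T P Θ ξ) {t : ℕ} (ht : t < T)
    (hf : ∀ x, BoundedInProb P fun p => (C p.1).model (N p.1) (Θ t p) x) :
    BoundedInProb P fun p => ((C p.1).maxFuture * ((C p.1).depth * p.1 : ℕ)) *
      l2 ((n / NK p.1 * η₀) • ξ t p) := by
  refine BoundedInProb.of_sq (((h.noise t ht).mul
    (boundedInProb_loss (X := X) (Y := Y) hf)).mono (.of_forall fun p => le_of_eq ?_))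
  have : 0 < 1 + (C p.1).loss (N p.1) X Y (Θ t p) := by
    linarith [(C p.1).loss_nonneg (N p.1) X Y (Θ t p)]
  congr 1
  field_simp

lemma boundedInProb_noise (h : LazyDescent C N NK X Y Kbar η₀ T P Θ ξ) {t : ℕ} (ht : t < T)
    (hf : ∀ x, BoundedInProb P fun p => (C p.1).model (N p.1) (Θ t p) x) :
    BoundedInProb P fun p => l2 ((n / NK p.1 * η₀) • ξ t p) := by
  refine (h.boundedInProb_scaled_noise ht hf).mono
    (tendsto_fst_aas.eventually h.one_le_size |>.mono fun p hp => ?_)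
  rw [abs_mul, abs_of_nonneg (by linarith : (0 : ℝ) ≤ _ * _)]
  exact le_mul_of_one_le_left (abs_nonneg _) hp

/-- The gradient has norm at most `2 |ℳ| |Θ| / N`. The scaled noise absorbs `|ℳ| |Θ|`, and the
factor `1 / N` remains. -/
lemma tendsto_noise_contribution (h : LazyDescent C N NK X Y Kbar η₀ T P Θ ξ) {t : ℕ} (ht : t < T)
    (hf : ∀ x, BoundedInProb P fun p => (C p.1).model (N p.1) (Θ t p) x) (x : 𝒳) :
    Tendsto (fun p => ∑ i, ((n / NK p.1 * η₀) • ξ t p) i * (C p.1).modelGrad (N p.1) x (Θ t p) i)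
      (aas P) (𝓝 0) := by
  have h0 := ((BoundedInProb.const 2).mul (h.boundedInProb_scaled_noise ht hf)) _
    (h.tendsto_inv.comp tendsto_fst_aas)
  refine squeeze_zero_norm (fun p => ?_) h0
  refine (abs_sum_mul_le_l2 _ _).trans ((mul_le_mul_of_nonneg_left
    ((C p.1).l2_modelGrad_le (N p.1) x (Θ t p)) (l2_nonneg _)).trans_eq ?_)
  simp only [Function.comp_apply]
  ring

/-- The evolution of the model in one step of training. -/
lemma tendsto_model_step (h : LazyDescent C N NK X Y Kbar η₀ T P Θ ξ) {t : ℕ} (ht : t < T)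
    (hD : BoundedInProb P fun p => l2 (Θ t p - Θ 0 p))
    (hf : ∀ x, BoundedInProb P fun p => (C p.1).model (N p.1) (Θ t p) x) (x : 𝒳) :
    Tendsto (fun p => (C p.1).model (N p.1) (Θ (t + 1) p) x -
      linStep Kbar X Y η₀ (fun x => (C p.1).model (N p.1) (Θ t p) x) x) (aas P) (𝓝 0) := by
  set d : (p : Σ m, Ω m) → (C p.1).Params := fun p =>
    (n / NK p.1 * η₀) • fun i => partialDeriv ((C p.1).loss (N p.1) X Y) i (Θ t p) with hd
  set e : (p : Σ m, Ω m) → (C p.1).Params := fun p => (n / NK p.1 * η₀) • ξ t p with he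
  have hstep : ∀ p, Θ (t + 1) p = Θ t p + (-(d p + e p)) := fun p => by
    rw [h.step t p]
    simp only [hd, he]
    abel
  have hΔ : BoundedInProb P fun p => l2 (-(d p + e p)) := by
    refine ((h.boundedInProb_gradient hD hf).add (h.boundedInProb_noise ht hf)).mono
      (.of_forall fun p => ?_)
    rw [abs_of_nonneg (l2_nonneg _)]
    refine le_trans ?_ (le_abs_self _)
    rw [← neg_one_smul ℝ (d p + e p), l2_smul, abs_neg, abs_one, one_mul]
    exact l2_add_le _ _
  have hH : Tendsto (fun p : Σ m, Ω m => (C p.1).curvature (N p.1)) (aas P) (𝓝 0) :=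
    h.tendsto_curvature.comp tendsto_fst_aas
  -- The Taylor remainder: a vanishing curvature times the square of a step bounded in probability.
  have h1 : Tendsto (fun p => (C p.1).model (N p.1) (Θ (t + 1) p) x -
      (C p.1).model (N p.1) (Θ t p) x - ∑ i, (-(d p + e p)) i *
        (C p.1).modelGrad (N p.1) x (Θ t p) i) (aas P) (𝓝 0) := by
    refine squeeze_zero_norm (fun p => ?_) ((hΔ.mul hΔ) _ hH)
    rw [hstep p]
    simp only [← sq]
    exact (C p.1).abs_model_taylor_le (N p.1) x (Θ t p) _
  have h2 := h.tendsto_noise_contribution ht hf x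
  have h3 : ∀ j, Tendsto (fun p => (C p.1).empiricalNTK (N p.1) (NK p.1) (Θ t p) (X j) x -
      Kbar (X j) x) (aas P) (𝓝 0) := fun j => by
    simpa using (h.tendsto_kernel hD (X j) x).sub_const (Kbar (X j) x)
  -- The empirical kernel may be replaced by its limit because the residuals are bounded in
  -- probability.
  have h4 : Tendsto (fun p => ∑ j, ((C p.1).empiricalNTK (N p.1) (NK p.1) (Θ t p) (X j) x -
      Kbar (X j) x) * ((C p.1).model (N p.1) (Θ t p) (X j) + -Y j)) (aas P) (𝓝 0) := by
    simpa using tendsto_finsetSum Finset.univ fun j _ =>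
      ((hf (X j)).add (BoundedInProb.const (-Y j))) _ (h3 j)
  have h5 := (h1.sub h2).sub (h4.const_mul η₀)
  rw [mul_zero, sub_zero, sub_zero] at h5
  refine h5.congr fun p => ?_
  have h6 : ∑ i, (-(d p + e p)) i * (C p.1).modelGrad (N p.1) x (Θ t p) i =
      -∑ i, d p i * (C p.1).modelGrad (N p.1) x (Θ t p) i -
        ∑ i, e p i * (C p.1).modelGrad (N p.1) x (Θ t p) i := by
    rw [← Finset.sum_neg_distrib, ← Finset.sum_sub_distrib]
    refine Finset.sum_congr rfl fun i _ => ?_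
    simp only [Pi.neg_apply, Pi.add_apply]
    ring
  have h7 : ∑ i, d p i * (C p.1).modelGrad (N p.1) x (Θ t p) i =
      η₀ * ∑ j, (C p.1).empiricalNTK (N p.1) (NK p.1) (Θ t p) (X j) x *
        ((C p.1).model (N p.1) (Θ t p) (X j) + -Y j) := by
    simp only [hd, h.gradient_eq, Finset.sum_apply, Pi.smul_apply, smul_eq_mul, Finset.sum_mul]
    rw [Finset.sum_comm, Finset.mul_sum]
    refine Finset.sum_congr rfl fun j _ => ?_
    rw [Circuit.empiricalNTK_eq, Finset.mul_sum, Finset.sum_mul, Finset.mul_sum]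
    exact Finset.sum_congr rfl fun i _ => by ring
  have h8 : ∑ j, ((C p.1).empiricalNTK (N p.1) (NK p.1) (Θ t p) (X j) x - Kbar (X j) x) *
      ((C p.1).model (N p.1) (Θ t p) (X j) + -Y j) =
      ∑ j, (C p.1).empiricalNTK (N p.1) (NK p.1) (Θ t p) (X j) x *
        ((C p.1).model (N p.1) (Θ t p) (X j) + -Y j) -
      ∑ j, Kbar x (X j) * ((C p.1).model (N p.1) (Θ t p) (X j) - Y j) := by
    rw [← Finset.sum_sub_distrib]
    refine Finset.sum_congr rfl fun j _ => ?_
    rw [h.apply_comm x (X j)]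
    ring
  rw [h6, h7, h8, linStep]
  ring

lemma tendsto_linStep_sub {F G : 𝒳 → (Σ m, Ω m) → ℝ}
    (h : ∀ x, Tendsto (fun p => F x p - G x p) (aas P) (𝓝 0)) (x : 𝒳) :
    Tendsto (fun p => linStep Kbar X Y η₀ (fun x => F x p) x -
      linStep Kbar X Y η₀ (fun x => G x p) x) (aas P) (𝓝 0) := by
  have h1 := tendsto_finsetSum (Finset.univ : Finset (Fin n)) fun j _ =>
    (h (X j)).const_mul (Kbar x (X j))
  have h2 := (h x).sub (h1.const_mul η₀)
  simp only [mul_zero, Finset.sum_const_zero, sub_zero] at h2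
  refine h2.congr fun p => ?_
  simp only [linStep, mul_sub, Finset.sum_sub_distrib]
  ring

/-- During training the model follows linearized training, and the parameters stay at a bounded
distance from their initialization. -/
theorem linearization (h : LazyDescent C N NK X Y Kbar η₀ T P Θ ξ) {t : ℕ} (ht : t ≤ T) :
    BoundedInProb P (fun p => l2 (Θ t p - Θ 0 p)) ∧
    ∀ x, Tendsto (fun p => (C p.1).model (N p.1) (Θ t p) x -
      (linStep Kbar X Y η₀)^[t] (fun x => (C p.1).model (N p.1) (Θ 0 p) x) x) (aas P) (𝓝 0) := by
  induction t with
  | zero =>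
    refine ⟨(BoundedInProb.const 0).mono (.of_forall fun p => ?_), fun x => by simp [tendsto_const_nhds]⟩
    have := l2_smul (0 : ℝ) (0 : (C p.1).Params)
    rw [abs_zero, zero_mul, smul_zero] at this
    rw [sub_self, this]
  | succ t ih =>
    obtain ⟨hD, hlin⟩ := ih (Nat.le_of_succ_le ht)
    -- Linearized training is bounded in probability at each fixed time and the difference vanishes.
    -- No contraction is involved, so `η₀` need not be small.
    have hf : ∀ x, BoundedInProb P fun p => (C p.1).model (N p.1) (Θ t p) x := fun x => by
      simpa using (BoundedInProb.of_tendsto (hlin x)).add (h.boundedInProb_iterate_linStep t x)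
    constructor
    · refine ((hD.add (h.boundedInProb_gradient hD hf)).add (h.boundedInProb_noise ht hf)).mono
        (.of_forall fun p => ?_)
      rw [abs_of_nonneg (l2_nonneg _), h.step t p, sub_right_comm, sub_right_comm (Θ t p)]
      refine le_trans ?_ (le_abs_self _)
      exact (l2_sub_le _ _).trans (add_le_add (l2_sub_le _ _) le_rfl)
    · intro x
      simp only [Function.iterate_succ_apply']
      simpa using (h.tendsto_model_step ht hD hf x).add (tendsto_linStep_sub (Kbar := Kbar)
        (X := X) (Y := Y) (η₀ := η₀) hlin x)

end LazyDescent

end QNN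

end

open MeasureTheory ProbabilityTheory Filter Topology

noncomputable section

namespace QNN

/-! ### Closed form of linearized training -/

section Dynamics

variable {𝒳 : Type*} {Kbar : 𝒳 → 𝒳 → ℝ} {n : ℕ} {X : Fin n → 𝒳}

lemma gram_mul_inv_mul_evolution (hdet : IsUnit (gram Kbar X).det) (η₀ : ℝ) (t : ℕ) :
    gram Kbar X * ((gram Kbar X)⁻¹ * evolution Kbar X η₀ t) = 1 - (1 - η₀ • gram Kbar X) ^ t := by
  rw [← Matrix.mul_assoc, Matrix.mul_nonsing_inv _ hdet, Matrix.one_mul, evolution]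

/-- The increment of `evolution` is the Gram matrix times `η₀ (1 - η₀ K̄)^t`, so the inverse
cancels. -/
lemma inv_mul_evolution_succ (hdet : IsUnit (gram Kbar X).det) (η₀ : ℝ) (t : ℕ) :
    (gram Kbar X)⁻¹ * evolution Kbar X η₀ (t + 1) =
      (gram Kbar X)⁻¹ * evolution Kbar X η₀ t + η₀ • (1 - η₀ • gram Kbar X) ^ t := by
  have h : evolution Kbar X η₀ (t + 1) =
      evolution Kbar X η₀ t + gram Kbar X * (η₀ • (1 - η₀ • gram Kbar X) ^ t) := by
    rw [evolution, evolution, pow_succ', sub_mul, one_mul, Matrix.smul_mul, Matrix.mul_smul]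
    abel
  rw [h, Matrix.mul_add, ← Matrix.mul_assoc, Matrix.nonsing_inv_mul _ hdet, Matrix.one_mul]

/-- The solution of linearized training. -/
lemma iterate_linStep (hdet : IsUnit (gram Kbar X).det) (Y : Fin n → ℝ) (η₀ : ℝ) (t : ℕ)
    (z : 𝒳 → ℝ) (x : 𝒳) : (linStep Kbar X Y η₀)^[t] z x = z x - (fun j => Kbar x (X j)) ⬝ᵥ
      ((gram Kbar X)⁻¹ * evolution Kbar X η₀ t).mulVec fun j => z (X j) - Y j := by
  induction t generalizing x with
  | zero => simp [evolution]
  | succ t ih =>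
    set r := fun j => z (X j) - Y j
    -- On the training inputs the recursion closes: the residuals are multiplied by `1 - η₀ K̄` in
    -- each step.
    have hres : (fun j => (linStep Kbar X Y η₀)^[t] z (X j) - Y j) =
        ((1 - η₀ • gram Kbar X) ^ t).mulVec r := by
      ext i
      rw [ih (X i)]
      change z (X i) - (gram Kbar X).mulVec _ i - Y i = _
      rw [Matrix.mulVec_mulVec, gram_mul_inv_mul_evolution hdet, Matrix.sub_mulVec,
        Matrix.one_mulVec, Pi.sub_apply]
      simp only [r]
      ring
    rw [Function.iterate_succ_apply', linStep, ih x, inv_mul_evolution_succ hdet,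
      Matrix.add_mulVec, dotProduct_add, Matrix.smul_mulVec, dotProduct_smul, ← hres, smul_eq_mul,
      sub_sub]
    rfl

end Dynamics

/-! ### Gaussian limit at initialization -/

section Initialization

variable {𝒳 : Type*} {C : (m : ℕ) → Circuit 𝒳 m} {N : ℕ → ℝ} {Kcov : 𝒳 → 𝒳 → ℝ}

lemma Circuit.integrable_model_mul {m : ℕ} (C : Circuit 𝒳 m) (N : ℝ) (x x' : 𝒳) :
    Integrable (fun Θ => C.model N Θ x * C.model N Θ x') C.initLaw := by
  refine integrable_of_abs_le ((C.continuous_model N x).mul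
    (C.continuous_model N x')).aestronglyMeasurable (B := (|1 / N| * m) * (|1 / N| * m)) fun Θ => ?_
  rw [abs_mul]
  exact mul_le_mul (C.abs_model_le N Θ x) (C.abs_model_le N Θ x') (abs_nonneg _) (by positivity)

lemma InitAssumption.apply_comm (h : InitAssumption C N Kcov) (x x' : 𝒳) :
    Kcov x x' = Kcov x' x := by
  have h1 := h.cov_tendsto.tendsto_at (x, x')
  simp only [mul_comm ((C _).model (N _) _ x)] at h1
  exact tendsto_nhds_unique h1 (h.cov_tendsto.tendsto_at (x', x))

variable [Fintype 𝒳]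

lemma InitAssumption.tendsto_integral_sum_sq (h : InitAssumption C N Kcov) (a : 𝒳 → ℝ) :
    Tendsto (fun m => ∫ Θ, (∑ x, a x * (C m).model (N m) Θ x) ^ 2 ∂(C m).initLaw) atTop
      (𝓝 (∑ x, ∑ x', a x * a x' * Kcov x x')) := by
  have h1 : ∀ m, ∫ Θ, (∑ x, a x * (C m).model (N m) Θ x) ^ 2 ∂(C m).initLaw =
      ∑ x, ∑ x', a x * a x' *
        ∫ Θ, (C m).model (N m) Θ x * (C m).model (N m) Θ x' ∂(C m).initLaw := fun m => by
    have e : ∀ Θ, (∑ x, a x * (C m).model (N m) Θ x) ^ 2 = ∑ x, ∑ x', a x * a x' *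
        ((C m).model (N m) Θ x * (C m).model (N m) Θ x') := fun Θ => by
      rw [sq, Finset.sum_mul_sum]
      exact Finset.sum_congr rfl fun x _ => Finset.sum_congr rfl fun x' _ => by ring
    simp only [e]
    have hi := fun x x' => ((C m).integrable_model_mul (N m) x x').const_mul (a x * a x')
    rw [integral_finsetSum _ fun x _ => integrable_finsetSum _ fun x' _ => hi x x']
    refine Finset.sum_congr rfl fun x _ => ?_
    rw [integral_finsetSum _ fun x' _ => hi x x']
    exact Finset.sum_congr rfl fun x' _ => integral_const_mul _ _
  simp only [h1]
  exact tendsto_finsetSum _ fun x _ => tendsto_finsetSum _ fun x' _ =>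
    (h.cov_tendsto.tendsto_at (x, x')).const_mul _

/-- Its quadratic form is a limit of second moments of linear combinations of outputs. -/
lemma InitAssumption.posSemidef [DecidableEq 𝒳] (h : InitAssumption C N Kcov) :
    (Matrix.of Kcov).PosSemidef := by
  refine Matrix.PosSemidef.of_dotProduct_mulVec_nonneg ?_ fun a => ?_
  · ext x x'
    simp [h.apply_comm x x']
  · have e : star a ⬝ᵥ (Matrix.of Kcov).mulVec a = ∑ x, ∑ x', a x * a x' * Kcov x x' := by
      simp only [dotProduct, Matrix.mulVec, Pi.star_apply, star_trivial, Finset.mul_sum,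
        Matrix.of_apply]
      exact Finset.sum_congr rfl fun x _ => Finset.sum_congr rfl fun x' _ => by ring
    rw [e]
    exact ge_of_tendsto' (h.tendsto_integral_sum_sq a) fun m => integral_nonneg fun _ => sq_nonneg _

/-- The bound for the distance of the characteristic function of a linear combination of outputs
from that of a Gaussian. -/
lemma Circuit.norm_charFun_sub_le [Nonempty 𝒳] {m : ℕ} (C : Circuit 𝒳 m) {N : ℝ} (hN : 0 < N)
    (h0 : ∀ k x, ∫ Θ, C.localModel k Θ x ∂C.initLaw = 0) (a : 𝒳 → ℝ) :
    ‖∫ Θ, Complex.exp (Complex.I * ((∑ x, a x * C.model N Θ x : ℝ) : ℂ)) ∂C.initLaw -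
      Complex.exp (-(((∫ Θ, (∑ x, a x * C.model N Θ x) ^ 2 ∂C.initLaw : ℝ) : ℂ) / 2))‖ ≤
    √(Real.pi ^ 2 * 16 * (∑ x, |a x|) ^ 4 *
      (C.depth * m * (C.maxPast * C.maxFuture ^ 2) ^ 2 / N ^ 4)) +
    2 * (∑ x, |a x|) ^ 3 * (m * (C.maxPast * C.maxFuture) ^ 2 / N ^ 3) := by
  -- The family entering the central limit theorem: the local outputs combined over the inputs and
  -- divided by `N`, with the bound `(∑ x, |a x|) / N`.
  have hL := (LocalFamily.linearCombination (fun x => C.localFamily x) a ‹_›).const_mul (1 / N)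
  have hs : ∀ Θ, ∑ k, 1 / N * ∑ x, a x * C.localModel k Θ x = ∑ x, a x * C.model N Θ x := fun Θ => by
    simp only [Circuit.model, Finset.mul_sum]
    rw [Finset.sum_comm]
    exact Finset.sum_congr rfl fun x _ => Finset.sum_congr rfl fun k _ => by ring
  have hz : ∀ k, ∫ Θ, 1 / N * ∑ x, a x * C.localModel k Θ x ∂unifPi _ = 0 := fun k => by
    have hi : ∀ x, Integrable (fun Θ => a x * C.localModel k Θ x) C.initLaw := fun x =>
      (integrable_of_abs_le ((C.localFamily x).shiftRule k).continuous.aestronglyMeasurable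
        ((C.localFamily x).abs_le k)).const_mul _
    change ∫ Θ, 1 / N * ∑ x, a x * C.localModel k Θ x ∂C.initLaw = 0
    rw [integral_const_mul, integral_finsetSum _ fun x _ => hi x, Finset.sum_eq_zero, mul_zero]
    intro x _
    rw [integral_const_mul, h0 k x, mul_zero]
  have h := hL.norm_charFun_sub_le (by positivity) hz
  simp only [hs] at h
  refine h.trans_eq ?_
  rw [abs_of_pos (one_div_pos.2 hN), Fintype.card_prod, Fintype.card_fin, Fintype.card_fin]
  congr 1
  · congr 1
    push_cast
    field_simp
    ring
  · field_simp

/-- The central limit theorem for the model at initialization. -/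
lemma InitAssumption.tendsto_charFun [Nonempty 𝒳] (h : InitAssumption C N Kcov)
    (hN : Tendsto N atTop atTop) (hG : Growth C N) (a : 𝒳 → ℝ) :
    Tendsto (fun m => ∫ Θ, Complex.exp (Complex.I * ((∑ x, a x * (C m).model (N m) Θ x : ℝ) : ℂ))
      ∂(C m).initLaw) atTop
      (𝓝 (Complex.exp (-(((∑ x, ∑ x', a x * a x' * Kcov x x' : ℝ) : ℂ) / 2)))) := by
  obtain ⟨c, hc, hcN⟩ := h.eventually_mul_sq_le hN
  have h1 := tendsto_growth_of_variance hN hG hc hcN (h.eventually_one_le hN)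
  have h2 := tendsto_growth_of_stein hN hG (h.eventually_one_le hN)
  have h3 := ((Real.continuous_sqrt.tendsto _).comp
    (h1.const_mul (Real.pi ^ 2 * 16 * (∑ x, |a x|) ^ 4))).add (h2.const_mul (2 * (∑ x, |a x|) ^ 3))
  rw [mul_zero, mul_zero, Real.sqrt_zero, add_zero] at h3
  have h4 := squeeze_zero_norm' ((hN.eventually_gt_atTop 0).mono fun m hm =>
    (C m).norm_charFun_sub_le hm (fun k x => h.mean_zero m k x) a) h3
  have h5 : Tendsto (fun m => Complex.exp
      (-(((∫ Θ, (∑ x, a x * (C m).model (N m) Θ x) ^ 2 ∂(C m).initLaw : ℝ) : ℂ) / 2))) atTop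
      (𝓝 (Complex.exp (-(((∑ x, ∑ x', a x * a x' * Kcov x x' : ℝ) : ℂ) / 2)))) :=
    (Complex.continuous_exp.tendsto _).comp
      (((Complex.continuous_ofReal.tendsto _).comp (h.tendsto_integral_sum_sq a)).div_const 2).neg
  simpa using h4.add h5

end Initialization

end QNN

end

open MeasureTheory ProbabilityTheory Filter Topology

noncomputable section

namespace QNN

/-! ### Affine images of a centered Gaussian vector -/

section Gaussian

variable {𝒳 : Type*} {n : ℕ}

/-- The affine map `z ↦ z x - ∑ j, w x j (z (X j) - Y j)`. -/
def affineUpdate (w : 𝒳 → Fin n → ℝ) (X : Fin n → 𝒳) (Y : Fin n → ℝ) (z : 𝒳 → ℝ) (x : 𝒳) : ℝ :=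
  z x - w x ⬝ᵥ fun j => z (X j) - Y j

lemma continuous_affineUpdate (w : 𝒳 → Fin n → ℝ) (X : Fin n → 𝒳) (Y : Fin n → ℝ) :
    Continuous (affineUpdate w X Y) := by
  refine continuous_pi fun x => ?_
  simp only [affineUpdate, dotProduct]
  fun_prop

lemma affineUpdate_eq (w : 𝒳 → Fin n → ℝ) (X : Fin n → 𝒳) (Y : Fin n → ℝ) (z : 𝒳 → ℝ) (x : 𝒳) :
    affineUpdate w X Y z x = w x ⬝ᵥ Y + (z x - ∑ j, w x j * z (X j)) := by
  simp only [affineUpdate, dotProduct, mul_sub, Finset.sum_sub_distrib]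
  ring

variable [Fintype 𝒳] [DecidableEq 𝒳] {S : Matrix 𝒳 𝒳 ℝ} (w : 𝒳 → Fin n → ℝ) (X : Fin n → 𝒳) (Y : Fin n → ℝ)

/-- A translate of a continuous linear image of a Gaussian vector. -/
lemma isGaussianProcess_affineUpdate :
    IsGaussianProcess (fun x (z : EuclideanSpace ℝ 𝒳) => affineUpdate w X Y (WithLp.ofLp z) x)
      (multivariateGaussian 0 S) where
  hasGaussianLaw I := by
    let A : EuclideanSpace ℝ 𝒳 →L[ℝ] (I → ℝ) := ContinuousLinearMap.pi fun x =>
      EuclideanSpace.proj (x : 𝒳) - ∑ j, w x j • EuclideanSpace.proj (X j)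
    have h : (fun z : EuclideanSpace ℝ 𝒳 =>
        I.restrict fun x => affineUpdate w X Y (WithLp.ofLp z) x) =
        (fun v : I → ℝ => (fun x : I => w x ⬝ᵥ Y) + v) ∘ A := by
      ext z x
      simp [A, affineUpdate_eq]
    constructor
    rw [h, ← Measure.map_map (measurable_const_add _) A.continuous.measurable]
    infer_instance

lemma memLp_eval (x : 𝒳) : MemLp (fun z : EuclideanSpace ℝ 𝒳 => z x) 2 (multivariateGaussian 0 S) :=
  (IsGaussian.hasGaussianLaw_id.map_fun (EuclideanSpace.proj (𝕜 := ℝ) x)).memLp_two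

lemma integral_eval_multivariateGaussian (x : 𝒳) :
    ∫ z : EuclideanSpace ℝ 𝒳, z x ∂(multivariateGaussian 0 S) = 0 := by
  have h := (EuclideanSpace.proj x : EuclideanSpace ℝ 𝒳 →L[ℝ] ℝ).integral_comp_comm
    (IsGaussian.integrable_fun_id (μ := multivariateGaussian (0 : EuclideanSpace ℝ 𝒳) S))
  rw [integral_id_multivariateGaussian, map_zero] at h
  exact h

lemma memLp_sum_eval (x : 𝒳) : MemLp (fun z : EuclideanSpace ℝ 𝒳 => ∑ j, w x j * z (X j)) 2
    (multivariateGaussian 0 S) :=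
  memLp_finsetSum _ fun j _ => (memLp_eval (X j)).const_mul (w x j)

lemma integral_affineUpdate (x : 𝒳) :
    ∫ z : EuclideanSpace ℝ 𝒳, affineUpdate w X Y (WithLp.ofLp z) x ∂(multivariateGaussian 0 S) =
      w x ⬝ᵥ Y := by
  simp only [affineUpdate_eq]
  have h1 := (memLp_eval (S := S) x).integrable one_le_two
  have h2 := (memLp_sum_eval (S := S) w X x).integrable one_le_two
  have h3 : Integrable (fun z : EuclideanSpace ℝ 𝒳 => z x - ∑ j, w x j * z (X j))
    (multivariateGaussian 0 S) := h1.sub h2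
  rw [integral_add (integrable_const _) h3, integral_sub h1 h2,
    integral_eval_multivariateGaussian, integral_finsetSum _ fun j _ =>
      ((memLp_eval (S := S) (X j)).integrable one_le_two).const_mul (w x j)]
  simp [integral_const_mul, integral_eval_multivariateGaussian]

lemma covariance_affineUpdate (hS : S.PosSemidef) (x x' : 𝒳) :
    covariance (fun z : EuclideanSpace ℝ 𝒳 => affineUpdate w X Y (WithLp.ofLp z) x)
      (fun z => affineUpdate w X Y (WithLp.ofLp z) x') (multivariateGaussian 0 S) =
      S x x' - ∑ j, w x j * S (X j) x' - ∑ j, w x' j * S (X j) x +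
        ∑ i, ∑ j, w x i * w x' j * S (X i) (X j) := by
  simp only [affineUpdate_eq]
  have h1 := fun x => memLp_eval (S := S) x
  have h2 := fun x => memLp_sum_eval (S := S) w X x
  have h3 : ∀ x j, MemLp (fun z : EuclideanSpace ℝ 𝒳 => w x j * z (X j)) 2
      (multivariateGaussian 0 S) := fun x j => (h1 (X j)).const_mul _
  have hsym : ∀ x x', S x x' = S x' x := fun x x' => by
    simpa using (hS.isHermitian.apply x x').symm
  have h4 : ∀ x, Integrable (fun z : EuclideanSpace ℝ 𝒳 => z x - ∑ j, w x j * z (X j))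
    (multivariateGaussian 0 S) := fun x => ((h1 x).sub (h2 x)).integrable one_le_two
  rw [covariance_const_add_left (h4 x), covariance_const_add_right (h4 x'),
    covariance_fun_sub_fun_sub (h1 x) (h2 x) (h1 x') (h2 x'),
    covariance_eval_multivariateGaussian hS, covariance_fun_sum_right (h3 x') (h1 x),
    covariance_fun_sum_left (h3 x) (h1 x'), covariance_fun_sum_fun_sum (h3 x) (h3 x')]
  simp only [covariance_const_mul_left, covariance_const_mul_right,
    covariance_eval_multivariateGaussian hS]
  rw [sub_right_comm]
  congr 1
  · congr 1
    exact Finset.sum_congr rfl fun j _ => by rw [hsym x]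
  · exact Finset.sum_congr rfl fun i _ => Finset.sum_congr rfl fun j _ => by ring

end Gaussian

/-! ### Convergence in distribution from characteristic functions -/

section Levy

variable {𝒳 : Type*} [Fintype 𝒳] {Ω : ℕ → Type*} [∀ m, MeasurableSpace (Ω m)]
  {P : (m : ℕ) → Measure (Ω m)} [∀ m, IsProbabilityMeasure (P m)]

lemma charFun_map_toLp {Ω : Type*} [MeasurableSpace Ω] (P : Measure Ω) {F : 𝒳 → Ω → ℝ}
    (hF : ∀ x, Measurable (F x)) (a : EuclideanSpace ℝ 𝒳) :
    charFun (P.map fun ω => WithLp.toLp 2 fun x => F x ω) a =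
      ∫ ω, Complex.exp (Complex.I * ((∑ x, a x * F x ω : ℝ) : ℂ)) ∂P := by
  have hm : Measurable fun ω => WithLp.toLp 2 fun x => F x ω :=
    (PiLp.continuous_toLp 2 _).measurable.comp (measurable_pi_lambda _ hF)
  rw [charFun_apply, integral_map hm.aemeasurable (by fun_prop)]
  congr 1
  ext ω
  rw [mul_comm, PiLp.inner_apply]
  simp

/-- Lévy's continuity theorem in Euclidean space. -/
lemma tendstoInDistribution_of_charFun {F : 𝒳 → (Σ m, Ω m) → ℝ}
    (hF : ∀ x m, Measurable fun ω => F x ⟨m, ω⟩) {μ : Measure (EuclideanSpace ℝ 𝒳)}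
    [IsProbabilityMeasure μ]
    (h : ∀ a : EuclideanSpace ℝ 𝒳, Tendsto (fun m =>
      ∫ ω, Complex.exp (Complex.I * ((∑ x, a x * F x ⟨m, ω⟩ : ℝ) : ℂ)) ∂P m) atTop
      (𝓝 (charFun μ a))) :
    TendstoInDistribution (fun m ω => WithLp.toLp 2 fun x => F x ⟨m, ω⟩) atTop
      (fun z : EuclideanSpace ℝ 𝒳 => z) P μ where
  forall_aemeasurable m := ((PiLp.continuous_toLp 2 _).measurable.comp
    (measurable_pi_lambda _ fun x => hF x m)).aemeasurable
  aemeasurable_limit := aemeasurable_id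
  tendsto := by
    refine ProbabilityMeasure.tendsto_of_tendsto_charFun fun a => ?_
    simp only [ProbabilityMeasure.coe_mk, Measure.map_id']
    refine (h a).congr fun m => ?_
    exact (charFun_map_toLp (P m) (F := fun x ω => F x ⟨m, ω⟩) (fun x => hF x m) a).symm

lemma tendsto_charFun_of_tendstoInDistribution {F : 𝒳 → (Σ m, Ω m) → ℝ}
    (hF : ∀ x m, Measurable fun ω => F x ⟨m, ω⟩) {Ω' : Type*} [MeasurableSpace Ω'] {Q : Measure Ω'}
    [IsProbabilityMeasure Q] {Z : Ω' → EuclideanSpace ℝ 𝒳}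
    (h : TendstoInDistribution (fun m ω => WithLp.toLp 2 fun x => F x ⟨m, ω⟩) atTop Z P Q)
    (a : EuclideanSpace ℝ 𝒳) : Tendsto (fun m =>
      ∫ ω, Complex.exp (Complex.I * ((∑ x, a x * F x ⟨m, ω⟩ : ℝ) : ℂ)) ∂P m) atTop
      (𝓝 (charFun (Q.map Z) a)) := by
  refine (ProbabilityMeasure.tendsto_iff_tendsto_charFun.1 h.tendsto a).congr fun m => ?_
  exact charFun_map_toLp (P m) (F := fun x ω => F x ⟨m, ω⟩) (fun x => hF x m) a

/-- A perturbation which tends to zero in probability does not change the limit in distribution. -/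
lemma tendstoInDistribution_of_tendsto_sub {F G : 𝒳 → (Σ m, Ω m) → ℝ}
    (hF : ∀ x m, Measurable fun ω => F x ⟨m, ω⟩) (hG : ∀ x m, Measurable fun ω => G x ⟨m, ω⟩)
    (hFG : ∀ x, Tendsto (fun p => F x p - G x p) (aas P) (𝓝 0))
    {Ω' : Type*} [MeasurableSpace Ω'] {Q : Measure Ω'}
    [IsProbabilityMeasure Q] {Z : Ω' → EuclideanSpace ℝ 𝒳}
    (h : TendstoInDistribution (fun m ω => WithLp.toLp 2 fun x => G x ⟨m, ω⟩) atTop Z P Q) :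
    TendstoInDistribution (fun m ω => WithLp.toLp 2 fun x => F x ⟨m, ω⟩) atTop Z P Q where
  forall_aemeasurable m := ((PiLp.continuous_toLp 2 _).measurable.comp
    (measurable_pi_lambda _ fun x => hF x m)).aemeasurable
  aemeasurable_limit := h.aemeasurable_limit
  tendsto := by
    refine ProbabilityMeasure.tendsto_of_tendsto_charFun fun a => ?_
    have h1 := tendsto_charFun_of_tendstoInDistribution hG h a
    have h2 := tendsto_integral_cexp_sub (P := P) (u := fun p => ∑ x, a x * F x p)
      (v := fun p => ∑ x, a x * G x p)
      (fun m => Finset.measurable_fun_sum _ fun x _ => (hF x m).const_mul _)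
      (fun m => Finset.measurable_fun_sum _ fun x _ => (hG x m).const_mul _) (by
        have h3 := tendsto_finsetSum (Finset.univ : Finset 𝒳) fun x _ => (hFG x).const_mul (a x)
        simp only [mul_zero, Finset.sum_const_zero] at h3
        refine h3.congr fun p => ?_
        simp only [mul_sub, Finset.sum_sub_distrib])
    have h4 := h2.add h1
    simp only [sub_add_cancel, zero_add] at h4
    refine h4.congr fun m => ?_
    exact (charFun_map_toLp (P m) (F := fun x ω => F x ⟨m, ω⟩) (fun x => hF x m) a).symm

end Levy

end QNN

end

open MeasureTheory ProbabilityTheory Filter Topology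

noncomputable section

namespace QNN

open scoped Matrix

/-! ### The mean and the covariance of the limit -/

section Limit

variable {𝒳 : Type*} {Kcov Kbar : 𝒳 → 𝒳 → ℝ} {n : ℕ} {X : Fin n → 𝒳}

/-- The row vector `K̄(x, Xᵀ) K̄⁻¹ (1 - (1 - η₀ K̄)^t)`. -/
def evolutionRow (Kbar : 𝒳 → 𝒳 → ℝ) {n : ℕ} (X : Fin n → 𝒳) (η₀ : ℝ) (t : ℕ) (x : 𝒳) :
    Fin n → ℝ :=
  Matrix.vecMul (fun j => Kbar x (X j)) ((gram Kbar X)⁻¹ * evolution Kbar X η₀ t)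

lemma iterate_linStep_eq_affineUpdate (hdet : IsUnit (gram Kbar X).det) (Y : Fin n → ℝ) (η₀ : ℝ)
    (t : ℕ) (z : 𝒳 → ℝ) :
    (linStep Kbar X Y η₀)^[t] z = affineUpdate (evolutionRow Kbar X η₀ t) X Y z := by
  ext x
  rw [iterate_linStep hdet, affineUpdate, evolutionRow, Matrix.dotProduct_mulVec]

lemma meanLimit_eq (Y : Fin n → ℝ) (η₀ : ℝ) (t : ℕ) (x : 𝒳) :
    meanLimit Kbar X Y η₀ t x = evolutionRow Kbar X η₀ t x ⬝ᵥ Y := by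
  rw [meanLimit, evolutionRow, Matrix.dotProduct_mulVec]

/-- `K̄` and `A` are symmetric, so transposition turns `K̄⁻¹ A` into `A K̄⁻¹`, and the vector on the
right of the last term is the evolution row at `x'`. -/
lemma covLimit_eq (hsym : ∀ x x', Kbar x x' = Kbar x' x) (η₀ : ℝ) (t : ℕ) (x x' : 𝒳) :
    covLimit Kcov Kbar X η₀ t x x' =
      Kcov x x' - ∑ j, evolutionRow Kbar X η₀ t x j * Kcov (X j) x' -
        ∑ j, evolutionRow Kbar X η₀ t x' j * Kcov (X j) x +
        ∑ i, ∑ j, evolutionRow Kbar X η₀ t x i * evolutionRow Kbar X η₀ t x' j *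
          Kcov (X i) (X j) := by
  have hG : (gram Kbar X)ᵀ = gram Kbar X := by
    ext i j
    exact hsym _ _
  have hE : (evolution Kbar X η₀ t)ᵀ = evolution Kbar X η₀ t := by
    rw [evolution, Matrix.transpose_sub, Matrix.transpose_pow, Matrix.transpose_sub,
      Matrix.transpose_one, Matrix.transpose_smul, hG]
  have hrow : (evolution Kbar X η₀ t * (gram Kbar X)⁻¹).mulVec (fun j => Kbar (X j) x') =
      evolutionRow Kbar X η₀ t x' := by
    rw [evolutionRow, ← Matrix.mulVec_transpose, Matrix.transpose_mul, hE,
      Matrix.transpose_nonsing_inv, hG]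
    congr 1
    ext j
    exact hsym _ _
  have hlast : (fun j => Kbar x (X j)) ⬝ᵥ
        (((gram Kbar X)⁻¹ * evolution Kbar X η₀ t * gram Kcov X * evolution Kbar X η₀ t *
          (gram Kbar X)⁻¹).mulVec fun j => Kbar (X j) x') =
      ∑ i, ∑ j, evolutionRow Kbar X η₀ t x i * evolutionRow Kbar X η₀ t x' j *
        Kcov (X i) (X j) := by
    rw [Matrix.mul_assoc _ (evolution Kbar X η₀ t) (gram Kbar X)⁻¹,
      Matrix.mul_assoc _ (gram Kcov X),
      ← Matrix.mulVec_mulVec _ ((gram Kbar X)⁻¹ * evolution Kbar X η₀ t),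
      ← Matrix.mulVec_mulVec _ (gram Kcov X), hrow,
      Matrix.dotProduct_mulVec]
    simp only [dotProduct, Matrix.mulVec, Finset.mul_sum]
    refine Finset.sum_congr rfl fun i _ => Finset.sum_congr rfl fun j _ => ?_
    simp only [evolutionRow, gram, Matrix.of_apply]
    ring
  rw [covLimit, hlast, Matrix.dotProduct_mulVec, Matrix.dotProduct_mulVec]
  rfl

end Limit

/-! ### Noisy training lies in the linearized regime -/

section Regime

variable {𝒳 : Type*} {C : (m : ℕ) → Circuit 𝒳 m} {N NK : ℕ → ℝ} {n : ℕ} {X : Fin n → 𝒳}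
  {Y : Fin n → ℝ} {Kcov Kbar : 𝒳 → 𝒳 → ℝ} {η₀ δ : ℝ} {T : ℕ}
  {Ω : ℕ → Type*} [∀ m, MeasurableSpace (Ω m)] {P : (m : ℕ) → Measure (Ω m)}
  {Θ₀ : (m : ℕ) → Ω m → (C m).Params}
  {g : (m : ℕ) → ℕ → (C m).Params → Ω m → (C m).Params} {η : ℕ → ℝ}

lemma integral_init
    (htrain : ∀ m, (C m).IsNoisyTraining (N m) X Y (η m) T (P m) (Θ₀ m) (g m))
    (m : ℕ) {F : (C m).Params → ℝ} (hF : Continuous F) :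
    ∫ ω, F (Θ₀ m ω) ∂P m = ∫ Θ, F Θ ∂(C m).initLaw :=
  (htrain m).law_init.integral_comp hF.aestronglyMeasurable

variable [∀ m, IsProbabilityMeasure (P m)]

lemma integrable_init
    (htrain : ∀ m, (C m).IsNoisyTraining (N m) X Y (η m) T (P m) (Θ₀ m) (g m))
    (m : ℕ) {F : (C m).Params → ℝ} (hF : Continuous F) {B : ℝ} (hB : ∀ Θ, |F Θ| ≤ B) :
    Integrable (fun ω => F (Θ₀ m ω)) (P m) :=
  integrable_of_abs_le (hF.measurable.comp (htrain m).measurable_init).aestronglyMeasurable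
    fun _ => hB _

/-- The second moments converge. -/
lemma boundedInProb_init_model (hinit : InitAssumption C N Kcov)
    (htrain : ∀ m, (C m).IsNoisyTraining (N m) X Y (η m) T (P m) (Θ₀ m) (g m)) (x : 𝒳) :
    BoundedInProb P fun p => (C p.1).model (N p.1) (Θ₀ p.1 p.2) x := by
  have hcont : ∀ m, Continuous fun Θ => (C m).model (N m) Θ x ^ 2 := fun m =>
    ((C m).continuous_model (N m) x).pow 2
  refine BoundedInProb.of_sq (BoundedInProb.of_integral_le (c := Kcov x x + 1)
    (fun _ => sq_nonneg _) (.of_forall fun m => ?_) ?_)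
  · refine integrable_init htrain m (hcont m) (B := (|1 / N m| * m) ^ 2) fun Θ => ?_
    rw [abs_pow]
    exact pow_le_pow_left₀ (abs_nonneg _) ((C m).abs_model_le (N m) Θ x) 2
  · filter_upwards [(hinit.tendsto_integral_sq x).eventually_le_const (lt_add_one _)] with m hm
    exact (integral_init htrain m (hcont m)).trans_le hm

/-- The variance of the empirical kernel vanishes and its mean converges. -/
lemma tendsto_init_kernel (hinit : InitAssumption C N Kcov) (hntk : NTKAssumption C N NK Kbar X)
    (hN : Tendsto N atTop atTop) (hG : Growth C N)
    (htrain : ∀ m, (C m).IsNoisyTraining (N m) X Y (η m) T (P m) (Θ₀ m) (g m)) (x x' : 𝒳) :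
    Tendsto (fun p => (C p.1).empiricalNTK (N p.1) (NK p.1) (Θ₀ p.1 p.2) x x')
      (aas P) (𝓝 (Kbar x x')) := by
  have hcont : ∀ m, Continuous fun Θ => ((C m).empiricalNTK (N m) (NK m) Θ x x' -
      (C m).analyticNTK (N m) (NK m) x x') ^ 2 := fun m =>
    (((C m).continuous_empiricalNTK (N m) (NK m) x x').sub continuous_const).pow 2
  have h1 : Tendsto (fun p : Σ m, Ω m => ((C p.1).empiricalNTK (N p.1) (NK p.1) (Θ₀ p.1 p.2) x x' -
      (C p.1).analyticNTK (N p.1) (NK p.1) x x') ^ 2) (aas P) (𝓝 0) := by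
    refine tendsto_aas_of_integral (fun _ => sq_nonneg _) (fun m => ?_) ?_
    · refine integrable_init htrain m (hcont m) (B := ((|1 / NK m| *
        ∑ _i : Fin (C m).depth × Fin m, (|1 / N m| * ((C m).maxFuture * 2)) ^ 2) +
        |(C m).analyticNTK (N m) (NK m) x x'|) ^ 2) fun Θ => ?_
      rw [abs_pow]
      exact pow_le_pow_left₀ (abs_nonneg _) ((abs_sub _ _).trans
        (add_le_add_left ((C m).abs_empiricalNTK_le (N m) (NK m) Θ x x') _)) 2
    · exact (tendsto_variance_empiricalNTK hinit hntk hN hG x x').congr fun m =>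
        (integral_init htrain m (hcont m)).symm
  have h2 := (Real.continuous_sqrt.tendsto 0).comp h1
  rw [Real.sqrt_zero] at h2
  have h3 := (tendsto_zero_iff_abs_tendsto_zero _).2
    (h2.congr fun p => Real.sqrt_sq_eq_abs _)
  simpa using h3.add ((hntk.tendsto.tendsto_at (x, x')).comp (tendsto_fst_aas (P := P)))

/-- The weighted second moment is a sum of `|Θ|` variance bounds with the prefactor `(|ℳ| |Θ| n η₀ /
N_K)²`. The powers of `|ℳ|`, `|Θ|`, `n` and `N_K` in the variance bound cancel these exactly,
leaving a constant independent of `m`. -/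
lemma boundedInProb_training_noise (hinit : InitAssumption C N Kcov)
    (hntk : NTKAssumption C N NK Kbar X)
    (hN : Tendsto N atTop atTop) (hδ : 0 < δ)
    (htrain : ∀ m, (C m).IsNoisyTraining (N m) X Y (n / NK m * η₀) T (P m) (Θ₀ m) (g m))
    {t : ℕ} (ht : t ≤ T)
    (hvar : ∀ m, ∀ i, condVar ((C m).history (n / NK m * η₀) (Θ₀ m) (g m) t)
      (fun ω => g m t ((C m).iterate (n / NK m * η₀) (Θ₀ m) (g m) t ω) ω i) (P m)
        ≤ᵐ[P m] fun ω =>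
          1 / (864 * Real.pi ^ 2) * η₀ ^ 2 * (minEigenvalue (gram Kbar X) ^ 4 / (n : ℝ) ^ 2) *
            (NK m ^ 2 / (((C m).maxFuture : ℝ) ^ 2 * (((C m).depth * m : ℕ) : ℝ) ^ 3)) *
            ((δ / 4) / ((t : ℝ) + 1) ^ 2) *
            (C m).loss (N m) X Y ((C m).iterate (n / NK m * η₀) (Θ₀ m) (g m) t ω)) :
    BoundedInProb P fun p => (1 + (C p.1).loss (N p.1) X Y
      ((C p.1).iterate (n / NK p.1 * η₀) (Θ₀ p.1) (g p.1) t p.2))⁻¹ *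
      (((C p.1).maxFuture * ((C p.1).depth * p.1 : ℕ)) * l2 ((n / NK p.1 * η₀) •
        (C p.1).noise (N p.1) X Y (n / NK p.1 * η₀) (Θ₀ p.1) (g p.1) t p.2)) ^ 2 := by
  have := hntk.nonempty
  obtain ⟨c, hc, hNK⟩ := eventually_le_normalization hinit hntk
  set K : ℕ → ℝ := fun m => 1 / (864 * Real.pi ^ 2) * η₀ ^ 2 *
    (minEigenvalue (gram Kbar X) ^ 4 / (n : ℝ) ^ 2) *
    (NK m ^ 2 / (((C m).maxFuture : ℝ) ^ 2 * (((C m).depth * m : ℕ) : ℝ) ^ 3)) *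
    ((δ / 4) / ((t : ℝ) + 1) ^ 2) with hK
  have hK0 : ∀ m, 0 ≤ K m := fun m => by positivity
  have hb := fun m i => (htrain m).integral_noise_sq_le ht (hK0 m) (hvar m i)
  have hl : ∀ p : Σ m, Ω m, 0 ≤ (1 + (C p.1).loss (N p.1) X Y
      ((C p.1).iterate (n / NK p.1 * η₀) (Θ₀ p.1) (g p.1) t p.2))⁻¹ := fun p =>
    inv_nonneg.2 (add_nonneg zero_le_one ((C p.1).loss_nonneg (N p.1) X Y _))
  have heq : ∀ m ω, (1 + (C m).loss (N m) X Y
      ((C m).iterate (n / NK m * η₀) (Θ₀ m) (g m) t ω))⁻¹ *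
      (((C m).maxFuture * ((C m).depth * m : ℕ)) * l2 ((n / NK m * η₀) •
        (C m).noise (N m) X Y (n / NK m * η₀) (Θ₀ m) (g m) t ω)) ^ 2 =
      (((C m).maxFuture * ((C m).depth * m : ℕ)) * (n / NK m * η₀)) ^ 2 *
      ∑ i, (1 + (C m).loss (N m) X Y ((C m).iterate (n / NK m * η₀) (Θ₀ m) (g m) t ω))⁻¹ *
        (C m).noise (N m) X Y (n / NK m * η₀) (Θ₀ m) (g m) t ω i ^ 2 := fun m ω => by
    rw [← Finset.mul_sum, ← l2_sq, l2_smul, mul_pow, mul_pow |_|, sq_abs]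
    ring
  have hsum := fun m => integrable_finsetSum (μ := P m) Finset.univ fun i _ => (hb m i).1
  refine BoundedInProb.of_integral_le (c := η₀ ^ 4 * (1 / (864 * Real.pi ^ 2)) *
    minEigenvalue (gram Kbar X) ^ 4 * ((δ / 4) / ((t : ℝ) + 1) ^ 2))
    (fun p => mul_nonneg (hl p) (sq_nonneg _)) (.of_forall fun m => ?_) ?_
  · simp only [heq]
    exact (hsum m).const_mul _
  · filter_upwards [hNK, hinit.eventually_one_le hN] with m hm ⟨h1, h2, h3, h4⟩
    simp only [heq]
    rw [integral_const_mul, integral_finsetSum _ fun i _ => (hb m i).1]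
    refine (mul_le_mul_of_nonneg_left (Finset.sum_le_sum fun i _ => (hb m i).2)
      (sq_nonneg _)).trans_eq ?_
    rw [Finset.sum_const, Finset.card_univ, Fintype.card_prod, Fintype.card_fin, Fintype.card_fin,
      nsmul_eq_mul, hK]
    have hNK0 : NK m ≠ 0 := (hc.trans_le hm).ne'
    have hn : (n : ℝ) ≠ 0 := by exact_mod_cast hntk.pos.ne'
    have hM : ((C m).maxFuture : ℝ) ≠ 0 := by positivity
    have hL : (((C m).depth * m : ℕ) : ℝ) ≠ 0 := by
      rw [Nat.cast_mul]
      positivity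
    have hd : ((t : ℝ) + 1) ≠ 0 := by positivity
    field_simp

lemma lazyDescent (hinit : InitAssumption C N Kcov) (hntk : NTKAssumption C N NK Kbar X)
    (hN : Tendsto N atTop atTop) (hG : Growth C N) (hδ : 0 < δ)
    (htrain : ∀ m, (C m).IsNoisyTraining (N m) X Y (n / NK m * η₀) T (P m) (Θ₀ m) (g m))
    (hvar : ∀ m, ∀ t ≤ T, ∀ i, condVar ((C m).history (n / NK m * η₀) (Θ₀ m) (g m) t)
      (fun ω => g m t ((C m).iterate (n / NK m * η₀) (Θ₀ m) (g m) t ω) ω i) (P m)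
        ≤ᵐ[P m] fun ω =>
          1 / (864 * Real.pi ^ 2) * η₀ ^ 2 * (minEigenvalue (gram Kbar X) ^ 4 / (n : ℝ) ^ 2) *
            (NK m ^ 2 / (((C m).maxFuture : ℝ) ^ 2 * (((C m).depth * m : ℕ) : ℝ) ^ 3)) *
            ((δ / 4) / ((t : ℝ) + 1) ^ 2) *
            (C m).loss (N m) X Y ((C m).iterate (n / NK m * η₀) (Θ₀ m) (g m) t ω)) :
    LazyDescent C N NK X Y Kbar η₀ T P
      (fun t p => (C p.1).iterate (n / NK p.1 * η₀) (Θ₀ p.1) (g p.1) t p.2)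
      (fun t p => (C p.1).noise (N p.1) X Y (n / NK p.1 * η₀) (Θ₀ p.1) (g p.1) t p.2) := by
  have := hntk.nonempty
  exact
  { pos := hntk.pos
    apply_comm := hntk.apply_comm
    tendsto_inv := by simpa using hN.inv_tendsto_atTop.abs
    tendsto_curvature := hinit.tendsto_curvature hN hG
    normalization := by
      obtain ⟨c, hc, hNK⟩ := eventually_le_normalization hinit hntk
      refine ⟨1 / c, hNK.mono fun m hm => ?_⟩
      rw [abs_of_pos (one_div_pos.2 (hc.trans_le hm))]
      exact one_div_le_one_div_of_le hc hm
    one_le_size := (hinit.eventually_one_le hN).mono fun m ⟨h1, h2, h3, _⟩ => by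
      rw [Nat.cast_mul]
      exact one_le_mul_of_one_le_of_one_le h3 (one_le_mul_of_one_le_of_one_le h1 h2)
    step := fun t p => by
      rw [sub_sub, ← smul_add]
      have : (fun i => partialDeriv ((C p.1).loss (N p.1) X Y) i
          ((C p.1).iterate (n / NK p.1 * η₀) (Θ₀ p.1) (g p.1) t p.2)) +
          (C p.1).noise (N p.1) X Y (n / NK p.1 * η₀) (Θ₀ p.1) (g p.1) t p.2 =
          g p.1 t ((C p.1).iterate (n / NK p.1 * η₀) (Θ₀ p.1) (g p.1) t p.2) p.2 := by
        ext i
        rw [Pi.add_apply, Circuit.noise, add_sub_cancel]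
      rw [this]
      rfl
    init_model := boundedInProb_init_model hinit htrain
    init_kernel := tendsto_init_kernel hinit hntk hN hG htrain
    noise := fun t ht => boundedInProb_training_noise hinit hntk hN hδ htrain ht.le
      fun m i => hvar m t ht.le i }

/-- At initialization the model converges in distribution to a centered Gaussian vector. -/
lemma tendstoInDistribution_init [Fintype 𝒳] [DecidableEq 𝒳] [Nonempty 𝒳]
    (hinit : InitAssumption C N Kcov)
    (hN : Tendsto N atTop atTop) (hG : Growth C N)
    (htrain : ∀ m, (C m).IsNoisyTraining (N m) X Y (η m) T (P m) (Θ₀ m) (g m)) :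
    TendstoInDistribution
      (fun m ω => WithLp.toLp 2 fun x => (C m).model (N m) (Θ₀ m ω) x) atTop
      (fun z : EuclideanSpace ℝ 𝒳 => z) P (multivariateGaussian 0 (Matrix.of Kcov)) := by
  refine tendstoInDistribution_of_charFun
    (F := fun x (p : Σ m, Ω m) => (C p.1).model (N p.1) (Θ₀ p.1 p.2) x)
    (fun x m => ((C m).continuous_model (N m) x).measurable.comp (htrain m).measurable_init)
    fun a => ?_
  have h := hinit.tendsto_charFun hN hG a
  have e : charFun (multivariateGaussian 0 (Matrix.of Kcov)) a =
      Complex.exp (-(((∑ x, ∑ x', a x * a x' * Kcov x x' : ℝ) : ℂ) / 2)) := by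
    rw [charFun_multivariateGaussian hinit.posSemidef, inner_zero_right, Complex.ofReal_zero,
      zero_mul, zero_sub]
    congr 4
    simp only [dotProduct, Matrix.mulVec, Finset.mul_sum, Matrix.of_apply]
    exact Finset.sum_congr rfl fun x _ => Finset.sum_congr rfl fun x' _ => by ring
  rw [e]
  refine h.congr fun m => ((htrain m).law_init.integral_comp ?_).symm
  exact (Complex.continuous_exp.comp (continuous_const.mul (Complex.continuous_ofReal.comp
    (continuous_finsetSum _ fun x _ => continuous_const.mul
      ((C m).continuous_model (N m) x))))).aestronglyMeasurable

end Regime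

end QNN

end

/-! ### Convergence of the trained model -/

open MeasureTheory ProbabilityTheory Filter Topology

theorem theorem6p9 {𝒳 : Type*} [Fintype 𝒳]
    -- a sequence of circuits, one for each number `m` of qubits, and the normalizations
    (C : (m : ℕ) → QNN.Circuit 𝒳 m) (N NK : ℕ → ℝ)
    -- the training set
    {n : ℕ} (X : Fin n → 𝒳) (Y : Fin n → ℝ)
    -- the limiting covariance and the limiting neural tangent kernel
    (Kcov Kbar : 𝒳 → 𝒳 → ℝ)
    (hinit : QNN.InitAssumption C N Kcov)
    (hntk : QNN.NTKAssumption C N NK Kbar X)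
    (hN : Tendsto N atTop atTop)
    (hgrowth : Tendsto (fun m : ℕ =>
        ((C m).depth : ℝ) ^ 2 * (m : ℝ) ^ 2 * ((C m).maxFuture : ℝ) ^ 6 *
          ((C m).maxPast : ℝ) ^ 4 / N m ^ 5 * Real.log (N m)) atTop (𝓝 0))
    -- noisy training with learning rate `η = n η₀ / N_K(m)`
    (η₀ : ℝ) (hη₀ : 0 < η₀) (δ : ℝ) (hδ : 0 < δ) (T : ℕ)
    {Ω : ℕ → Type*} [∀ m, MeasurableSpace (Ω m)]
    (P : (m : ℕ) → Measure (Ω m)) [∀ m, IsProbabilityMeasure (P m)]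
    (Θ₀ : (m : ℕ) → Ω m → (C m).Params)
    (g : (m : ℕ) → ℕ → (C m).Params → Ω m → (C m).Params)
    (htrain : ∀ m, (C m).IsNoisyTraining (N m) X Y (n / NK m * η₀) T (P m) (Θ₀ m) (g m))
    -- the bound on the conditional variance of the estimator
    (hvar : ∀ m, ∀ t ≤ T, ∀ i,
      condVar ((C m).history (n / NK m * η₀) (Θ₀ m) (g m) t)
          (fun ω => g m t ((C m).iterate (n / NK m * η₀) (Θ₀ m) (g m) t ω) ω i) (P m)
        ≤ᵐ[P m] fun ω =>
          1 / (864 * Real.pi ^ 2) * η₀ ^ 2 *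
            (QNN.minEigenvalue (QNN.gram Kbar X) ^ 4 / (n : ℝ) ^ 2) *
            (NK m ^ 2 / (((C m).maxFuture : ℝ) ^ 2 * (((C m).depth * m : ℕ) : ℝ) ^ 3)) *
            ((δ / 4) / ((t : ℝ) + 1) ^ 2) *
            (C m).loss (N m) X Y ((C m).iterate (n / NK m * η₀) (Θ₀ m) (g m) t ω)) :
    ∀ t ≤ T, ∃ ν : ProbabilityMeasure (𝒳 → ℝ),
      IsGaussianProcess (fun (x : 𝒳) (z : 𝒳 → ℝ) => z x) (ν : Measure (𝒳 → ℝ)) ∧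
      (∀ x, ∫ z, z x ∂(ν : Measure (𝒳 → ℝ)) = QNN.meanLimit Kbar X Y η₀ t x) ∧
      (∀ x x', covariance (fun z : 𝒳 → ℝ => z x) (fun z => z x') (ν : Measure (𝒳 → ℝ))
        = QNN.covLimit Kcov Kbar X η₀ t x x') ∧
      TendstoInDistribution
        (fun m ω x => (C m).model (N m)
          ((C m).iterate (n / NK m * η₀) (Θ₀ m) (g m) t ω) x)
        atTop (fun z : 𝒳 → ℝ => z) P (ν : Measure (𝒳 → ℝ)) := by
  classical
  open QNN in
  intro t ht
  have := hntk.nonempty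
  set μ₀ := multivariateGaussian (0 : EuclideanSpace ℝ 𝒳) (Matrix.of Kcov)
  set w := evolutionRow Kbar X η₀ t
  -- The limit vector: the affine solution of linearized training, applied to the Gaussian limit at
  -- initialization.
  set Z : EuclideanSpace ℝ 𝒳 → 𝒳 → ℝ := fun z => affineUpdate w X Y (WithLp.ofLp z) with hZ
  have hZc : Continuous Z := (continuous_affineUpdate w X Y).comp (PiLp.continuous_ofLp 2 _)
  have hZm : AEMeasurable Z μ₀ := hZc.measurable.aemeasurable
  have hlazy := lazyDescent hinit hntk hN hgrowth hδ htrain hvar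
  have h0 := tendstoInDistribution_init hinit hN hgrowth htrain
  -- The continuous mapping theorem for linearized training; Slutsky's lemma then replaces it by the
  -- actual training.
  have h1 := h0.continuous_comp (g := fun z => WithLp.toLp 2 (Z z))
    ((PiLp.continuous_toLp 2 _).comp hZc)
  have h2 := tendstoInDistribution_of_tendsto_sub
    (F := fun x (p : Σ m, Ω m) => (C p.1).model (N p.1)
      ((C p.1).iterate (n / NK p.1 * η₀) (Θ₀ p.1) (g p.1) t p.2) x)
    (G := fun x (p : Σ m, Ω m) => affineUpdate w X Y
      (fun x => (C p.1).model (N p.1) (Θ₀ p.1 p.2) x) x)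
    (fun x m => (htrain m).measurable_model ht x)
    (fun x m => (continuous_apply x).measurable.comp
      ((continuous_affineUpdate w X Y).measurable.comp (measurable_pi_lambda _ fun x =>
        ((C m).continuous_model (N m) x).measurable.comp (htrain m).measurable_init)))
    (fun x => by
      have h := (hlazy.linearization ht).2 x
      simp only [iterate_linStep_eq_affineUpdate hntk.isUnit_det_gram] at h
      exact h) h1
  have h3 := h2.continuous_comp (g := fun z : EuclideanSpace ℝ 𝒳 => (WithLp.ofLp z : 𝒳 → ℝ))
    (PiLp.continuous_ofLp 2 _)
  -- The law is carried from Euclidean space, where characteristic functions are taken, to the space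
  -- of functions on `𝒳`.
  obtain ⟨ν, hν⟩ : ∃ ν : ProbabilityMeasure (𝒳 → ℝ), (ν : Measure (𝒳 → ℝ)) = μ₀.map Z :=
    ⟨⟨μ₀.map Z, Measure.isProbabilityMeasure_map hZm⟩, rfl⟩
  refine ⟨ν, ⟨fun I => ⟨?_⟩⟩, fun x => ?_, fun x x' => ?_, h3.forall_aemeasurable,
    aemeasurable_id, ?_⟩
  · have h := ((isGaussianProcess_affineUpdate (S := Matrix.of Kcov) w X Y).hasGaussianLaw
      I).isGaussian_map
    rw [hν, Measure.map_map (by fun_prop) hZc.measurable]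
    exact h
  · rw [hν, integral_map hZm (continuous_apply x).aestronglyMeasurable, meanLimit_eq]
    exact integral_affineUpdate w X Y x
  · rw [hν, covariance_map_fun (continuous_apply x).aestronglyMeasurable
      (continuous_apply x').aestronglyMeasurable hZm, covLimit_eq hntk.apply_comm]
    exact covariance_affineUpdate w X Y hinit.posSemidef x x'
  · convert! h3.tendsto using 2
    refine congrArg 𝓝 (Subtype.ext ?_)
    change Measure.map (fun z => z) (ν : Measure (𝒳 → ℝ)) = μ₀.map Z
    rw [Measure.map_id', hν]
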